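/- Let $n,a,\ell$ be natural numbers with $n\ge 3$, $a<\ell$ and $\ell\ge 2a^2\left(a+\frac n2-1\right)-\frac n2$. Let $dx$ be the rotation-invariant probability measure on the sphere $S^{n-1}\subset\mathbb R^n$ and $\omega_m=2\pi^{m/2}/\Gamma(m/2)$. Call a matrix $A$ on $(\mathbb R^n)^{\otimes k}$ *maximally symmetric* if its vectorization $|A\rangle\in(\mathbb R^n)^{\otimes 2k}$, $|A\rangle=\sum_{u,v}A_{uv}|u\rangle|v\rangle$ (sum over the standard product basis), is invariant under all permutations in $S_{2k}$ of the $2k$ tensor factors, and a *state* if $A\ge 0$ and $\operatorname{tr}A=1$. For a homogeneous real polynomial $F$ of degree $2k$ in $n$ variables, let $Z_F$ be its polynomial matrix, i.e. the unique maximally symmetric matrix on $(\mathbb R^n)^{\otimes k}$ with $\langle x|^{\otimes k}Z_F|x\rangle^{\otimes k}=F(x)$ for all $x\in\mathbb R^n$: if $F=\sum_{\mathbf i}\alpha_{\mathbf i}x^{\mathbf i}$, then $(Z_F)_{uv}=\alpha_{\mathbf i}\,\mathbf i!/(2k)!$, where $\mathbf i$ counts the occurrences of the indices $1,\dots,n$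 in the pair of words $(u,v)$. For maximally symmetric $A$ on $(\mathbb R^n)^{\otimes k}$ put $$\|A\|_{F1}:=\sup\left\{\operatorname{tr}(Z_FA)\;:\;F\text{ homogeneous of degree }2k,\ \|F\|_\infty=\max_{x\in S^{n-1}}|F(x)|\le 1\right\}.$$ Let $M$ be a maximally symmetric state on $(\mathbb R^n)^{\otimes\ell}$, let $Q_M(x)=\langle x|^{\otimes\ell}M|x\rangle^{\otimes\ell}$ be its $Q$-representation, let $M_a$ be the reduced matrix on $(\mathbb R^n)^{\otimes a}$, obtained from $M$ by the partial trace over the last $\ell-a$ tensor factors, and let $$\tilde M_a:=\left(\frac{2^{2\ell}\,\omega_n}{\sqrt\pi\,\omega_{n-1}}\,\frac{\Gamma(\ell+1)\,\Gamma\left(\ell+\frac n2\right)}{\Gamma\left(\frac{n-1}2\right)\Gamma(2\ell+1)}\right)\int_{S^{n-1}}Q_M(x)\,|x\rangle\langle x|^{\otimes a}\,dx .$$ Then $$\left\|M_a-\tilde M_a\right\|_{F1}\le\frac{4a^2\left(a+\frac n2-1\right)}{2\ell+n}$$ (in particular the supremum is finite). Furthermore, $\tilde M_a$ is a state ($\tilde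 M_a\ge0$ and $\operatorname{tr}\tilde M_a=1$), it has a positive $P$-representation, i.e. $\tilde M_a=\int_{S^{n-1}}P(x)\,|x\rangle\langle x|^{\otimes a}\,dx$ for some square-integrable function $P\ge0$ on $S^{n-1}$, and it is a moment matrix, i.e. it is maximally symmetric and $\tilde M_a=\int_{S^{n-1}}|x\rangle\langle x|^{\otimes a}\,d\mu(x)$ for some Borel probability measure $\mu$ on $S^{n-1}$. -/

import Mathlib

open MeasureTheory

namespace RealDeFinetti

noncomputable section

/-- Operators on the `l`-fold tensor power of `ℝⁿ`, as matrices in the product basis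
`|i₁⟩ ⊗ ⋯ ⊗ |i_l⟩`, which is indexed by the words `i : Fin l → Fin n`. -/
abbrev TensorMatrix (n l : ℕ) : Type :=
  Matrix (Fin l → Fin n) (Fin l → Fin n) ℝ

/-- The unit sphere `S^{n-1}` of `ℝⁿ`. -/
abbrev USphere (n : ℕ) : Type :=
  Metric.sphere (0 : EuclideanSpace ℝ (Fin n)) 1

/-- The rotation invariant surface measure on `S^{n-1}`, normalized to total mass one. -/
def sphereMeasure (n : ℕ) : Measure (USphere n) :=
  ((volume : Measure (EuclideanSpace ℝ (Fin n))).toSphere Set.univ)⁻¹ •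
    (volume : Measure (EuclideanSpace ℝ (Fin n))).toSphere

/-- The surface area `ω_n = 2 π^{n/2} / Γ(n/2)` of `S^{n-1}`. -/
def sphereArea (n : ℕ) : ℝ :=
  2 * Real.pi ^ ((n : ℝ) / 2) / Real.Gamma ((n : ℝ) / 2)

/-- The product vector `|x⟩^{⊗ l}`. -/
def tensorPow {n : ℕ} (l : ℕ) (x : EuclideanSpace ℝ (Fin n)) : (Fin l → Fin n) → ℝ :=
  fun i => ∏ k, x (i k)

/-- The rank one operator `|x⟩⟨x|^{⊗ l}`. -/
def tensorProj {n : ℕ} (l : ℕ) (x : EuclideanSpace ℝ (Fin n)) : TensorMatrix n l :=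
  Matrix.vecMulVec (tensorPow l x) (tensorPow l x)

/-- The vectorization `|M⟩` in the `2l`-fold tensor power: the word of length `2l` is split into
the first `l` letters (the row) and the last `l` letters (the column). -/
def vectorize {n l : ℕ} (M : TensorMatrix n l) : (Fin l ⊕ Fin l → Fin n) → ℝ :=
  fun w => M (fun k => w (Sum.inl k)) (fun k => w (Sum.inr k))

/-- `M` is maximally symmetric: `|M⟩` is fixed by all permutations of its `2l` tensor factors. -/
def IsMaxSym {n l : ℕ} (M : TensorMatrix n l) : Prop :=
  ∀ (π : Equiv.Perm (Fin l ⊕ Fin l)) (w : Fin l ⊕ Fin l → Fin n),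
    vectorize M (w ∘ π) = vectorize M w

/-- `M` is a state: positive semidefinite (in particular symmetric) of trace one. -/
def IsState {n l : ℕ} (M : TensorMatrix n l) : Prop :=
  M.PosSemidef ∧ M.trace = 1

/-- The reduced matrix: the last `l - a` tensor factors are traced out. -/
def reducedMatrix {n l : ℕ} (a : ℕ) (h : a ≤ l) (M : TensorMatrix n l) : TensorMatrix n a :=
  Matrix.of fun i j => ∑ w : Fin (l - a) → Fin n,
    M (Fin.append i w ∘ Fin.cast (Nat.add_sub_of_le h).symm)
      (Fin.append j w ∘ Fin.cast (Nat.add_sub_of_le h).symm)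

/-- The `Q`-representation `Q_M(x) = ⟨x|^{⊗ l} M |x⟩^{⊗ l}`. -/
def qRep {n l : ℕ} (M : TensorMatrix n l) (x : EuclideanSpace ℝ (Fin n)) : ℝ :=
  tensorPow l x ⬝ᵥ M.mulVec (tensorPow l x)

/-- The exponent vector of the monomial `x_{w_1} x_{w_2} ⋯` of a word `w`. -/
def wordExponent {n : ℕ} {ι : Type*} [Fintype ι] (w : ι → Fin n) : Fin n →₀ ℕ :=
  ∑ k, Finsupp.single (w k) 1

/-- The polynomial matrix `Z_F` of a homogeneous polynomial `F = ∑ α_i x^i` of degree `2a`: the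
maximally symmetric matrix whose vectorization is `|Z_F⟩ = ∑ √(i!/(2a)!) α_i |i⟩`, where
`|i⟩ = ((2a)! i!)^{-1/2} ∑_π π (|1⟩^{⊗ i_1} ⊗ ⋯ ⊗ |n⟩^{⊗ i_n})` is the number state basis of the
symmetric subspace. The value of `|i⟩` at a word with exponent vector `i` is
`√(i!/(2a)!)`, so the entry of `|Z_F⟩` there is `α_i i!/(2a)!`. -/
def polyMatrix {n : ℕ} (a : ℕ) (F : MvPolynomial (Fin n) ℝ) : TensorMatrix n a :=
  Matrix.of fun u v =>
    F.coeff (wordExponent u + wordExponent v) *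
      (∏ k, ((wordExponent u + wordExponent v) k).factorial : ℕ) / ((2 * a).factorial : ℝ)

/-- `‖F‖_∞`, the maximum of `|F|` on the sphere. -/
def sphereSupNorm {n : ℕ} (F : MvPolynomial (Fin n) ℝ) : ℝ :=
  ⨆ x : USphere n, |MvPolynomial.eval (fun k => (x : EuclideanSpace ℝ (Fin n)) k) F|

/-- The numbers `tr(Z_F A)`, for `F` homogeneous of degree `2a` with `‖F‖_∞ ≤ 1`. -/
def f1Values {n a : ℕ} (A : TensorMatrix n a) : Set ℝ :=
  {r | ∃ F : MvPolynomial (Fin n) ℝ, F.IsHomogeneous (2 * a) ∧ sphereSupNorm F ≤ 1 ∧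
    r = (polyMatrix a F * A).trace}

/-- The `F1`-norm `‖A‖_{F1} = sup_{‖F‖_∞ ≤ 1} tr(Z_F A)`. -/
def f1Norm {n a : ℕ} (A : TensorMatrix n a) : ℝ :=
  sSup (f1Values A)

/-- The normalization constant of the approximating matrix. -/
def normConst (n l : ℕ) : ℝ :=
  2 ^ (2 * l) * sphereArea n / (Real.sqrt Real.pi * sphereArea (n - 1)) *
    (Real.Gamma ((l : ℝ) + 1) * Real.Gamma ((l : ℝ) + (n : ℝ) / 2) /
      (Real.Gamma (((n : ℝ) - 1) / 2) * Real.Gamma (2 * (l : ℝ) + 1)))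

/-- The matrix `M̃_a = c ∫ Q_M(x) |x⟩⟨x|^{⊗ a} dx`, the integral being taken entrywise. -/
def approxMatrix {n l : ℕ} (a : ℕ) (M : TensorMatrix n l) : TensorMatrix n a :=
  Matrix.of fun i j => normConst n l *
    ∫ x : USphere n, qRep M (x : EuclideanSpace ℝ (Fin n)) *
      tensorProj a (x : EuclideanSpace ℝ (Fin n)) i j ∂(sphereMeasure n)

/-- `A` has a positive `P`-representation: `A = ∫ P(x) |x⟩⟨x|^{⊗ a} dx` with a pointwise
nonnegative square integrable function `P` on the sphere. -/
def HasPositivePRep {n a : ℕ} (A : TensorMatrix n a) : Prop :=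
  ∃ P : USphere n → ℝ, MemLp P 2 (sphereMeasure n) ∧ (∀ x, 0 ≤ P x) ∧
    ∀ i j, A i j =
      ∫ x : USphere n, P x * tensorProj a (x : EuclideanSpace ℝ (Fin n)) i j ∂(sphereMeasure n)

/-- `A` is a truncated moment matrix: `A` is maximally symmetric and `A = ∫ |x⟩⟨x|^{⊗ a} dμ(x)`
for a Borel probability measure `μ` on the sphere. -/
def IsMomentMatrix {n a : ℕ} (A : TensorMatrix n a) : Prop :=
  IsMaxSym A ∧ ∃ μ : Measure (USphere n), IsProbabilityMeasure μ ∧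
    ∀ i j, A i j = ∫ x : USphere n, tensorProj a (x : EuclideanSpace ℝ (Fin n)) i j ∂μ

end

end RealDeFinetti

open RealDeFinetti

/-!
Write `D = 2l + n`, and `s = ⟨x, y⟩²` for points `x`, `y` of the sphere.

A maximally symmetric `M` is a signed combination `∑ c_y |y⟩⟨y|^{⊗ l}` of product operators
(`IsMaxSym.exists_signed_representation`), and if `M` is a state, then the weights `c` have total
mass one and give every square of a form of degree at most `l` a nonnegative sum
(`IsPseudoDistribution`). Hence `F ↦ ∑ c_y F(y)` behaves like an expectation on low degree forms.

For a form `F` of degree `2a` let `p_y(s)` be the average of `F` over the circle of latitude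
`⟨x, y⟩² = s`. It is a polynomial of degree at most `a` in `s` with `p_y(1) = F(y)`, bounded on
`[0, 1]` by the maximum of `|F|` on the sphere (`exists_isZonalPoly`, `IsZonalPoly.abs_le`). As
`normConst` is the inverse of the mean of `s^l`, the number `tr(Z_F (M_a - M̃_a))` is the sum
`∑ c_y (p_y(1) - E_l p_y)`, where `E_l` is the mean weighted by `s^l`; here `E_l(1 - s) = (n-1)/D`
(`trace_polyMatrix_mul_sub`, `weightedMean_X_pow_one_sub`).

Two facts control this sum. A functional `Λ` of the zonal polynomials is again realized by a form,
`G(y) = Λ(p_y)` (`exists_form_of_functional`), so a bound on `Λ` over polynomials bounded by one on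
`[0, 1]` transfers to the sum, at the cost of the norm of `F ↦ ∑ c_y F(y)`. And the average of `F`
against a kernel that is a square in `y` of degree at most `2l` has a sum of at most one in
absolute value (`abs_sum_weightedMean_le`). The square of a Gegenbauer polynomial of degree `l` is
such a kernel, and for it the mean of `1 - s` is of order `1/D²`, by a virial identity
(`gegenKernel_virial`).

* If `a = 1`, a quadratic form that is nonnegative on the sphere is a sum of squares, so the norm
  in question is one, and `|p(1) - p(s)| ≤ 2 (1 - s)` suffices.
* If `a ≥ 3`, comparison with the Chebyshev polynomial gives `|p(1) - p(s)| ≤ 2 a² (1 - s)`, with an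
  improvement of second order (`abs_eval_one_sub_le`). The Gegenbauer kernel bounds the norm by
  `(1 - O(a²/D²))⁻¹`, and the improvement absorbs this factor.
* If `a = 2`, this loses too much. The sums over `y` of the `p_y` give one quadratic polynomial in
  `1 - s`, whose weighted means for the Gegenbauer kernel, for `s^{⌊n/2⌋}` and for the constant
  kernel are bounded by one, and the deviation is a combination of these three means
  (`three_kernel_bound`).

The statements on `M̃_a` itself hold since its density `normConst * Q_M` is continuous, nonnegative
and of integral one.
-/

namespace RealDeFinetti

/-! ### Moments of the uniform measure on the sphere -/

section

/-- Polar coordinates for a homogeneous function with a Gaussian weight. -/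
lemma integral_homogeneous_mul_exp {n : ℕ} (d : ℕ) (hn : 1 ≤ n)
    (f : EuclideanSpace ℝ (Fin n) → ℝ)
    (hf : ∀ (r : ℝ) (x : EuclideanSpace ℝ (Fin n)), f (r • x) = r ^ d * f x) :
    ∫ x, f x * Real.exp (-‖x‖ ^ 2) =
      (∫ x : USphere n, f x ∂(volume : Measure (EuclideanSpace ℝ (Fin n))).toSphere) *
        ∫ r in Set.Ioi (0 : ℝ), r ^ (d + (n - 1)) * Real.exp (-r ^ 2) := by
  have : Nonempty (Fin n) := ⟨⟨0, hn⟩⟩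
  have hdim : Module.finrank ℝ (EuclideanSpace ℝ (Fin n)) = n := by simp
  set μ : Measure (EuclideanSpace ℝ (Fin n)) := volume
  calc
    ∫ x, f x * Real.exp (-‖x‖ ^ 2) ∂μ
      = ∫ x : ({(0)}ᶜ : Set (EuclideanSpace ℝ (Fin n))),
          f x.1 * Real.exp (-‖x.1‖ ^ 2) ∂(μ.comap (↑)) := by
      rw [integral_subtype_comap (measurableSet_singleton _).compl
        fun x ↦ f x * Real.exp (-‖x‖ ^ 2), restrict_compl_singleton]
    _ = ∫ x, f x.1 * ((x.2 : ℝ) ^ d * Real.exp (-(x.2 : ℝ) ^ 2))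
          ∂μ.toSphere.prod (.volumeIoiPow (Module.finrank ℝ (EuclideanSpace ℝ (Fin n)) - 1)) := by
      rw [← μ.measurePreserving_homeomorphUnitSphereProd.integral_comp
        (Homeomorph.measurableEmbedding _)]
      refine integral_congr_ae (Filter.Eventually.of_forall fun x => ?_)
      have hx : (x : EuclideanSpace ℝ (Fin n)) ≠ 0 := x.2
      have hx' : ‖(x : EuclideanSpace ℝ (Fin n))‖ ≠ 0 := norm_ne_zero_iff.2 hx
      simp only [homeomorphUnitSphereProd_apply_snd_coe, homeomorphUnitSphereProd_apply_fst_coe]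
      rw [hf, inv_pow]
      field_simp
    _ = (∫ x : USphere n, f x ∂μ.toSphere) *
          ∫ r : Set.Ioi (0 : ℝ), (r : ℝ) ^ d * Real.exp (-(r : ℝ) ^ 2)
            ∂.volumeIoiPow (Module.finrank ℝ (EuclideanSpace ℝ (Fin n)) - 1) :=
      integral_prod_mul (fun x : USphere n => f x)
        (fun r : Set.Ioi (0 : ℝ) => (r : ℝ) ^ d * Real.exp (-(r : ℝ) ^ 2))
    _ = _ := by
      congr 1
      rw [hdim]
      simp only [Measure.volumeIoiPow, ENNReal.ofReal]
      rw [integral_withDensity_eq_integral_smul,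
        integral_subtype_comap measurableSet_Ioi fun a ↦ Real.toNNReal (a ^ (n - 1)) •
          (a ^ d * Real.exp (-a ^ 2)),
        setIntegral_congr_fun measurableSet_Ioi fun x hx ↦ ?_]
      · rw [NNReal.smul_def, Real.coe_toNNReal _ (pow_nonneg hx.out.le _), smul_eq_mul, pow_add]
        ring
      · exact (measurable_subtype_coe.pow_const _).real_toNNReal

/-- The Gaussian moment of the half line, for the weight `e^{-r²}`. -/
noncomputable def halfLineMoment (k : ℕ) : ℝ :=
  ∫ r in Set.Ioi (0 : ℝ), r ^ k * Real.exp (-r ^ 2)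

lemma halfLineMoment_eq (k : ℕ) : halfLineMoment k = 1 / 2 * Real.Gamma (((k : ℝ) + 1) / 2) := by
  have h := integral_rpow_mul_exp_neg_rpow (p := 2) (q := k) (by norm_num)
    (by have : (0 : ℝ) ≤ k := k.cast_nonneg
        linarith)
  rw [← h, halfLineMoment]
  simp only [Real.rpow_natCast, Real.rpow_two]

lemma halfLineMoment_pos (k : ℕ) : 0 < halfLineMoment k := by
  rw [halfLineMoment_eq]
  have := Real.Gamma_pos_of_pos (s := ((k : ℝ) + 1) / 2) (by positivity)
  positivity

lemma halfLineMoment_add_two (k : ℕ) :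
    halfLineMoment (k + 2) = ((k : ℝ) + 1) / 2 * halfLineMoment k := by
  rw [halfLineMoment_eq, halfLineMoment_eq]
  have : (((k + 2 : ℕ) : ℝ) + 1) / 2 = ((k : ℝ) + 1) / 2 + 1 := by push_cast; ring
  rw [this, Real.Gamma_add_one (by positivity)]
  ring

/-- The Gaussian moment of the line, for the weight `e^{-t²}`. -/
noncomputable def lineMoment (k : ℕ) : ℝ := ∫ t : ℝ, t ^ k * Real.exp (-t ^ 2)

lemma lineMoment_odd {k : ℕ} (hk : Odd k) : lineMoment k = 0 := by
  have h : lineMoment k = -lineMoment k := by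
    conv_lhs => rw [lineMoment, ← integral_neg_eq_self]
    rw [lineMoment, ← integral_neg]
    congr 1
    ext t
    rw [hk.neg_pow]
    ring_nf
  linarith

lemma lineMoment_even {k : ℕ} (hk : Even k) : lineMoment k = 2 * halfLineMoment k := by
  rw [halfLineMoment, lineMoment,
    ← integral_comp_abs (f := fun r => r ^ k * Real.exp (-r ^ 2))]
  simp only [hk.pow_abs, sq_abs]

lemma lineMoment_add_two (k : ℕ) :
    lineMoment (k + 2) = ((k : ℝ) + 1) / 2 * lineMoment k := by
  rcases Nat.even_or_odd k with hk | hk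
  · rw [lineMoment_even hk, lineMoment_even (hk.add even_two), halfLineMoment_add_two]
    ring
  · rw [lineMoment_odd hk, lineMoment_odd (hk.add_even even_two), mul_zero]

instance {n : ℕ} [NeZero n] : Nonempty (USphere n) :=
  ⟨⟨EuclideanSpace.single 0 1, by simp⟩⟩

variable {n : ℕ}

lemma toSphere_univ_ne_zero [NeZero n] :
    (volume : Measure (EuclideanSpace ℝ (Fin n))).toSphere Set.univ ≠ 0 := by
  rw [Ne, Measure.measure_univ_eq_zero]
  exact Measure.toSphere_ne_zero _

instance [NeZero n] : IsProbabilityMeasure (sphereMeasure n) := by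
  constructor
  rw [sphereMeasure, Measure.smul_apply, smul_eq_mul]
  exact ENNReal.inv_mul_cancel toSphere_univ_ne_zero (measure_ne_top _ _)

instance [NeZero n] : (sphereMeasure n).IsOpenPosMeasure := by
  constructor
  intro U hU hne
  rw [sphereMeasure, Measure.smul_apply, smul_eq_mul]
  exact mul_ne_zero (ENNReal.inv_ne_zero.2 (measure_ne_top _ _)) (hU.measure_ne_zero _ hne)

lemma integrable_of_continuous [NeZero n] {f : USphere n → ℝ} (hf : Continuous f)
    (μ : Measure (USphere n)) [IsFiniteMeasure μ] : Integrable f μ :=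
  hf.integrable_of_hasCompactSupport (HasCompactSupport.of_compactSpace f)

lemma integral_sphereMeasure (f : USphere n → ℝ) :
    ∫ x, f x ∂(sphereMeasure n) =
      ((volume : Measure (EuclideanSpace ℝ (Fin n))).toSphere Set.univ).toReal⁻¹ *
        ∫ x, f x ∂(volume : Measure (EuclideanSpace ℝ (Fin n))).toSphere := by
  rw [sphereMeasure, integral_smul_measure, ENNReal.toReal_inv, smul_eq_mul]

/-- The moments `∫ x^β dx` of the uniform measure on the sphere. -/
noncomputable def sphereMoment (β : Fin n → ℕ) : ℝ :=
  ∫ x : USphere n, ∏ k, (x : EuclideanSpace ℝ (Fin n)) k ^ β k ∂(sphereMeasure n)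

/-- Integration of `x^β e^{-|x|²}` over `ℝⁿ` in Cartesian and in polar coordinates. -/
lemma sphereMoment_mul_halfLineMoment [NeZero n] (β : Fin n → ℕ) :
    sphereMoment β * halfLineMoment ((∑ k, β k) + (n - 1)) =
      ((volume : Measure (EuclideanSpace ℝ (Fin n))).toSphere Set.univ).toReal⁻¹ *
        ∏ k, lineMoment (β k) := by
  have h := integral_homogeneous_mul_exp (n := n) (∑ k, β k) (NeZero.one_le)
    (fun x => ∏ k, x k ^ β k) (by
      intro r x
      simp only [PiLp.smul_apply, smul_eq_mul, mul_pow, Finset.prod_mul_distrib,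
        Finset.prod_pow_eq_pow_sum])
  rw [sphereMoment, integral_sphereMeasure, mul_assoc, halfLineMoment, ← h]
  congr 1
  have h2 := (EuclideanSpace.volume_preserving_symm_measurableEquiv_toLp (Fin n)).integral_comp
    (MeasurableEquiv.measurableEmbedding _)
    (fun x : Fin n → ℝ => ∏ k, (x k ^ β k * Real.exp (-(x k) ^ 2)))
  rw [integral_fintype_prod_volume_eq_prod (fun k (t : ℝ) => t ^ β k * Real.exp (-t ^ 2))] at h2
  simp only [lineMoment]
  rw [← h2]
  congr 1
  ext x
  rw [Finset.prod_mul_distrib, ← Real.exp_sum, EuclideanSpace.norm_sq_eq, Finset.sum_neg_distrib]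
  simp

lemma sphereMoment_of_odd [NeZero n] {β : Fin n → ℕ} {k : Fin n} (hk : Odd (β k)) :
    sphereMoment β = 0 := by
  have h := sphereMoment_mul_halfLineMoment β
  rw [Finset.prod_eq_zero (Finset.mem_univ k) (lineMoment_odd hk), mul_zero] at h
  exact (mul_eq_zero.1 h).resolve_right (halfLineMoment_pos _).ne'

/-- The recursion that determines the moments of the sphere. -/
lemma sphereMoment_add_two [NeZero n] (β : Fin n → ℕ) (k : Fin n) :
    ((∑ i, β i : ℕ) + (n : ℝ)) * sphereMoment (Function.update β k (β k + 2)) =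
      ((β k : ℝ) + 1) * sphereMoment β := by
  have hs : ∑ i, Function.update β k (β k + 2) i = (∑ i, β i) + 2 := by
    rw [Finset.sum_update_of_mem (Finset.mem_univ k),
      ← Finset.add_sum_erase _ β (Finset.mem_univ k), Finset.sdiff_singleton_eq_erase]
    ring
  have hp : ∏ i, lineMoment (Function.update β k (β k + 2) i) =
      ((β k : ℝ) + 1) / 2 * ∏ i, lineMoment (β i) := by
    rw [← Finset.mul_prod_erase _ _ (Finset.mem_univ k),
      ← Finset.mul_prod_erase _ (fun i => lineMoment (β i)) (Finset.mem_univ k),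
      Function.update_self, lineMoment_add_two, mul_assoc]
    congr 2
    refine Finset.prod_congr rfl fun i hi => ?_
    rw [Function.update_of_ne (Finset.ne_of_mem_erase hi)]
  have h1 := sphereMoment_mul_halfLineMoment β
  have h2 := sphereMoment_mul_halfLineMoment (Function.update β k (β k + 2))
  have hn : 1 ≤ n := NeZero.one_le
  rw [hs, hp, show (∑ i, β i) + 2 + (n - 1) = ((∑ i, β i) + (n - 1)) + 2 by ring,
    halfLineMoment_add_two, show (((∑ i, β i) + (n - 1) : ℕ) : ℝ) + 1 = (∑ i, β i : ℕ) + (n : ℝ) by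
      push_cast [Nat.cast_sub hn]; ring] at h2
  have h3 := (halfLineMoment_pos ((∑ i, β i) + (n - 1))).ne'
  refine mul_right_cancel₀ h3 ?_
  linear_combination 2 * h2 - ((β k : ℝ) + 1) * h1

lemma sphereMoment_zero [NeZero n] : sphereMoment (0 : Fin n → ℕ) = 1 := by
  simp [sphereMoment]

/-- The action of a linear isometry on the unit sphere. -/
noncomputable def sphereMap (R : EuclideanSpace ℝ (Fin n) ≃ₗᵢ[ℝ] EuclideanSpace ℝ (Fin n))
    (x : USphere n) : USphere n := ⟨R x, by simp⟩

lemma continuous_sphereMap (R : EuclideanSpace ℝ (Fin n) ≃ₗᵢ[ℝ] EuclideanSpace ℝ (Fin n)) :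
    Continuous (sphereMap R) :=
  (R.continuous.comp continuous_subtype_val).subtype_mk _

open scoped Pointwise in
lemma map_sphereMap (R : EuclideanSpace ℝ (Fin n) ≃ₗᵢ[ℝ] EuclideanSpace ℝ (Fin n)) :
    (sphereMeasure n).map (sphereMap R) = sphereMeasure n := by
  have key : ((volume : Measure (EuclideanSpace ℝ (Fin n))).toSphere).map (sphereMap R) =
      (volume : Measure (EuclideanSpace ℝ (Fin n))).toSphere := by
    ext s hs
    rw [Measure.map_apply (continuous_sphereMap R).measurable hs,
      Measure.toSphere_apply' _ ((continuous_sphereMap R).measurable hs),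
      Measure.toSphere_apply' _ hs]
    congr 1
    have hpre : Set.Ioo (0 : ℝ) 1 • ((↑) '' (sphereMap R ⁻¹' s) : Set (EuclideanSpace ℝ (Fin n))) =
        R ⁻¹' (Set.Ioo (0 : ℝ) 1 • ((↑) '' s : Set (EuclideanSpace ℝ (Fin n)))) := by
      ext x
      simp only [Set.mem_smul, Set.mem_preimage, Set.mem_image]
      constructor
      · rintro ⟨r, hr, _, ⟨y, hy, rfl⟩, rfl⟩
        exact ⟨r, hr, _, ⟨_, hy, rfl⟩, by simp [sphereMap]⟩
      · rintro ⟨r, hr, _, ⟨y, hy, rfl⟩, hx⟩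
        refine ⟨r, hr, R.symm y, ⟨sphereMap R.symm y, ?_, rfl⟩, ?_⟩
        · convert hy
          simp [sphereMap]
        · rw [← R.symm.map_smul, hx, R.symm_apply_apply]
    rw [hpre]
    exact R.measurePreserving.measure_preimage_emb R.toHomeomorph.measurableEmbedding _
  rw [sphereMeasure, Measure.map_smul, key]

lemma integral_comp_sphereMap [NeZero n]
    (R : EuclideanSpace ℝ (Fin n) ≃ₗᵢ[ℝ] EuclideanSpace ℝ (Fin n))
    {f : USphere n → ℝ} (hf : Continuous f) :
    ∫ x, f (sphereMap R x) ∂(sphereMeasure n) = ∫ x, f x ∂(sphereMeasure n) := by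
  conv_rhs => rw [← map_sphereMap R]
  rw [integral_map (continuous_sphereMap R).measurable.aemeasurable
    hf.measurable.aestronglyMeasurable]

end

/-! ### One coordinate of a uniform point: moments and zonal means -/

section

open Polynomial

/-- The moments `∫ ⟨x, y⟩^k dx` of one coordinate (`|y| = 1`), given by their recursion; see
`sphereMoment_single`. -/
noncomputable def axisMoment (n : ℕ) : ℕ → ℝ
  | 0 => 1
  | 1 => 0
  | k + 2 => ((k : ℝ) + 1) / ((k : ℝ) + n) * axisMoment n k

/-- The expectation of `f(⟨x, y⟩)` for `x` uniform on the sphere, as a functional on polynomials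
`f`; see `integral_eval_inner`. -/
noncomputable def axisMean (n : ℕ) : ℝ[X] →ₗ[ℝ] ℝ :=
  Polynomial.lsum fun k => axisMoment n k • LinearMap.id

lemma axisMean_X_pow (n k : ℕ) : axisMean n (X ^ k) = axisMoment n k := by
  simp [axisMean, Polynomial.lsum_apply, X_pow_eq_monomial]

lemma axisMoment_step {n : ℕ} [NeZero n] (k : ℕ) :
    ((k : ℝ) + n) * axisMoment n (k + 2) = ((k : ℝ) + 1) * axisMoment n k := by
  have : (n : ℝ) ≠ 0 := NeZero.ne _
  have : (k : ℝ) + n ≠ 0 := by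
    have : 0 < (n : ℝ) := Nat.cast_pos.2 (NeZero.pos n)
    positivity
  rw [axisMoment]
  field_simp

/-- Integration by parts for the density `(1 - t²)^{(n-3)/2}` of one coordinate, proved on monomials
from the recursion of the moments. -/
lemma axisMean_stein {n : ℕ} [NeZero n] (R : ℝ[X]) :
    axisMean n ((1 - X ^ 2) * derivative R - C ((n : ℝ) - 1) * (X * R)) = 0 := by
  induction R using Polynomial.induction_on' with
  | add p q hp hq =>
    have : (1 - X ^ 2) * derivative (p + q) - C ((n : ℝ) - 1) * (X * (p + q)) =
        ((1 - X ^ 2) * derivative p - C ((n : ℝ) - 1) * (X * p)) +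
          ((1 - X ^ 2) * derivative q - C ((n : ℝ) - 1) * (X * q)) := by
      rw [derivative_add]
      ring
    rw [this, map_add, hp, hq, add_zero]
  | monomial k c =>
    rw [← C_mul_X_pow_eq_monomial]
    rcases k with _ | k
    · have : (1 - X ^ 2) * derivative (C c * X ^ 0) - C ((n : ℝ) - 1) * (X * (C c * X ^ 0)) =
        (-(((n : ℝ) - 1) * c)) • (X ^ 1 : ℝ[X]) := by
        simp [smul_eq_C_mul]
        ring
      rw [this, map_smul, axisMean_X_pow]
      simp [axisMoment]
    · have : (1 - X ^ 2) * derivative (C c * X ^ (k + 1)) -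
          C ((n : ℝ) - 1) * (X * (C c * X ^ (k + 1))) =
        (c * (k + 1)) • (X ^ k : ℝ[X]) - (c * (k + n)) • (X ^ (k + 2) : ℝ[X]) := by
        simp [smul_eq_C_mul]
        ring
      rw [this, map_sub, map_smul, map_smul, axisMean_X_pow, axisMean_X_pow]
      simp only [smul_eq_mul]
      linear_combination (-c) * axisMoment_step (n := n) k

section Rotation

variable {n : ℕ}

/-- The base point `e₀` of the sphere. -/
noncomputable def basePoint (n : ℕ) [NeZero n] : USphere n :=
  ⟨EuclideanSpace.single 0 1, by simp⟩

/-- A reflection takes the base point to `y`. -/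
lemma exists_rotation [NeZero n] (y : USphere n) :
    ∃ R : EuclideanSpace ℝ (Fin n) ≃ₗᵢ[ℝ] EuclideanSpace ℝ (Fin n),
      sphereMap R (basePoint n) = y := by
  refine ⟨Submodule.reflection (Submodule.span ℝ {(basePoint n : EuclideanSpace ℝ (Fin n)) - y})ᗮ,
    Subtype.ext (Submodule.reflection_sub ?_)⟩
  simp

lemma inner_basePoint [NeZero n] (x : EuclideanSpace ℝ (Fin n)) :
    inner ℝ x (basePoint n : EuclideanSpace ℝ (Fin n)) = x 0 := by
  simp [basePoint, EuclideanSpace.inner_single_right]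

lemma integral_inner_rotate [NeZero n]
    (R : EuclideanSpace ℝ (Fin n) ≃ₗᵢ[ℝ] EuclideanSpace ℝ (Fin n))
    {f : EuclideanSpace ℝ (Fin n) → ℝ → ℝ} (hf : Continuous fun z : _ × ℝ => f z.1 z.2) :
    ∫ x : USphere n, f x (inner ℝ (x : EuclideanSpace ℝ (Fin n)) (sphereMap R (basePoint n)))
        ∂(sphereMeasure n) =
      ∫ x : USphere n, f (R x) ((x : EuclideanSpace ℝ (Fin n)) 0) ∂(sphereMeasure n) := by
  rw [← integral_comp_sphereMap R]
  · congr 1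
    ext x
    simp only [sphereMap]
    rw [LinearIsometryEquiv.inner_map_map, inner_basePoint]
  · exact hf.comp (continuous_subtype_val.prodMk (continuous_subtype_val.inner continuous_const))

lemma sphereMoment_single [NeZero n] (k : ℕ) :
    sphereMoment (Pi.single (0 : Fin n) k) = axisMoment n k := by
  induction k using Nat.twoStepInduction with
  | zero => simpa [axisMoment] using sphereMoment_zero
  | one =>
    rw [axisMoment]
    exact sphereMoment_of_odd (k := 0) (by simp)
  | more k ih _ =>
    have h := sphereMoment_add_two (Pi.single (0 : Fin n) k) 0
    have h2 := axisMoment_step (n := n) k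
    have hpos : (k : ℝ) + n ≠ 0 := by
      have : 0 < (n : ℝ) := Nat.cast_pos.2 (NeZero.pos n)
      positivity
    rw [Pi.single, Function.update_idem, Function.update_self, ← Pi.single, ih, ← h2] at h
    rw [Finset.sum_eq_single (0 : Fin n) (fun i _ hi => by simp [hi]) (by simp)] at h
    simp only [Pi.single_eq_same] at h
    exact mul_left_cancel₀ hpos h

lemma integral_eval_inner [NeZero n] (y : USphere n) (f : ℝ[X]) :
    ∫ x : USphere n, f.eval (inner ℝ (x : EuclideanSpace ℝ (Fin n)) y) ∂(sphereMeasure n) =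
      axisMean n f := by
  obtain ⟨R, rfl⟩ := exists_rotation y
  rw [integral_inner_rotate R (f := fun _ t => f.eval t) (f.continuous.comp continuous_snd)]
  have hc : ∀ g : ℝ[X], Integrable
      (fun x : USphere n => g.eval ((x : EuclideanSpace ℝ (Fin n)) 0)) (sphereMeasure n) :=
    fun g => integrable_of_continuous (by fun_prop) _
  induction f using Polynomial.induction_on' with
  | add p q hp hq =>
    simp only [eval_add]
    rw [integral_add (hc p) (hc q), hp, hq, map_add]
  | monomial k c =>
    rw [← C_mul_X_pow_eq_monomial, ← smul_eq_C_mul, map_smul, axisMean_X_pow,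
      ← sphereMoment_single, sphereMoment]
    simp only [eval_smul, eval_pow, eval_X, smul_eq_mul]
    rw [integral_const_mul]
    congr 2
    ext x
    rw [Finset.prod_eq_single (0 : Fin n) (fun i _ hi => by simp [hi]) (by simp)]
    simp

end Rotation

/-- The expectation of `h(⟨x, y⟩²)` for `x` uniform on the sphere; see `integral_eval_inner_sq`. -/
noncomputable def zonalMean (n : ℕ) : ℝ[X] →ₗ[ℝ] ℝ :=
  axisMean n ∘ₗ (Polynomial.expand ℝ 2).toLinearMap

lemma zonalMean_apply (n : ℕ) (h : ℝ[X]) : zonalMean n h = axisMean n (expand ℝ 2 h) := rfl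

lemma integral_eval_inner_sq {n : ℕ} [NeZero n] (y : USphere n) (h : ℝ[X]) :
    ∫ x : USphere n, h.eval (inner ℝ (x : EuclideanSpace ℝ (Fin n)) y ^ 2) ∂(sphereMeasure n) =
      zonalMean n h := by
  rw [zonalMean_apply, ← integral_eval_inner y]
  simp [expand_eval]

lemma inner_sq_mem_Icc {n : ℕ} (x y : USphere n) :
    inner ℝ (x : EuclideanSpace ℝ (Fin n)) (y : EuclideanSpace ℝ (Fin n)) ^ 2 ∈
      Set.Icc (0 : ℝ) 1 := by
  refine ⟨sq_nonneg _, ?_⟩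
  have h := abs_real_inner_le_norm (x : EuclideanSpace ℝ (Fin n)) (y : EuclideanSpace ℝ (Fin n))
  rw [← sq_abs]
  simp only [norm_eq_of_mem_sphere, mul_one] at h
  exact pow_le_one₀ (abs_nonneg _) h

lemma zonalMean_mono {n : ℕ} [NeZero n] {f g : ℝ[X]}
    (h : ∀ s ∈ Set.Icc (0 : ℝ) 1, f.eval s ≤ g.eval s) : zonalMean n f ≤ zonalMean n g := by
  rw [← integral_eval_inner_sq (basePoint n), ← integral_eval_inner_sq (basePoint n)]
  have hc : ∀ g : ℝ[X], Integrable (fun x : USphere n =>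
      g.eval (inner ℝ (x : EuclideanSpace ℝ (Fin n)) (basePoint n) ^ 2)) (sphereMeasure n) :=
    fun g => integrable_of_continuous (by fun_prop) _
  exact integral_mono (hc f) (hc g) fun x => h _ (inner_sq_mem_Icc _ _)

lemma zonalMean_one (n : ℕ) : zonalMean n 1 = 1 := by
  rw [zonalMean_apply, map_one, ← pow_zero X, axisMean_X_pow, axisMoment]

lemma zonalMean_X_pow (n k : ℕ) : zonalMean n (X ^ k) = axisMoment n (2 * k) := by
  rw [zonalMean_apply, map_pow, expand_X, ← pow_mul, axisMean_X_pow]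

lemma zonalMean_X_pow_succ {n : ℕ} [NeZero n] (k : ℕ) :
    (2 * (k : ℝ) + n) * zonalMean n (X ^ (k + 1)) = (2 * (k : ℝ) + 1) * zonalMean n (X ^ k) := by
  have h := axisMoment_step (n := n) (2 * k)
  push_cast at h
  rw [zonalMean_X_pow, zonalMean_X_pow, mul_add, mul_one, h]

lemma zonalMean_X_pow_pos {n : ℕ} [NeZero n] (k : ℕ) : 0 < zonalMean n (X ^ k) := by
  induction k with
  | zero => simp [zonalMean_one]
  | succ k ih =>
    have h := zonalMean_X_pow_succ (n := n) k
    have hn : 0 < (n : ℝ) := Nat.cast_pos.2 (NeZero.pos n)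
    have : 0 < (2 * (k : ℝ) + n) * zonalMean n (X ^ (k + 1)) := by rw [h]; positivity
    exact pos_of_mul_pos_right this (by positivity)

lemma zonalMean_beta_succ {n : ℕ} [NeZero n] (i m : ℕ) :
    (2 * (m : ℝ) + 2 * i + n) * zonalMean n (X ^ (m + 1) * (1 - X) ^ i) =
      (2 * (m : ℝ) + 1) * zonalMean n (X ^ m * (1 - X) ^ i) := by
  induction i generalizing m with
  | zero => simpa using zonalMean_X_pow_succ (n := n) m
  | succ i ih =>
    have e : ∀ m : ℕ, (X ^ m * (1 - X) ^ (i + 1) : ℝ[X]) =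
        X ^ m * (1 - X) ^ i - X ^ (m + 1) * (1 - X) ^ i := fun m => by ring
    rw [e, e, map_sub, map_sub]
    have h1 := ih m
    have h2 := ih (m + 1)
    push_cast at h2 ⊢
    linear_combination h1 - h2

lemma zonalMean_beta_pos {n : ℕ} [NeZero n] (hn : 2 ≤ n) (i m : ℕ) :
    0 < zonalMean n (X ^ m * (1 - X) ^ i) := by
  induction i with
  | zero => simpa using zonalMean_X_pow_pos m
  | succ i ih =>
    have e : (X ^ m * (1 - X) ^ (i + 1) : ℝ[X]) =
        X ^ m * (1 - X) ^ i - X ^ (m + 1) * (1 - X) ^ i := by ring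
    have h := zonalMean_beta_succ (n := n) i m
    have hn' : (2 : ℝ) ≤ n := by exact_mod_cast hn
    have hm : (0 : ℝ) ≤ m := m.cast_nonneg
    have hi : (0 : ℝ) ≤ i := i.cast_nonneg
    rw [e, map_sub]
    have hp : 0 < 2 * (m : ℝ) + 2 * i + n := by positivity
    have : (2 * (m : ℝ) + 2 * i + n) * (zonalMean n (X ^ m * (1 - X) ^ i) -
        zonalMean n (X ^ (m + 1) * (1 - X) ^ i)) =
        (2 * i + n - 1) * zonalMean n (X ^ m * (1 - X) ^ i) := by
      linear_combination -h
    refine pos_of_mul_pos_right (a := 2 * (m : ℝ) + 2 * i + n) ?_ hp.le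
    rw [this]
    exact mul_pos (by linarith) ih

end

/-! ### The Gegenbauer kernel -/

section

open Polynomial

/-- The coefficients of the solution `∑ c_i t^{(l mod 2) + 2i}` of the Gegenbauer equation
`gegen_ode`, normalized to `c_0 = 1`. The recursion makes them vanish for `i > l / 2`. -/
noncomputable def gegenCoeff (n l : ℕ) : ℕ → ℝ
  | 0 => 1
  | i + 1 =>
    -(((l : ℝ) - (l % 2 + 2 * i : ℕ)) * (l + (l % 2 + 2 * i : ℕ) + n + 2)) /
      (((l % 2 + 2 * i : ℕ) + 2) * ((l % 2 + 2 * i : ℕ) + 1)) * gegenCoeff n l i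

/-- The polynomial `g` for which the Gegenbauer polynomial is `t^{l mod 2} g(t²)`. -/
noncomputable def gegenRadial (n l : ℕ) : ℝ[X] :=
  ∑ i ∈ Finset.range (l / 2 + 1), C (gegenCoeff n l i) * X ^ i

/-- The Gegenbauer polynomial of degree `l` of index `(n + 2)/2`, that is, for the weight
`(1 - t²)^{(n+1)/2}`, up to normalization. -/
noncomputable def gegen (n l : ℕ) : ℝ[X] :=
  X ^ (l % 2) * expand ℝ 2 (gegenRadial n l)

lemma gegen_eq_sum (n l : ℕ) : gegen n l =
    ∑ i ∈ Finset.range (l / 2 + 1), C (gegenCoeff n l i) * X ^ (l % 2 + 2 * i) := by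
  rw [gegen, gegenRadial, map_sum, Finset.mul_sum]
  refine Finset.sum_congr rfl fun i _ => ?_
  rw [map_mul, expand_C, map_pow, expand_X]
  ring

/-- The Gegenbauer equation. The partial sums of the series solve it up to one monomial, whose
coefficient vanishes when the degree of the partial sum is `l`. -/
lemma gegen_ode (n l : ℕ) :
    (1 - X ^ 2) * derivative (derivative (gegen n l)) =
      C ((n : ℝ) + 3) * (X * derivative (gegen n l)) -
        C ((l : ℝ) * (l + n + 2)) * gegen n l := by
  have key : ∀ (N : ℕ) (q : ℝ[X]), q = ∑ i ∈ Finset.range (N + 1),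
      C (gegenCoeff n l i) * (X : ℝ[X]) ^ (l % 2 + 2 * i) →
      (1 - X ^ 2) * derivative (derivative q) - C ((n : ℝ) + 3) * (X * derivative q) +
        C ((l : ℝ) * (l + n + 2)) * q =
      C (((l : ℝ) - (l % 2 + 2 * N : ℕ)) * (l + (l % 2 + 2 * N : ℕ) + n + 2) *
        gegenCoeff n l N) * X ^ (l % 2 + 2 * N) := by
    intro N
    induction N with
    | zero =>
      rintro q rfl
      rcases Nat.mod_two_eq_zero_or_one l with h | h
      · simp [h, gegenCoeff]
      · simp [h, gegenCoeff]
        simp only [map_ofNat C]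
        ring
    | succ N ih =>
      rintro q' rfl
      rw [Finset.sum_range_succ]
      generalize hq : ∑ i ∈ Finset.range (N + 1),
        C (gegenCoeff n l i) * (X : ℝ[X]) ^ (l % 2 + 2 * i) = q
      replace ih := ih q hq.symm
      set k := l % 2 + 2 * N with hk
      have hk2 : l % 2 + 2 * (N + 1) = k + 2 := by omega
      have hc : gegenCoeff n l (N + 1) * (((k : ℝ) + 2) * (k + 1)) =
          -(((l : ℝ) - k) * (l + k + n + 2)) * gegenCoeff n l N := by
        rw [gegenCoeff, ← hk]
        field_simp
      have hC : C (((l : ℝ) - k) * (l + k + n + 2) * gegenCoeff n l N) =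
          -C (gegenCoeff n l (N + 1) * (((k : ℝ) + 2) * (k + 1))) := by
        rw [hc, ← C_neg]; congr 1; ring
      rw [hC] at ih
      rw [hk2]
      simp only [derivative_add, derivative_mul, derivative_C, zero_mul, zero_add, derivative_X_pow]
      rw [show k + 2 - 1 = k + 1 by omega]
      simp only [Nat.add_sub_cancel, map_natCast]
      simp only [map_mul, map_add, map_sub, map_natCast, map_ofNat, map_one, Nat.cast_add,
        Nat.cast_ofNat, Nat.cast_one] at ih ⊢
      linear_combination ih
  have h := key (l / 2) _ (gegen_eq_sum n l)
  rw [Nat.mod_add_div] at h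
  rw [sub_self, zero_mul, zero_mul, C_0, zero_mul] at h
  linear_combination h

/-- The mean of `1 - t²` under the squared Gegenbauer polynomial. It follows from Stein's
identity for a quadratic expression in `q` and `q'`, chosen such that the Gegenbauer equation
cancels all terms that contain `q'`. -/
lemma gegen_virial {n : ℕ} [NeZero n] (l : ℕ) :
    (2 * ((l : ℝ) * (l + n + 2)) + n * (n + 3)) *
        axisMean n ((1 - X ^ 2) * gegen n l ^ 2) =
      (((n : ℝ) - 1) * (n + 3)) * axisMean n (gegen n l ^ 2) := by
  set q := gegen n l with hq
  have ode := gegen_ode n l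
  rw [← hq] at ode
  set Λ := (l : ℝ) * (l + n + 2)
  have st := axisMean_stein (n := n) (X * (1 - X ^ 2) ^ 2 * derivative q ^ 2 -
    (1 - X ^ 2) * (1 + C ((n : ℝ) + 2) * X ^ 2) * (q * derivative q) +
    X * (C ((n : ℝ) + 3) + C Λ * (1 - X ^ 2)) * q ^ 2)
  have e : (1 - X ^ 2) * derivative (X * (1 - X ^ 2) ^ 2 * derivative q ^ 2 -
    (1 - X ^ 2) * (1 + C ((n : ℝ) + 2) * X ^ 2) * (q * derivative q) +
    X * (C ((n : ℝ) + 3) + C Λ * (1 - X ^ 2)) * q ^ 2) - C ((n : ℝ) - 1) * (X *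
    (X * (1 - X ^ 2) ^ 2 * derivative q ^ 2 -
    (1 - X ^ 2) * (1 + C ((n : ℝ) + 2) * X ^ 2) * (q * derivative q) +
    X * (C ((n : ℝ) + 3) + C Λ * (1 - X ^ 2)) * q ^ 2)) =
    (2 * Λ + n * (n + 3)) • ((1 - X ^ 2) * q ^ 2) - (((n : ℝ) - 1) * (n + 3)) • q ^ 2 := by
    simp only [smul_eq_C_mul, map_mul, map_add, map_sub, map_natCast, map_ofNat, map_one,
      derivative_mul, derivative_pow, derivative_X, derivative_one,
      derivative_C, derivative_natCast, derivative_ofNat]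
    simp only [map_add, map_natCast, map_ofNat] at ode
    simp
    linear_combination (2 * X * (1 - X ^ 2) ^ 2 * derivative q -
      (1 - X ^ 2) * (1 + (n + 2) * X ^ 2) * q) * ode
  rw [e, map_sub, map_smul, map_smul] at st
  simpa [sub_eq_zero] using st

/-- The nonnegative kernel `h` with `h(t²) = gegen(t)²`. -/
noncomputable def gegenKernel (n l : ℕ) : ℝ[X] := X ^ (l % 2) * gegenRadial n l ^ 2

lemma expand_gegenKernel (n l : ℕ) : expand ℝ 2 (gegenKernel n l) = gegen n l ^ 2 := by
  rw [gegenKernel, gegen, map_mul, map_pow, map_pow, expand_X]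
  ring

lemma gegenKernel_virial {n : ℕ} [NeZero n] (l : ℕ) :
    (2 * ((l : ℝ) * (l + n + 2)) + n * (n + 3)) *
        zonalMean n ((1 - X) * gegenKernel n l) =
      (((n : ℝ) - 1) * (n + 3)) * zonalMean n (gegenKernel n l) := by
  rw [zonalMean_apply, zonalMean_apply, map_mul, expand_gegenKernel, map_sub, map_one, expand_X,
    gegen_virial]

lemma gegenKernel_nonneg (n l : ℕ) {s : ℝ} (hs : 0 ≤ s) : 0 ≤ (gegenKernel n l).eval s := by
  rw [gegenKernel, eval_mul, eval_pow, eval_pow, eval_X]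
  positivity

lemma gegenKernel_ne_zero (n l : ℕ) : gegenKernel n l ≠ 0 := by
  have h : gegenRadial n l ≠ 0 := by
    intro h
    have := congrArg (fun p => coeff p 0) h
    simp only [gegenRadial, finsetSum_coeff, coeff_C_mul, coeff_X_pow, coeff_zero] at this
    rw [Finset.sum_eq_single 0] at this
    · simp [gegenCoeff] at this
    · intro b _ hb
      rw [if_neg hb.symm, mul_zero]
    · simp
  exact mul_ne_zero (pow_ne_zero _ X_ne_zero) (pow_ne_zero _ h)

/-- Every value in `[0, 1]` is taken by `⟨x, y⟩²`; this needs two dimensions. -/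
lemma exists_inner_sq_eq {n : ℕ} (hn : 2 ≤ n) (y : USphere n) {s : ℝ} (hs : s ∈ Set.Icc (0 : ℝ) 1) :
    ∃ x : USphere n, inner ℝ (x : EuclideanSpace ℝ (Fin n)) (y : EuclideanSpace ℝ (Fin n)) ^ 2
      = s := by
  have : NeZero n := ⟨by omega⟩
  obtain ⟨R, rfl⟩ := exists_rotation y
  have h01 : (⟨1, by omega⟩ : Fin n) ≠ 0 := by
    intro h
    have := congrArg Fin.val h
    simp at this
  let x : EuclideanSpace ℝ (Fin n) := EuclideanSpace.single 0 (√s) +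
    EuclideanSpace.single (⟨1, by omega⟩ : Fin n) (√(1 - s))
  have hx : ‖x‖ = 1 := by
    have h2 : ‖x‖ ^ 2 = 1 := by
      rw [norm_add_sq_real, EuclideanSpace.inner_single_left]
      simp [h01.symm, Real.sq_sqrt hs.1, Real.sq_sqrt (sub_nonneg.2 hs.2)]
    nlinarith [norm_nonneg x]
  refine ⟨sphereMap R ⟨x, by simpa using hx⟩, ?_⟩
  simp only [sphereMap]
  rw [LinearIsometryEquiv.inner_map_map, inner_basePoint]
  simp [x, h01.symm, Real.sq_sqrt hs.1]

lemma zonalMean_pos {n : ℕ} (hn : 2 ≤ n) {h : ℝ[X]}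
    (h0 : ∀ s ∈ Set.Icc (0 : ℝ) 1, 0 ≤ h.eval s) (hne : h ≠ 0) : 0 < zonalMean n h := by
  have : NeZero n := ⟨by omega⟩
  let f : USphere n → ℝ := fun x =>
    h.eval (inner ℝ (x : EuclideanSpace ℝ (Fin n)) (basePoint n) ^ 2)
  have hf : Continuous f := by fun_prop
  have hnn : 0 ≤ f := fun x => h0 _ (inner_sq_mem_Icc _ _)
  rw [← integral_eval_inner_sq (basePoint n)]
  refine lt_of_le_of_ne (integral_nonneg hnn) fun h1 => hne ?_
  have h2 := (integral_eq_zero_iff_of_nonneg hnn (integrable_of_continuous hf _)).1 h1.symm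
  have h3 : f = 0 := hf.ae_eq_iff_eq (sphereMeasure n) continuous_zero |>.1 h2
  refine Polynomial.eq_zero_of_infinite_isRoot h
    ((Set.Icc_infinite (zero_lt_one (α := ℝ))).mono fun s hs => ?_)
  obtain ⟨x, hx⟩ := exists_inner_sq_eq hn (basePoint n) hs
  have := congrFun h3 x
  simpa [f, hx] using this

end

/-! ### Growth of bounded polynomials near an endpoint -/

section

open Polynomial Polynomial.Chebyshev

/-- Among the polynomials of degree at most `a` bounded by one on `[-1, 1]`, the Chebyshev
polynomial decreases most from the endpoint `1` to a point `x` right of its first inner extremum. By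
Lagrange interpolation in the extrema of `T_a`, the functional `P ↦ P(1) - P(x)` has coefficients of
alternating sign, like the values of `T_a`. -/
lemma eval_one_sub_eval_le_chebyshev {a : ℕ} {P : ℝ[X]} (hd : P.degree ≤ a)
    (hP : ∀ x ∈ Set.Icc (-1 : ℝ) 1, |P.eval x| ≤ 1) {x : ℝ} (hx : node a 1 ≤ x) (hx1 : x ≤ 1) :
    P.eval 1 - P.eval x ≤ 1 - (T ℝ a).eval x := by
  classical
  set ℓ : ℕ → ℝ := fun i => ∏ j ∈ (Finset.range (a + 1)).erase i,
    ((node a i - node a j)⁻¹ * (x - node a j)) with hℓ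
  set c : ℕ → ℝ := fun i => (if i = 0 then 1 else 0) - ℓ i with hc
  have hinj : Set.InjOn (node a ·) (Finset.range (a + 1) : Set ℕ) := (strictAntiOn_node a).injOn
  have hsum : ∀ Q : ℝ[X], Q.degree ≤ a → sumNodes a c Q = Q.eval 1 - Q.eval x := by
    intro Q hQ
    have hlt : Q.degree < (Finset.range (a + 1)).card := by
      rw [Finset.card_range]
      exact hQ.trans_lt (by exact_mod_cast Nat.lt_succ_self a)
    have hint := Lagrange.eq_interpolate (v := node a) hinj hlt
    have hx' : Q.eval x = ∑ i ∈ Finset.range (a + 1), Q.eval (node a i) * ℓ i := by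
      conv_lhs => rw [hint]
      rw [Lagrange.interpolate_apply, eval_finsetSum]
      refine Finset.sum_congr rfl fun i _ => ?_
      rw [eval_mul, eval_C, Lagrange.basis, eval_prod]
      simp only [Lagrange.basisDivisor, eval_mul, eval_C, eval_sub, eval_X, hℓ]
    rw [sumNodes, hx', ← Nat.range_succ_eq_Iic]
    simp only [hc, mul_sub, Finset.sum_sub_distrib, mul_ite, mul_one, mul_zero]
    rw [Finset.sum_ite_eq' (Finset.range (a + 1)) 0, if_pos (by simp), node_eq_one]
  have hsign : ∀ i ≤ a, 0 ≤ (-1) ^ i * c i := by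
    intro i hi
    rcases Nat.eq_zero_or_pos i with rfl | hipos
    · simp only [hc, if_true, pow_zero, one_mul, sub_nonneg, hℓ]
      refine Finset.prod_le_one (fun j hj => ?_) (fun j hj => ?_)
      all_goals
        have hj0 : 0 < j := Nat.pos_of_ne_zero (Finset.ne_of_mem_erase hj)
        have hja : j ≤ a := by have := Finset.mem_of_mem_erase hj; simp at this; omega
        have h1 : node a j < node a 0 := node_lt hja hj0
        have h2 : node a j ≤ x := by
          rcases Nat.eq_or_lt_of_le (show 1 ≤ j from hj0) with h | h
          · rwa [← h]
          · exact (node_lt hja h).le.trans hx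
      · exact mul_nonneg (inv_nonneg.2 (by linarith)) (by linarith)
      · rw [node_eq_one] at h1 ⊢
        rw [inv_mul_le_iff₀ (by linarith)]
        linarith
    · have hne : i ≠ 0 := hipos.ne'
      simp only [hc, if_neg hne, hℓ]
      rw [Finset.prod_mul_distrib, Finset.prod_inv_distrib]
      have h1 := zero_lt_prod_node_sub_node hi
      have h2 : ∏ j ∈ (Finset.range (a + 1)).erase i, (x - node a j) ≤ 0 := by
        rw [← Finset.mul_prod_erase _ _ (show 0 ∈ (Finset.range (a + 1)).erase i by
          simp [hne.symm]), node_eq_one]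
        refine mul_nonpos_of_nonpos_of_nonneg (by linarith) (Finset.prod_nonneg fun j hj => ?_)
        have hj0 : 0 < j := Nat.pos_of_ne_zero (Finset.ne_of_mem_erase hj)
        have hja : j ≤ a := by
          have := Finset.mem_of_mem_erase (Finset.mem_of_mem_erase hj); simp at this; omega
        have : node a j ≤ x := by
          rcases Nat.eq_or_lt_of_le (show 1 ≤ j from hj0) with h | h
          · rwa [← h]
          · exact (node_lt hja h).le.trans hx
        linarith
      have h3 : (-1 : ℝ) ^ i * (0 - (∏ j ∈ (Finset.range (a + 1)).erase i,
          (node a i - node a j))⁻¹ * ∏ j ∈ (Finset.range (a + 1)).erase i, (x - node a j)) =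
          ((-1) ^ i * ∏ j ∈ (Finset.range (a + 1)).erase i, (node a i - node a j))⁻¹ *
          -(∏ j ∈ (Finset.range (a + 1)).erase i, (x - node a j)) := by
        rw [mul_inv, ← inv_pow, inv_neg_one]
        ring
      rw [h3]
      exact mul_nonneg (inv_nonneg.2 h1.le) (neg_nonneg.2 h2)
  have h := sumNodes_le_sumNodes_T hsign hP
  rw [hsum P hd, hsum _ (by simp)] at h
  simpa using h

/-- Concavity of the sine, between `0` and `ψ / 2`. -/
lemma two_mul_sin_half_le {a : ℕ} (ha : 2 ≤ a) {ψ : ℝ} (h0 : 0 ≤ ψ) (hπ : ψ ≤ Real.pi) :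
    2 * Real.sin (ψ / 2) ≤ a * Real.sin (ψ / a) := by
  have ha' : (2 : ℝ) ≤ a := by exact_mod_cast ha
  have ha0 : (0 : ℝ) < a := by linarith
  have hm : ψ / 2 ∈ Set.Icc 0 Real.pi := ⟨by linarith, by linarith [Real.pi_pos]⟩
  have hz : (0 : ℝ) ∈ Set.Icc 0 Real.pi := ⟨le_rfl, Real.pi_pos.le⟩
  have h := strictConcaveOn_sin_Icc.concaveOn.2 hm hz (by positivity : 0 ≤ 2 / (a : ℝ))
    (by rw [sub_nonneg, div_le_one ha0]; exact ha' : 0 ≤ 1 - 2 / (a : ℝ)) (by ring)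
  simp only [smul_eq_mul, Real.sin_zero, mul_zero, add_zero] at h
  rw [show 2 / (a : ℝ) * (ψ / 2) = ψ / a by ring] at h
  rw [div_mul_eq_mul_div, div_le_iff₀ ha0] at h
  linarith

/-- The decrease `1 - cos(2aθ)` of the Chebyshev polynomial, in terms of `v = a² sin² θ`, is at most
`2v - v²/2`. -/
lemma sin_sq_mul_le {a : ℕ} (ha : 2 ≤ a) {θ : ℝ} (h0 : 0 ≤ θ) (hθ : a * θ ≤ Real.pi)
    (hy : (a : ℝ) ^ 2 * Real.sin θ ^ 2 ≤ 2) :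
    2 * Real.sin (a * θ) ^ 2 ≤
      2 * ((a : ℝ) ^ 2 * Real.sin θ ^ 2) - ((a : ℝ) ^ 2 * Real.sin θ ^ 2) ^ 2 / 2 := by
  have ha0 : (a : ℝ) ≠ 0 := by positivity
  have h1 := two_mul_sin_half_le ha (ψ := a * θ) (by positivity) hθ
  rw [mul_div_cancel_left₀ _ ha0] at h1
  set σ := Real.sin (a * θ / 2)
  have hσ0 : 0 ≤ σ := Real.sin_nonneg_of_nonneg_of_le_pi (by positivity) (by linarith [Real.pi_pos])
  have h2 : Real.sin (a * θ) ^ 2 = 4 * σ ^ 2 * (1 - σ ^ 2) := by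
    have : Real.sin (a * θ) = 2 * σ * Real.cos (a * θ / 2) := by
      rw [← Real.sin_two_mul]; congr 1; ring
    rw [this, mul_pow, mul_pow, Real.cos_sq']
    ring
  have h3 : 4 * σ ^ 2 ≤ (a : ℝ) ^ 2 * Real.sin θ ^ 2 := by
    rw [← mul_pow, show 4 * σ ^ 2 = (2 * σ) ^ 2 by ring]
    exact pow_le_pow_left₀ (by linarith) h1 2
  rw [h2]
  nlinarith

/-- A Markov type inequality at the endpoint of `[0, 1]`. The decrease is at most `2v - v²/2` with
`v = a² (1 - s)`, and the bound is the tangent line to this concave function at `v = y`. For `v > 2`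
the trivial bound `2` suffices. -/
lemma abs_eval_one_sub_le {a : ℕ} (ha : 2 ≤ a) {p : ℝ[X]} (hd : p.natDegree ≤ a)
    (hp : ∀ s ∈ Set.Icc (0 : ℝ) 1, |p.eval s| ≤ 1) {s : ℝ} (hs : s ∈ Set.Icc (0 : ℝ) 1)
    {y : ℝ} (hy2 : y ≤ 2) :
    |p.eval 1 - p.eval s| ≤ y ^ 2 / 2 + (2 - y) * ((a : ℝ) ^ 2 * (1 - s)) := by
  have ha' : (2 : ℝ) ≤ a := by exact_mod_cast ha
  have ha0 : (0 : ℝ) < a := by linarith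
  set u := 1 - s with hu
  have hu0 : 0 ≤ u := by linarith [hs.2]
  have hu1 : u ≤ 1 := by linarith [hs.1]
  rcases lt_or_ge 2 ((a : ℝ) ^ 2 * u) with hbig | hsmall
  · have h1 := hp 1 ⟨zero_le_one, le_rfl⟩
    have h2 := hp s hs
    have h3 := abs_sub (p.eval 1) (p.eval s)
    nlinarith
  set θ := Real.arcsin √u with hθ
  have hsq : √u ≤ 1 := Real.sqrt_le_one.2 hu1
  have hsin : Real.sin θ = √u :=
    Real.sin_arcsin (by linarith [Real.sqrt_nonneg u]) hsq
  have hsin2 : Real.sin θ ^ 2 = u := by rw [hsin, Real.sq_sqrt hu0]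
  have hθ0 : 0 ≤ θ := Real.arcsin_nonneg.2 (Real.sqrt_nonneg _)
  have hθ1 : θ ≤ Real.pi / 2 := Real.arcsin_le_pi_div_two _
  have hπ := Real.pi_pos
  have haθ : a * θ ≤ Real.pi / 2 := by
    by_contra! hlt
    have h1 := two_mul_sin_half_le ha (ψ := Real.pi / 2) (by linarith) (by linarith)
    have h2 : Real.sin (Real.pi / 2 / a) < Real.sin θ := by
      refine Real.sin_lt_sin_of_lt_of_le_pi_div_two ?_ hθ1 ?_
      · have : 0 ≤ Real.pi / 2 / a := by positivity
        linarith
      · rw [div_lt_iff₀ ha0]; linarith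
    rw [show Real.pi / 2 / 2 = Real.pi / 4 by ring, Real.sin_pi_div_four] at h1
    have h3 : √2 < a * Real.sin θ := by
      have := mul_lt_mul_of_pos_left h2 ha0
      linarith
    have h4 : (√2) ^ 2 < (a * Real.sin θ) ^ 2 :=
      pow_lt_pow_left₀ h3 (Real.sqrt_nonneg _) two_ne_zero
    rw [Real.sq_sqrt zero_le_two, mul_pow, hsin2] at h4
    linarith
  set x := Real.cos (2 * θ) with hx
  have hxs : (x + 1) / 2 = s := by
    rw [hx, Real.cos_two_mul, Real.cos_sq', hsin2]
    ring
  have hnode : node a 1 ≤ x := by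
    rw [node, hx, Nat.cast_one, one_mul]
    refine Real.cos_le_cos_of_nonneg_of_le_pi (by linarith) ?_ ?_
    · exact div_le_self hπ.le (by linarith)
    · rw [le_div_iff₀ ha0]; linarith
  have hT : 1 - (T ℝ a).eval x = 2 * Real.sin (a * θ) ^ 2 := by
    have := T_real_cos (2 * θ) a
    rw [hx, this, show ((a : ℤ) : ℝ) * (2 * θ) = 2 * (a * θ) by push_cast; ring, Real.cos_two_mul,
      Real.cos_sq']
    ring
  have hfin : ∀ q : ℝ[X], q.natDegree ≤ a → (∀ s ∈ Set.Icc (0 : ℝ) 1, |q.eval s| ≤ 1) →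
      q.eval 1 - q.eval s ≤ y ^ 2 / 2 + (2 - y) * ((a : ℝ) ^ 2 * u) := by
    intro q hqd hq
    set P := q.comp (C (1 / 2) * (X + 1)) with hP
    have hev : ∀ z, P.eval z = q.eval ((z + 1) / 2) := fun z => by
      rw [hP, eval_comp]
      congr 1
      simp
      ring
    have hPd : P.degree ≤ a := by
      refine degree_le_of_natDegree_le ((natDegree_comp_le).trans ?_)
      have : (C (1 / 2) * (X + 1) : ℝ[X]).natDegree ≤ 1 :=
        (natDegree_C_mul_le _ _).trans ((natDegree_add_le _ _).trans (by simp))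
      calc _ ≤ q.natDegree * 1 := Nat.mul_le_mul_left _ this
        _ ≤ a := by omega
    have h := eval_one_sub_eval_le_chebyshev hPd (fun z hz => by
      rw [hev]
      exact hq _ ⟨by linarith [hz.1], by linarith [hz.2]⟩) hnode (Real.cos_le_one _)
    rw [hev, hev, hxs, hT] at h
    norm_num at h
    have h5 := sin_sq_mul_le ha hθ0 (by linarith) (by rw [hsin2]; exact hsmall)
    rw [hsin2] at h5
    nlinarith [sq_nonneg ((a : ℝ) ^ 2 * u - y)]
  refine abs_le.2 ⟨?_, hfin p hd hp⟩
  have := hfin (-p) (by simpa using hd) (by simpa using hp)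
  simp only [eval_neg] at this
  linarith

lemma abs_eval_one_sub_le_of_natDegree_le_one {p : ℝ[X]} (hd : p.natDegree ≤ 1)
    (hp : ∀ s ∈ Set.Icc (0 : ℝ) 1, |p.eval s| ≤ 1) {s : ℝ} (hs : s ≤ 1) :
    |p.eval 1 - p.eval s| ≤ 2 * (1 - s) := by
  have h0 := hp 0 (by simp)
  have h1 := hp 1 (by simp)
  rw [eq_X_add_C_of_natDegree_le_one hd] at h0 h1 ⊢
  simp only [eval_add, eval_mul, eval_C, eval_X, mul_zero, zero_add, mul_one] at h0 h1 ⊢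
  rw [show p.coeff 1 + p.coeff 0 - (p.coeff 1 * s + p.coeff 0) = p.coeff 1 * (1 - s) by ring,
    abs_mul, abs_of_nonneg (sub_nonneg.2 hs)]
  refine mul_le_mul_of_nonneg_right ?_ (by linarith)
  rw [abs_le] at h0 h1 ⊢
  constructor <;> linarith

end

/-! ### Zonal polynomials of a form -/

section

open Polynomial

/-- The value of the polynomial `F` at a point of `ℝⁿ`. -/
noncomputable def evalAt {n : ℕ} (F : MvPolynomial (Fin n) ℝ) (x : EuclideanSpace ℝ (Fin n)) : ℝ :=
  MvPolynomial.eval (fun k => x k) F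

variable {n : ℕ}

lemma continuous_evalAt (F : MvPolynomial (Fin n) ℝ) : Continuous (evalAt F) :=
  (MvPolynomial.continuous_eval F).comp (by fun_prop)

/-- The polynomial `p`, of degree at most `a`, represents the average of `F` over the `x` in the
sphere with `⟨x, y⟩² = s`, as a function of `s`. The average is characterized weakly, by integration
against polynomials in `⟨x, y⟩²`. -/
def IsZonalPoly (F : MvPolynomial (Fin n) ℝ) (y : USphere n) (a : ℕ) (p : ℝ[X]) : Prop :=
  p.natDegree ≤ a ∧ p.eval 1 = evalAt F y ∧ ∀ h : ℝ[X],
    ∫ x : USphere n, evalAt F x * h.eval (inner ℝ (x : EuclideanSpace ℝ (Fin n)) y ^ 2)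
      ∂(sphereMeasure n) = zonalMean n (h * p)

lemma integrable_evalAt_mul [NeZero n] (F : MvPolynomial (Fin n) ℝ) (y : USphere n) (h : ℝ[X]) :
    Integrable (fun x : USphere n =>
      evalAt F x * h.eval (inner ℝ (x : EuclideanSpace ℝ (Fin n)) y ^ 2)) (sphereMeasure n) := by
  have := continuous_evalAt F
  exact integrable_of_continuous (by fun_prop) _

lemma IsZonalPoly.of_pow [NeZero n] {F : MvPolynomial (Fin n) ℝ} {y : USphere n} {a : ℕ} {p : ℝ[X]}
    (hd : p.natDegree ≤ a) (h1 : p.eval 1 = evalAt F y)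
    (hp : ∀ j : ℕ, ∫ x : USphere n, evalAt F x *
      (inner ℝ (x : EuclideanSpace ℝ (Fin n)) y ^ 2) ^ j ∂(sphereMeasure n) =
        zonalMean n (X ^ j * p)) : IsZonalPoly F y a p := by
  refine ⟨hd, h1, fun h => ?_⟩
  induction h using Polynomial.induction_on' with
  | add f g hf hg =>
    rw [add_mul, map_add, ← hf, ← hg,
      ← integral_add (integrable_evalAt_mul F y f) (integrable_evalAt_mul F y g)]
    simp only [eval_add, mul_add]
  | monomial k c =>
    rw [← C_mul_X_pow_eq_monomial, ← smul_eq_C_mul, smul_mul_assoc, map_smul, ← hp, smul_eq_mul,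
      ← integral_const_mul]
    congr 1
    ext x
    simp only [eval_smul, eval_pow, eval_X, smul_eq_mul]
    ring

lemma IsZonalPoly.add [NeZero n] {F G : MvPolynomial (Fin n) ℝ} {y : USphere n} {a : ℕ} {p q : ℝ[X]}
    (hp : IsZonalPoly F y a p) (hq : IsZonalPoly G y a q) : IsZonalPoly (F + G) y a (p + q) := by
  have e : ∀ x, evalAt (F + G) x = evalAt F x + evalAt G x := fun x => by simp [evalAt]
  refine ⟨(natDegree_add_le _ _).trans (max_le hp.1 hq.1), by rw [eval_add, hp.2.1, hq.2.1, e],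
    fun h => ?_⟩
  rw [mul_add, map_add, ← hp.2.2, ← hq.2.2,
    ← integral_add (integrable_evalAt_mul F y h) (integrable_evalAt_mul G y h)]
  simp only [e, add_mul]

lemma IsZonalPoly.zero [NeZero n] {y : USphere n} {a : ℕ} :
    IsZonalPoly (0 : MvPolynomial (Fin n) ℝ) y a 0 :=
  ⟨by simp, by simp [evalAt], fun h => by simp [evalAt]⟩

/-- The moments of `x^α` times powers of `x_0²`, relative to those of `x^α`, are the moments of
`s^b (1 - s)^i`: both satisfy the same recursion. -/
lemma sphereMoment_iterate [NeZero n] (α : Fin n → ℕ) (b i j : ℕ) (hb : α 0 = 2 * b)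
    (hi : ∑ k, α k = 2 * b + 2 * i) :
    sphereMoment (Function.update α 0 (α 0 + 2 * j)) * zonalMean n (X ^ b * (1 - X) ^ i) =
      sphereMoment α * zonalMean n (X ^ (b + j) * (1 - X) ^ i) := by
  induction j with
  | zero => simp
  | succ j ih =>
    have h1 := sphereMoment_add_two (Function.update α 0 (α 0 + 2 * j)) 0
    have h2 := zonalMean_beta_succ (n := n) i (b + j)
    have hs : ∑ k, Function.update α 0 (α 0 + 2 * j) k = 2 * b + 2 * i + 2 * j := by
      rw [Finset.sum_update_of_mem (Finset.mem_univ _), ← hi,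
        ← Finset.add_sum_erase _ α (Finset.mem_univ 0), Finset.sdiff_singleton_eq_erase]
      ring
    rw [Function.update_idem, Function.update_self, hs,
      show α 0 + 2 * j + 2 = α 0 + 2 * (j + 1) by ring, hb] at h1
    rw [hb] at ih ⊢
    push_cast at h1 h2
    have hn : 0 < (n : ℝ) := Nat.cast_pos.2 (NeZero.pos n)
    have hp : 2 * ((b : ℝ) + j) + 2 * i + n ≠ 0 := by positivity
    refine mul_left_cancel₀ hp ?_
    rw [show b + (j + 1) = b + j + 1 by ring]
    linear_combination zonalMean n (X ^ b * (1 - X) ^ i) * h1 - sphereMoment α * h2 +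
      (2 * b + 2 * j + 1) * ih

/-- At the base point the zonal polynomial of a monomial is a multiple of `s^b (1 - s)^i`, and zero
if some exponent is odd. -/
lemma exists_isZonalPoly_monomial (hn : 2 ≤ n) [NeZero n] (α : Fin n →₀ ℕ) (c : ℝ) (a : ℕ)
    (hα : α.degree = 2 * a) :
    ∃ p, IsZonalPoly (MvPolynomial.monomial α c) (basePoint n) a p := by
  have hev : ∀ x : EuclideanSpace ℝ (Fin n), evalAt (MvPolynomial.monomial α c) x =
      c * ∏ k, x k ^ α k := fun x => by
    rw [evalAt, MvPolynomial.eval_monomial, Finsupp.prod_fintype _ _ (by simp)]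
  have hsum : ∑ k, α k = 2 * a := by rw [← hα, Finsupp.degree_eq_sum]
  have hmom : ∀ j : ℕ, ∫ x : USphere n, evalAt (MvPolynomial.monomial α c) x *
      (inner ℝ (x : EuclideanSpace ℝ (Fin n)) (basePoint n) ^ 2) ^ j ∂(sphereMeasure n) =
      c * sphereMoment (Function.update α 0 (α 0 + 2 * j)) := by
    intro j
    rw [sphereMoment, ← integral_const_mul]
    congr 1
    ext x
    rw [hev, inner_basePoint, ← Finset.mul_prod_erase _ _ (Finset.mem_univ 0),
      ← Finset.mul_prod_erase _ (fun k => _ ^ Function.update _ _ _ k) (Finset.mem_univ 0),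
      Function.update_self, pow_add, pow_mul]
    have : ∏ k ∈ Finset.univ.erase 0, (x : EuclideanSpace ℝ (Fin n)) k ^
        Function.update α 0 (α 0 + 2 * j) k =
        ∏ k ∈ Finset.univ.erase 0, (x : EuclideanSpace ℝ (Fin n)) k ^ α k :=
      Finset.prod_congr rfl fun k hk => by rw [Function.update_of_ne (Finset.ne_of_mem_erase hk)]
    rw [this]
    ring
  have hbase : ∀ k : Fin n, k ≠ 0 → (basePoint n : EuclideanSpace ℝ (Fin n)) k = 0 :=
    fun k hk => by simp [basePoint, hk]
  have hbase0 : (basePoint n : EuclideanSpace ℝ (Fin n)) 0 = 1 := by simp [basePoint]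
  by_cases hodd : ∃ k, Odd (α k)
  · obtain ⟨k, hk⟩ := hodd
    refine ⟨0, IsZonalPoly.of_pow (by simp) ?_ fun j => ?_⟩
    · rw [hev, eval_zero]
      obtain ⟨k', hk'0, hk'⟩ : ∃ k', k' ≠ 0 ∧ α k' ≠ 0 := by
        by_contra! hcon
        have h0 : ∑ k, α k = α 0 :=
          Finset.sum_eq_single 0 (fun k _ h => hcon k h) (by simp)
        rcases eq_or_ne k 0 with rfl | h
        · rw [← h0, hsum] at hk
          exact (Nat.not_odd_iff_even.2 (even_two_mul a)) hk
        · rw [hcon k h] at hk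
          simp at hk
      rw [Finset.prod_eq_zero (Finset.mem_univ k') (by rw [hbase k' hk'0, zero_pow hk']), mul_zero]
    · have h0 : Odd (Function.update (⇑α) 0 (α 0 + 2 * j) k) := by
        rcases eq_or_ne k 0 with rfl | h
        · rw [Function.update_self]
          exact hk.add_even (even_two_mul j)
        · rwa [Function.update_of_ne h]
      rw [hmom, sphereMoment_of_odd h0, mul_zero, mul_zero, (zonalMean n).map_zero]
  · push Not at hodd
    obtain ⟨b, hb⟩ := (Nat.not_odd_iff_even.1 (hodd 0)).two_dvd
    have hle : α 0 ≤ ∑ k, α k := Finset.single_le_sum (fun _ _ => Nat.zero_le _) (Finset.mem_univ 0)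
    obtain ⟨i, hi⟩ : ∃ i, a = b + i := ⟨a - b, by omega⟩
    have hZ := (zonalMean_beta_pos hn i b).ne'
    refine ⟨C (c * (sphereMoment α / zonalMean n (X ^ b * (1 - X) ^ i))) *
      (X ^ b * (1 - X) ^ i), IsZonalPoly.of_pow ?_ ?_ fun j => ?_⟩
    · refine (natDegree_C_mul_le _ _).trans ?_
      rw [hi]
      refine natDegree_mul_le_of_le (natDegree_X_pow_le b) ?_
      have h1 : (1 - X : ℝ[X]).natDegree ≤ 1 := (natDegree_sub_le _ _).trans (by simp)
      simpa using natDegree_pow_le_of_le i h1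
    · rw [hev]
      rcases Nat.eq_zero_or_pos i with rfl | hipos
      · have hs : (α : Fin n → ℕ) = Pi.single 0 (2 * b) := by
          ext k
          rcases eq_or_ne k 0 with rfl | hk
          · rw [hb, Pi.single_eq_same]
          · rw [Pi.single_eq_of_ne hk]
            have h2 := Finset.add_sum_erase _ α (Finset.mem_univ 0)
            have h3 := Finset.single_le_sum (f := α) (fun _ _ => Nat.zero_le _)
              (Finset.mem_erase.2 ⟨hk, Finset.mem_univ k⟩)
            omega
        rw [pow_zero, mul_one, zonalMean_X_pow, hs, sphereMoment_single,
          div_self (by rw [← zonalMean_X_pow]; exact (zonalMean_X_pow_pos b).ne')]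
        rw [Finset.prod_eq_single 0 (fun k _ hk => by simp [hk]) (by simp)]
        simp [hbase0]
      · obtain ⟨k', hk'0, hk'⟩ : ∃ k', k' ≠ 0 ∧ α k' ≠ 0 := by
          by_contra! hcon
          have h0 : ∑ k, α k = α 0 :=
            Finset.sum_eq_single 0 (fun k _ h => hcon k h) (by simp)
          omega
        rw [Finset.prod_eq_zero (Finset.mem_univ k') (by rw [hbase k' hk'0, zero_pow hk'])]
        simp [hipos.ne']
    · have h := sphereMoment_iterate (α : Fin n → ℕ) b i j hb (by omega)
      rw [hmom, mul_left_comm, ← smul_eq_C_mul, map_smul, smul_eq_mul, ← mul_assoc (X ^ j),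
        ← pow_add, add_comm j b, mul_assoc]
      congr 1
      rw [div_mul_eq_mul_div, eq_div_iff hZ, h]

/-- The polynomial `F ∘ R`. -/
noncomputable def rotatePoly (R : EuclideanSpace ℝ (Fin n) ≃ₗᵢ[ℝ] EuclideanSpace ℝ (Fin n))
    (F : MvPolynomial (Fin n) ℝ) : MvPolynomial (Fin n) ℝ :=
  MvPolynomial.aeval (fun k => ∑ j, MvPolynomial.C (R (EuclideanSpace.single j 1) k) *
    MvPolynomial.X j) F

lemma evalAt_rotatePoly (R : EuclideanSpace ℝ (Fin n) ≃ₗᵢ[ℝ] EuclideanSpace ℝ (Fin n))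
    (F : MvPolynomial (Fin n) ℝ) (x : EuclideanSpace ℝ (Fin n)) :
    evalAt (rotatePoly R F) x = evalAt F (R x) := by
  rw [evalAt, evalAt, rotatePoly, ← MvPolynomial.coe_aeval_eq_eval,
    ← MvPolynomial.coe_aeval_eq_eval]
  simp only [RingHom.coe_coe]
  rw [← AlgHom.comp_apply, MvPolynomial.comp_aeval]
  congr 1
  congr 1
  ext k
  simp only [map_sum, map_mul, MvPolynomial.aeval_C, MvPolynomial.aeval_X]
  have hx : x = ∑ j, x j • EuclideanSpace.single j (1 : ℝ) := by
    ext k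
    simp [Pi.single_apply]
  conv_rhs => rw [hx, map_sum]
  simp [mul_comm]

lemma isHomogeneous_rotatePoly (R : EuclideanSpace ℝ (Fin n) ≃ₗᵢ[ℝ] EuclideanSpace ℝ (Fin n))
    {F : MvPolynomial (Fin n) ℝ} {d : ℕ} (hF : F.IsHomogeneous d) :
    (rotatePoly R F).IsHomogeneous d := by
  have := hF.aeval (n := 1) (fun k => ∑ j, MvPolynomial.C (R (EuclideanSpace.single j 1) k) *
    MvPolynomial.X j) fun k => MvPolynomial.IsHomogeneous.sum _ _ _ fun j _ =>
      MvPolynomial.isHomogeneous_C_mul_X _ _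
  rwa [one_mul] at this

lemma exists_isZonalPoly (hn : 2 ≤ n) {F : MvPolynomial (Fin n) ℝ} {a : ℕ}
    (hF : F.IsHomogeneous (2 * a)) (y : USphere n) : ∃ p, IsZonalPoly F y a p := by
  have : NeZero n := ⟨by omega⟩
  obtain ⟨R, rfl⟩ := exists_rotation y
  have hbase : ∃ p, IsZonalPoly (rotatePoly R F) (basePoint n) a p := by
    have hG := isHomogeneous_rotatePoly R hF
    generalize rotatePoly R F = G at hG
    have key : ∀ s : Finset (Fin n →₀ ℕ), s ⊆ G.support → ∃ p, IsZonalPoly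
        (∑ α ∈ s, MvPolynomial.monomial α (G.coeff α)) (basePoint n) a p := by
      classical
      intro s
      induction s using Finset.induction_on with
      | empty => exact fun _ => ⟨0, by simpa using IsZonalPoly.zero⟩
      | insert α s hα ih =>
        intro hs
        obtain ⟨p, hp⟩ := ih fun x hx => hs (Finset.mem_insert_of_mem hx)
        obtain ⟨q, hq⟩ := exists_isZonalPoly_monomial hn α (G.coeff α) a (by
          by_contra hne
          exact MvPolynomial.mem_support_iff.1 (hs (Finset.mem_insert_self _ _))
            (hG.coeff_eq_zero hne))
        rw [Finset.sum_insert hα]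
        exact ⟨_, hq.add hp⟩
    have := key G.support subset_rfl
    rwa [MvPolynomial.support_sum_monomial_coeff] at this
  obtain ⟨p, hd, h1, hp⟩ := hbase
  refine ⟨p, hd, by rw [h1, evalAt_rotatePoly]; rfl, fun h => ?_⟩
  rw [← hp, integral_inner_rotate R (f := fun x t => evalAt F x * h.eval (t ^ 2))]
  · simp only [evalAt_rotatePoly, inner_basePoint]
  · have := continuous_evalAt F
    fun_prop

/-- A zonal polynomial inherits the upper bounds of `F`: the defining identity extends to continuous
functions, and is applied to the positive part of `p - c`. -/
lemma IsZonalPoly.le_of_le (hn : 2 ≤ n) {F : MvPolynomial (Fin n) ℝ} {y : USphere n} {a : ℕ}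
    {p : ℝ[X]} (hp : IsZonalPoly F y a p) {c : ℝ} (hF : ∀ x : USphere n, evalAt F x ≤ c)
    {s : ℝ} (hs : s ∈ Set.Icc (0 : ℝ) 1) : p.eval s ≤ c := by
  have : NeZero n := ⟨by omega⟩
  set t : USphere n → ℝ := fun x => inner ℝ (x : EuclideanSpace ℝ (Fin n)) y ^ 2 with ht
  have htc : Continuous t := by fun_prop
  have htm : ∀ x, t x ∈ Set.Icc (0 : ℝ) 1 := fun x => inner_sq_mem_Icc x y
  have hFc : Continuous fun x : USphere n => evalAt F x :=
    (continuous_evalAt F).comp continuous_subtype_val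
  -- the defining identity extends to continuous functions
  have hcont : ∀ φ : ℝ → ℝ, Continuous φ →
      ∫ x : USphere n, (evalAt F x - p.eval (t x)) * φ (t x) ∂(sphereMeasure n) = 0 := by
    intro φ hφ
    obtain ⟨K, hK⟩ : ∃ K, ∀ x : USphere n, |evalAt F x - p.eval (t x)| ≤ K := by
      obtain ⟨K, hK⟩ := isCompact_univ.exists_bound_of_continuousOn
        (f := fun x : USphere n => evalAt F x - p.eval (t x)) (by fun_prop)
      exact ⟨K, fun x => by simpa using hK x trivial⟩
    have hK0 : 0 ≤ K := (abs_nonneg _).trans (hK y)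
    by_contra hne
    have hpos := abs_pos.2 hne
    set I := ∫ x : USphere n, (evalAt F x - p.eval (t x)) * φ (t x) ∂(sphereMeasure n)
    obtain ⟨h, hh⟩ := exists_polynomial_near_of_continuousOn 0 1 φ hφ.continuousOn (|I| / (K + 1))
      (by positivity)
    have hz : ∫ x : USphere n, (evalAt F x - p.eval (t x)) * h.eval (t x)
        ∂(sphereMeasure n) = 0 := by
      have h1 := hp.2.2 h
      rw [← integral_eval_inner_sq y, ← sub_eq_zero, ← integral_sub] at h1
      · rw [← h1]
        congr 1
        ext x
        simp only [eval_mul, ht]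
        ring
      · exact integrable_evalAt_mul F y h
      · exact integrable_of_continuous (by fun_prop) _
    have hI : I = ∫ x : USphere n, (evalAt F x - p.eval (t x)) * (φ (t x) - h.eval (t x))
        ∂(sphereMeasure n) := by
      simp only [mul_sub]
      rw [integral_sub, hz, sub_zero]
      · exact integrable_of_continuous (by fun_prop) _
      · exact integrable_of_continuous (by fun_prop) _
    have hle : |I| ≤ K * (|I| / (K + 1)) := by
      conv_lhs => rw [hI]
      have := norm_integral_le_of_norm_le_const (μ := sphereMeasure n)
        (f := fun x : USphere n => (evalAt F x - p.eval (t x)) * (φ (t x) - h.eval (t x)))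
        (C := K * (|I| / (K + 1))) (Filter.Eventually.of_forall fun x => by
          rw [Real.norm_eq_abs, abs_mul]
          refine mul_le_mul (hK x) ?_ (abs_nonneg _) hK0
          rw [abs_sub_comm]
          exact (hh _ (htm x)).le)
      simpa using this
    have : K * (|I| / (K + 1)) < |I| := by
      rw [mul_div_assoc', div_lt_iff₀ (by positivity)]
      nlinarith
    linarith
  set φ : ℝ → ℝ := fun s => max (p.eval s - c) 0 with hφdef
  have hφ : Continuous φ := by fun_prop
  have h0 := hcont φ hφ
  have hsq : ∫ x : USphere n, φ (t x) ^ 2 ∂(sphereMeasure n) ≤ 0 := by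
    rw [← neg_nonneg, ← h0, ← integral_neg]
    refine integral_mono (integrable_of_continuous (by fun_prop) _)
      (integrable_of_continuous (by fun_prop) _) fun x => ?_
    have := hF x
    simp only [hφdef]
    rcases le_total (p.eval (t x) - c) 0 with h | h
    · rw [max_eq_right h]; simp
    · rw [max_eq_left h]; nlinarith
  have hnn : 0 ≤ fun x : USphere n => φ (t x) ^ 2 := fun x => sq_nonneg _
  have hc2 : Continuous fun x : USphere n => φ (t x) ^ 2 := by fun_prop
  have h2 := (integral_eq_zero_iff_of_nonneg hnn (integrable_of_continuous hc2 _)).1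
    (le_antisymm hsq (integral_nonneg hnn))
  have h3 := (hc2.ae_eq_iff_eq (sphereMeasure n) continuous_zero).1 h2
  obtain ⟨x, hx⟩ := exists_inner_sq_eq hn y hs
  have h4 := congrFun h3 x
  have h5 : t x = s := hx
  simp only [h5, Pi.zero_apply, sq_eq_zero_iff, hφdef] at h4
  have := le_max_left (p.eval s - c) 0
  linarith

lemma IsZonalPoly.neg {F : MvPolynomial (Fin n) ℝ} {y : USphere n} {a : ℕ} {p : ℝ[X]}
    (hp : IsZonalPoly F y a p) : IsZonalPoly (-F) y a (-p) := by
  have e : ∀ x, evalAt (-F) x = -evalAt F x := fun x => by simp [evalAt]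
  refine ⟨by simpa using hp.1, by rw [eval_neg, hp.2.1, e], fun h => ?_⟩
  rw [mul_neg, map_neg, ← hp.2.2, ← integral_neg]
  simp only [e, neg_mul]

lemma IsZonalPoly.abs_le (hn : 2 ≤ n) {F : MvPolynomial (Fin n) ℝ} {y : USphere n} {a : ℕ}
    {p : ℝ[X]} (hp : IsZonalPoly F y a p) {c : ℝ} (hF : ∀ x : USphere n, |evalAt F x| ≤ c)
    {s : ℝ} (hs : s ∈ Set.Icc (0 : ℝ) 1) : |p.eval s| ≤ c := by
  refine _root_.abs_le.2 ⟨?_, hp.le_of_le hn (fun x => (_root_.abs_le.1 (hF x)).2) hs⟩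
  have := hp.neg.le_of_le hn (c := c) (fun x => by
    have := (_root_.abs_le.1 (hF x)).1
    simp only [evalAt, map_neg] at this ⊢
    linarith) hs
  rw [eval_neg] at this
  linarith

end

/-! ### Forms obtained from a functional on zonal polynomials -/

section

open Polynomial

variable {n : ℕ}

lemma inner_eq_sum (x y : EuclideanSpace ℝ (Fin n)) : inner ℝ x y = ∑ j, x j * y j := by
  rw [PiLp.inner_apply]
  exact Finset.sum_congr rfl fun j _ => mul_comm _ _

/-- The form `∑ X_j²`, which is one on the sphere. -/
noncomputable def normSqPoly (n : ℕ) : MvPolynomial (Fin n) ℝ := ∑ j, MvPolynomial.X j ^ 2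

lemma isHomogeneous_normSqPoly : (normSqPoly n).IsHomogeneous 2 :=
  MvPolynomial.IsHomogeneous.sum _ _ _ fun j _ => MvPolynomial.isHomogeneous_X_pow j 2

lemma evalAt_normSqPoly (y : USphere n) : evalAt (normSqPoly n) y = 1 := by
  have h : ‖(y : EuclideanSpace ℝ (Fin n))‖ ^ 2 = 1 := by simp
  rw [EuclideanSpace.norm_sq_eq] at h
  simpa [evalAt, normSqPoly] using h

/-- The linear form `⟨x, ·⟩`. -/
noncomputable def linPoly (x : EuclideanSpace ℝ (Fin n)) : MvPolynomial (Fin n) ℝ :=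
  ∑ j, MvPolynomial.C (x j) * MvPolynomial.X j

lemma isHomogeneous_linPoly (x : EuclideanSpace ℝ (Fin n)) : (linPoly x).IsHomogeneous 1 :=
  MvPolynomial.IsHomogeneous.sum _ _ _ fun _ _ => MvPolynomial.isHomogeneous_C_mul_X _ _

lemma evalAt_linPoly (x y : EuclideanSpace ℝ (Fin n)) : evalAt (linPoly x) y = inner ℝ x y := by
  simp [evalAt, linPoly, inner_eq_sum]

/-- The form `y ↦ ∫ F(x) ⟨x, y⟩^m dx`. -/
noncomputable def momentPoly (F : MvPolynomial (Fin n) ℝ) (m : ℕ) : MvPolynomial (Fin n) ℝ :=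
  ∑ w : Fin m → Fin n, MvPolynomial.C (∫ x : USphere n, evalAt F x *
    ∏ k, (x : EuclideanSpace ℝ (Fin n)) (w k) ∂(sphereMeasure n)) * ∏ k, MvPolynomial.X (w k)

lemma isHomogeneous_momentPoly (F : MvPolynomial (Fin n) ℝ) (m : ℕ) :
    (momentPoly F m).IsHomogeneous m := by
  refine MvPolynomial.IsHomogeneous.sum _ _ _ fun w _ => MvPolynomial.IsHomogeneous.C_mul ?_ _
  simpa using MvPolynomial.IsHomogeneous.prod Finset.univ (fun k => MvPolynomial.X (R := ℝ) (w k))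
    (fun _ => 1) fun k _ => MvPolynomial.isHomogeneous_X ℝ (w k)

lemma evalAt_momentPoly [NeZero n] (F : MvPolynomial (Fin n) ℝ) (m : ℕ)
    (y : EuclideanSpace ℝ (Fin n)) : evalAt (momentPoly F m) y =
      ∫ x : USphere n, evalAt F x * inner ℝ (x : EuclideanSpace ℝ (Fin n)) y ^ m
        ∂(sphereMeasure n) := by
  have hF := continuous_evalAt F
  simp only [inner_eq_sum, Fintype.sum_pow, Finset.mul_sum]
  rw [integral_finsetSum]
  swap
  · exact fun w _ => integrable_of_continuous (by fun_prop) _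
  simp only [evalAt, momentPoly, map_sum, map_mul, MvPolynomial.eval_C, map_prod,
    MvPolynomial.eval_X]
  refine Finset.sum_congr rfl fun w _ => ?_
  rw [← integral_mul_const]
  congr 1
  ext x
  rw [Finset.prod_mul_distrib]
  ring

/-- Riesz representation of functionals on polynomials of degree at most `a`, for the inner product
given by `zonalMean`. -/
lemma exists_zonalMean_mul_eq (hn : 2 ≤ n) (a : ℕ) (Λ : ℝ[X] →ₗ[ℝ] ℝ) :
    ∃ f : ℝ[X], f.natDegree ≤ a ∧ ∀ p : ℝ[X], p.natDegree ≤ a → zonalMean n (f * p) = Λ p := by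
  have : NeZero n := ⟨by omega⟩
  set V := degreeLT ℝ (a + 1) with hV
  have hmem : ∀ p : ℝ[X], p.natDegree ≤ a ↔ p ∈ V := fun p => by
    rw [hV, mem_degreeLT, ← Nat.lt_succ_iff]
    rcases eq_or_ne p 0 with rfl | hp
    · simp
    · exact (natDegree_lt_iff_degree_lt hp)
  have : Module.Finite ℝ V := Module.Finite.equiv (degreeLTEquiv ℝ (a + 1)).symm
  let B : V →ₗ[ℝ] Module.Dual ℝ V :=
    ((LinearMap.mul ℝ ℝ[X]).compr₂ (zonalMean n)).domRestrict₁₂ V V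
  have hB : ∀ f p : V, B f p = zonalMean n (f.1 * p.1) := fun f p => rfl
  have hinj : Function.Injective B := by
    rw [injective_iff_map_eq_zero]
    intro f hf
    by_contra hne
    have h1 : B f f = 0 := by rw [hf]; rfl
    have h2 : (f : ℝ[X]) ≠ 0 := fun h => hne (Subtype.ext h)
    have h3 := zonalMean_pos hn (h := f.1 * f.1)
      (fun s _ => by rw [eval_mul]; exact mul_self_nonneg _) (mul_ne_zero h2 h2)
    rw [hB] at h1
    exact h3.ne' h1
  have hsurj := (LinearMap.injective_iff_surjective_of_finrank_eq_finrank
    (Subspace.dual_finrank_eq (K := ℝ) (V := V)).symm).1 hinj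
  obtain ⟨f, hf⟩ := hsurj (Λ.domRestrict V)
  refine ⟨f, (hmem _).2 f.2, fun p hp => ?_⟩
  rw [← hB f ⟨p, (hmem p).1 hp⟩, hf]
  rfl

/-- A functional `Λ` of the zonal polynomials of `F` is realized by a form `G` of the same degree.
If `f` represents `Λ`, then `G(y) = ∫ F(x) f(⟨x, y⟩²) dx` on the sphere, made homogeneous by powers
of `|y|²`. -/
lemma exists_form_of_functional (hn : 2 ≤ n) {F : MvPolynomial (Fin n) ℝ} (a : ℕ)
    (Λ : ℝ[X] →ₗ[ℝ] ℝ) :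
    ∃ G : MvPolynomial (Fin n) ℝ, G.IsHomogeneous (2 * a) ∧
      ∀ (y : USphere n) (p : ℝ[X]), IsZonalPoly F y a p → evalAt G y = Λ p := by
  have : NeZero n := ⟨by omega⟩
  obtain ⟨f, hfd, hf⟩ := exists_zonalMean_mul_eq hn a Λ
  refine ⟨∑ i ∈ Finset.range (a + 1), MvPolynomial.C (f.coeff i) *
    (momentPoly F (2 * i) * normSqPoly n ^ (a - i)), ?_, fun y p hp => ?_⟩
  · refine MvPolynomial.IsHomogeneous.sum _ _ _ fun i hi => MvPolynomial.IsHomogeneous.C_mul ?_ _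
    have := (isHomogeneous_momentPoly F (2 * i)).mul
      (isHomogeneous_normSqPoly (n := n) |>.pow (a - i))
    rwa [← mul_add, Nat.add_sub_of_le (Nat.lt_succ_iff.1 (Finset.mem_range.1 hi))] at this
  · have hFc := continuous_evalAt F
    rw [← hf p hp.1, ← hp.2.2 f]
    simp only [eval_eq_sum_range' (Nat.lt_succ_iff.2 hfd), Finset.mul_sum]
    rw [integral_finsetSum]
    swap
    · exact fun i _ => integrable_of_continuous (by fun_prop) _
    have h1 : ∀ i, evalAt (MvPolynomial.C (f.coeff i) * (momentPoly F (2 * i) *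
        normSqPoly n ^ (a - i))) y = f.coeff i * evalAt (momentPoly F (2 * i)) y := fun i => by
      have := evalAt_normSqPoly y
      simp only [evalAt] at this
      simp only [evalAt, map_mul, map_pow, this, one_pow, mul_one, MvPolynomial.eval_C]
    have h2 : evalAt (∑ i ∈ Finset.range (a + 1), MvPolynomial.C (f.coeff i) *
        (momentPoly F (2 * i) * normSqPoly n ^ (a - i))) y =
        ∑ i ∈ Finset.range (a + 1), evalAt (MvPolynomial.C (f.coeff i) *
        (momentPoly F (2 * i) * normSqPoly n ^ (a - i))) y := by
      simp only [evalAt, map_sum]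
    rw [h2]
    refine Finset.sum_congr rfl fun i _ => ?_
    rw [h1, evalAt_momentPoly, ← integral_const_mul]
    congr 1
    ext x
    rw [pow_mul]
    ring

end

/-! ### Polynomial matrices and signed representations of maximally symmetric matrices -/

section

open Polynomial

variable {n : ℕ}

lemma wordExponent_apply {ι : Type*} [Fintype ι] (w : ι → Fin n) (j : Fin n) :
    wordExponent w j = Fintype.card {k // w k = j} := by
  rw [wordExponent, Finsupp.finsetSum_apply, Fintype.card_subtype, Finset.card_filter]
  exact Finset.sum_congr rfl fun k _ => by simp [Finsupp.single_apply]

lemma degree_wordExponent {ι : Type*} [Fintype ι] (w : ι → Fin n) :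
    (wordExponent w).degree = Fintype.card ι := by
  simp [wordExponent, map_sum]

/-- Words with the same exponent vector differ by a permutation of their letters. -/
lemma exists_perm_of_wordExponent_eq {ι : Type*} [Fintype ι] {w w' : ι → Fin n}
    (h : wordExponent w = wordExponent w') : ∃ π : Equiv.Perm ι, w' ∘ π = w := by
  have hc : ∀ j, Nonempty ({k // w k = j} ≃ {k // w' k = j}) := fun j => by
    rw [← Fintype.card_eq, ← wordExponent_apply, ← wordExponent_apply, h]
  exact ⟨Equiv.ofFiberEquiv fun j => (hc j).some, funext fun k => Equiv.ofFiberEquiv_map _ k⟩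

lemma prod_word {ι R : Type*} [Fintype ι] [CommSemiring R] (w : ι → Fin n) (x : Fin n → R) :
    ∏ k, x (w k) = ∏ j, x j ^ wordExponent w j := by
  classical
  rw [← Finset.prod_fiberwise_of_maps_to (s := Finset.univ) (t := Finset.univ) (g := w)
    (fun _ _ => Finset.mem_univ _)]
  refine Finset.prod_congr rfl fun j _ => ?_
  rw [Finset.prod_congr rfl (g := fun _ => x j) fun k hk => by rw [(Finset.mem_filter.1 hk).2],
    Finset.prod_const, wordExponent_apply, Fintype.card_subtype]

lemma prod_X_word {ι : Type*} [Fintype ι] (w : ι → Fin n) :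
    ∏ k, MvPolynomial.X (R := ℝ) (w k) = MvPolynomial.monomial (wordExponent w) 1 := by
  rw [prod_word w (fun j => MvPolynomial.X (R := ℝ) j), MvPolynomial.monomial_eq,
    Finsupp.prod_fintype _ _ (by simp)]
  simp

/-- The number of words with a given exponent vector is a multinomial coefficient. -/
lemma card_word_mul_factorial {ι : Type*} [Fintype ι] [DecidableEq ι] (e : Fin n →₀ ℕ)
    (he : e.degree = Fintype.card ι) :
    Fintype.card {w : ι → Fin n // wordExponent w = e} * ∏ j, (e j).factorial =
      (Fintype.card ι).factorial := by
  have h1 : MvPolynomial.coeff e ((∑ j, (1 : ℝ) • MvPolynomial.X (R := ℝ) (σ := Fin n) j) ^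
      Fintype.card ι) = Fintype.card {w : ι → Fin n // wordExponent w = e} := by
    have : (∑ j, (1 : ℝ) • MvPolynomial.X (R := ℝ) (σ := Fin n) j) ^ Fintype.card ι =
        ∑ w : ι → Fin n, MvPolynomial.monomial (wordExponent w) 1 := by
      rw [← Finset.card_univ, ← Finset.prod_const, Finset.prod_univ_sum, Fintype.piFinset_univ]
      refine Finset.sum_congr rfl fun w _ => ?_
      rw [← prod_X_word]
      simp
    rw [this, MvPolynomial.coeff_sum, Fintype.card_subtype, Finset.card_filter]
    push_cast
    exact Finset.sum_congr rfl fun w _ => by rw [MvPolynomial.coeff_monomial]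
  have hs : e.sum (fun _ m => m) = Fintype.card ι := by
    rw [← he, Finsupp.degree_apply]; rfl
  have h2 := MvPolynomial.coeff_linearCombination_X_pow_of_fintype (fun _ : Fin n => (1 : ℝ)) e
    (Fintype.card ι)
  rw [if_pos hs, h1] at h2
  have h3 : Fintype.card {w : ι → Fin n // wordExponent w = e} = e.multinomial := by
    simpa using h2
  have h4 := Nat.multinomial_spec Finset.univ e
  rw [← Finsupp.degree_eq_sum, he] at h4
  rw [h3, ← h4, mul_comm]
  congr 1
  exact (Finsupp.multinomial_of_support_subset (Finset.subset_univ e.support)).symm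

lemma tensorPow_eq (l : ℕ) (x : EuclideanSpace ℝ (Fin n)) (u : Fin l → Fin n) :
    tensorPow l x u = ∏ j, x j ^ wordExponent u j := prod_word u fun j => x j

/-- Pairing with the polynomial matrix of `F` evaluates `F`. -/
lemma trace_polyMatrix_mul_tensorProj {a : ℕ} {F : MvPolynomial (Fin n) ℝ}
    (hF : F.IsHomogeneous (2 * a)) (y : EuclideanSpace ℝ (Fin n)) :
    (polyMatrix a F * tensorProj a y).trace = evalAt F y := by
  classical
  have hfact : ((2 * a).factorial : ℝ) ≠ 0 := by exact_mod_cast (2 * a).factorial_ne_zero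
  set g : (Fin n →₀ ℕ) → ℝ := fun e =>
    F.coeff e * (∏ k, (e k).factorial : ℕ) / ((2 * a).factorial : ℝ) * ∏ j, y j ^ e j with hg
  have hw : ∀ u v : Fin a → Fin n, wordExponent (Sum.elim u v) = wordExponent u + wordExponent v :=
    fun u v => by simp [wordExponent, Fintype.sum_sum_type]
  have h1 : (polyMatrix a F * tensorProj a y).trace =
      ∑ w : Fin a ⊕ Fin a → Fin n, g (wordExponent w) := by
    rw [← (Equiv.sumArrowEquivProdArrow (Fin a) (Fin a) (Fin n)).symm.sum_comp,
      Fintype.sum_prod_type, Matrix.trace]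
    refine Finset.sum_congr rfl fun u _ => ?_
    rw [Matrix.diag_apply, Matrix.mul_apply]
    refine Finset.sum_congr rfl fun v _ => ?_
    have : (Equiv.sumArrowEquivProdArrow (Fin a) (Fin a) (Fin n)).symm (u, v) = Sum.elim u v := rfl
    rw [this, hw]
    simp only [hg, polyMatrix, Matrix.of_apply, tensorProj, Matrix.vecMulVec_apply, tensorPow_eq,
      Finsupp.add_apply, pow_add, Finset.prod_mul_distrib]
    ring
  have h2 : ∀ w : Fin a ⊕ Fin a → Fin n, g (wordExponent w) =
      ∑ e ∈ F.support, if wordExponent w = e then g e else 0 := fun w => by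
    rw [Finset.sum_ite_eq]
    split_ifs with h
    · rfl
    · rw [MvPolynomial.notMem_support_iff] at h
      simp [hg, h]
  rw [h1, Finset.sum_congr rfl fun w _ => h2 w, Finset.sum_comm, evalAt, MvPolynomial.eval_eq']
  refine Finset.sum_congr rfl fun e he => ?_
  have hdeg : e.degree = Fintype.card (Fin a ⊕ Fin a) := by
    by_contra hne
    refine MvPolynomial.mem_support_iff.1 he (hF.coeff_eq_zero ?_)
    rwa [Fintype.card_sum, Fintype.card_fin, ← two_mul] at hne
  have hcard := card_word_mul_factorial (ι := Fin a ⊕ Fin a) e hdeg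
  rw [← Finset.sum_filter, Finset.sum_const, nsmul_eq_mul, ← Fintype.card_subtype]
  have hcard' : (Fintype.card {w : Fin a ⊕ Fin a → Fin n // wordExponent w = e} : ℝ) *
      (∏ j, (e j).factorial : ℕ) = ((2 * a).factorial : ℝ) := by
    rw [← Nat.cast_mul, hcard]
    simp [two_mul]
  simp only [hg]
  rw [div_mul_eq_mul_div, mul_div_assoc', div_eq_iff hfact, ← hcard']
  ring

/-- A maximally symmetric matrix is a combination of the `|y⟩⟨y|^{⊗ l}`, with coefficients of
either sign. Otherwise a functional separates `M` from the span of these; it gives a form of degree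
`2l` that vanishes on the sphere, hence is zero, so it also vanishes on `M`. -/
lemma IsMaxSym.exists_signed_representation [NeZero n] {l : ℕ} {M : TensorMatrix n l}
    (hM : IsMaxSym M) :
    ∃ c : USphere n →₀ ℝ,
      M = ∑ y ∈ c.support, c y • tensorProj l (y : EuclideanSpace ℝ (Fin n)) := by
  classical
  suffices h : M ∈ Submodule.span ℝ (Set.range fun y : USphere n =>
      tensorProj l (y : EuclideanSpace ℝ (Fin n))) by
    obtain ⟨c, hc⟩ := (Finsupp.mem_span_range_iff_exists_finsupp).1 h
    exact ⟨c, hc.symm⟩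
  by_contra hnot
  obtain ⟨f, hfM, hf⟩ := Submodule.exists_le_ker_of_notMem hnot
  refine hfM ?_
  set b : (Fin l ⊕ Fin l → Fin n) → ℝ := fun w =>
    f (Matrix.single (fun k => w (Sum.inl k)) (fun k => w (Sum.inr k)) 1) with hb
  have hfA : ∀ A : TensorMatrix n l, f A = ∑ w, vectorize A w * b w := by
    intro A
    conv_lhs => rw [Matrix.matrix_eq_sum_single A]
    rw [← (Equiv.sumArrowEquivProdArrow (Fin l) (Fin l) (Fin n)).symm.sum_comp,
      Fintype.sum_prod_type, map_sum]
    refine Finset.sum_congr rfl fun u _ => ?_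
    rw [map_sum]
    refine Finset.sum_congr rfl fun v _ => ?_
    have : Matrix.single u v (A u v) = A u v • Matrix.single u v (1 : ℝ) := by
      rw [Matrix.smul_single, smul_eq_mul, mul_one]
    rw [this, map_smul, smul_eq_mul]
    rfl
  -- the form `∑ b_w x^w` vanishes on the sphere, hence identically
  set P : MvPolynomial (Fin n) ℝ :=
    ∑ w : Fin l ⊕ Fin l → Fin n, MvPolynomial.monomial (wordExponent w) (b w) with hP
  have hPhom : P.IsHomogeneous (2 * l) :=
    MvPolynomial.IsHomogeneous.sum _ _ _ fun w _ => MvPolynomial.isHomogeneous_monomial _ (by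
      rw [degree_wordExponent]; simp [two_mul])
  have hPeval : ∀ x : EuclideanSpace ℝ (Fin n), evalAt P x = f (tensorProj l x) := by
    intro x
    rw [hfA, evalAt, hP, map_sum]
    refine Finset.sum_congr rfl fun w _ => ?_
    rw [MvPolynomial.eval_monomial, Finsupp.prod_fintype _ _ (by simp), ← prod_word w fun j => x j,
      Fintype.prod_sum_type, mul_comm]
    rfl
  have hPzero : P = 0 := by
    refine hPhom.eq_zero_of_forall_eval_eq_zero fun r => ?_
    set x : EuclideanSpace ℝ (Fin n) := WithLp.toLp 2 r
    have hscale : ∀ (t : ℝ) (z : EuclideanSpace ℝ (Fin n)),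
        tensorProj l (t • z) = t ^ (2 * l) • tensorProj l z := by
      intro t z
      ext u v
      simp only [tensorProj, Matrix.vecMulVec_apply, Matrix.smul_apply, tensorPow, PiLp.smul_apply,
        smul_eq_mul, Finset.prod_mul_distrib, Finset.prod_const, Finset.card_univ, Fintype.card_fin]
      ring
    have hfs : ∀ y : USphere n, f (tensorProj l (y : EuclideanSpace ℝ (Fin n))) = 0 := fun y =>
      hf (Submodule.subset_span ⟨y, rfl⟩)
    change evalAt P x = 0
    rcases eq_or_ne x 0 with h0 | h0
    · rw [hPeval, h0, ← zero_smul ℝ (basePoint n : EuclideanSpace ℝ (Fin n)), hscale, map_smul, hfs,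
        smul_zero]
    · have hx : x = ‖x‖ • ((‖x‖⁻¹ : ℝ) • x) := by
        rw [smul_smul, mul_inv_cancel₀ (norm_ne_zero_iff.2 h0), one_smul]
      rw [hPeval, hx, hscale, map_smul, hfs ⟨(‖x‖⁻¹ : ℝ) • x, by
        simp [norm_smul, inv_mul_cancel₀ (norm_ne_zero_iff.2 h0)]⟩, smul_zero]
  -- `M` is constant on the words with a given exponent vector
  rw [hfA, ← Finset.sum_fiberwise_of_maps_to (s := Finset.univ)
    (t := Finset.univ.image (wordExponent (n := n) (ι := Fin l ⊕ Fin l))) (g := wordExponent)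
    (fun w _ => Finset.mem_image_of_mem _ (Finset.mem_univ w))]
  refine Finset.sum_eq_zero fun e he => ?_
  obtain ⟨w₀, -, rfl⟩ := Finset.mem_image.1 he
  have hcoef := congrArg (MvPolynomial.coeff (wordExponent w₀)) hPzero
  rw [hP, MvPolynomial.coeff_sum, MvPolynomial.coeff_zero] at hcoef
  simp only [MvPolynomial.coeff_monomial] at hcoef
  rw [← Finset.sum_filter] at hcoef
  rw [Finset.sum_congr rfl (g := fun w => vectorize M w₀ * b w), ← Finset.mul_sum, hcoef, mul_zero]
  intro w hw
  obtain ⟨π, hπ⟩ := exists_perm_of_wordExponent_eq (Finset.mem_filter.1 hw).2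
  rw [← hπ, hM π]

end

/-! ### Pseudo-distributions -/

section

open Polynomial

variable {n : ℕ}

lemma sum_tensorPow_mul_self (m : ℕ) (y : USphere n) :
    ∑ w, tensorPow m (y : EuclideanSpace ℝ (Fin n)) w * tensorPow m y w = 1 := by
  have h : ∑ j, (y : EuclideanSpace ℝ (Fin n)) j * (y : EuclideanSpace ℝ (Fin n)) j = 1 := by
    rw [← inner_eq_sum, real_inner_self_eq_norm_sq]
    simp
  simp only [tensorPow, ← Finset.prod_mul_distrib]
  rw [← Fintype.sum_pow (fun j => (y : EuclideanSpace ℝ (Fin n)) j *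
    (y : EuclideanSpace ℝ (Fin n)) j) m, h, one_pow]

lemma reducedMatrix_tensorProj {a l : ℕ} (h : a ≤ l) (y : USphere n) :
    reducedMatrix a h (tensorProj l (y : EuclideanSpace ℝ (Fin n))) =
      tensorProj a (y : EuclideanSpace ℝ (Fin n)) := by
  have key : ∀ (u : Fin a → Fin n) (w : Fin (l - a) → Fin n),
      tensorPow l (y : EuclideanSpace ℝ (Fin n))
        (Fin.append u w ∘ Fin.cast (Nat.add_sub_of_le h).symm) =
      tensorPow a y u * tensorPow (l - a) y w := by
    intro u w
    simp only [tensorPow, Function.comp_apply]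
    have hc := (finCongr (Nat.add_sub_of_le h).symm).prod_comp
      (fun k => (y : EuclideanSpace ℝ (Fin n)) (Fin.append u w k))
    simp only [finCongr_apply] at hc
    rw [hc, Fin.prod_univ_add]
    simp
  ext u v
  simp only [reducedMatrix, Matrix.of_apply, tensorProj, Matrix.vecMulVec_apply, key]
  have hsum := congrArg
    (fun r => tensorPow a (y : EuclideanSpace ℝ (Fin n)) u * tensorPow a y v * r)
    (sum_tensorPow_mul_self (l - a) y)
  simp only [mul_one, Finset.mul_sum] at hsum
  rw [← hsum]
  exact Finset.sum_congr rfl fun w _ => by ring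

/-- Weights `c`, of either sign, on finitely many points of the sphere that behave like a
probability measure towards squares of forms of degree at most `l`. These are the weights of the
signed combinations `∑ c_y |y⟩⟨y|^{⊗ l}` that are states, see `IsState.isPseudoDistribution`. -/
structure IsPseudoDistribution (l : ℕ) (c : USphere n →₀ ℝ) : Prop where
  sum_eq_one : ∑ y ∈ c.support, c y = 1
  sq_nonneg : ∀ {d : ℕ} (P : MvPolynomial (Fin n) ℝ), P.IsHomogeneous d → d ≤ l →
    0 ≤ ∑ y ∈ c.support, c y * evalAt P y ^ 2

lemma qRep_tensorProj (l : ℕ) (x y : EuclideanSpace ℝ (Fin n)) :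
    qRep (tensorProj l y) x = inner ℝ x y ^ (2 * l) := by
  have h : tensorPow l x ⬝ᵥ tensorPow l y = inner ℝ x y ^ l := by
    rw [inner_eq_sum, Fintype.sum_pow]
    simp only [dotProduct, tensorPow, Finset.prod_mul_distrib]
  rw [qRep, tensorProj, Matrix.vecMulVec_mulVec, dotProduct_comm (tensorPow l y), h]
  simp [h]
  ring

lemma qRep_sum {l : ℕ} (s : Finset (USphere n)) (c : USphere n → ℝ)
    (x : EuclideanSpace ℝ (Fin n)) :
    qRep (∑ y ∈ s, c y • tensorProj l (y : EuclideanSpace ℝ (Fin n))) x =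
      ∑ y ∈ s, c y * inner ℝ x (y : EuclideanSpace ℝ (Fin n)) ^ (2 * l) := by
  simp only [← qRep_tensorProj]
  simp only [qRep, Matrix.sum_mulVec, dotProduct_sum, Matrix.smul_mulVec, dotProduct_smul,
    smul_eq_mul]

/-- A form of degree `d` is a linear functional of `|x⟩^{⊗ d}`. -/
lemma exists_word_coeff {d : ℕ} {P : MvPolynomial (Fin n) ℝ} (hP : P.IsHomogeneous d) :
    ∃ z : (Fin d → Fin n) → ℝ, ∀ x, evalAt P x = ∑ u, z u * tensorPow d x u := by
  classical
  have hmon : ∀ e ∈ P.support, ∃ u : Fin d → Fin n, wordExponent u = e := by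
    intro e he
    have hdeg : e.degree = Fintype.card (Fin d) := by
      by_contra hne
      refine MvPolynomial.mem_support_iff.1 he (hP.coeff_eq_zero ?_)
      simpa using hne
    have h := card_word_mul_factorial (ι := Fin d) e hdeg
    have hpos : 0 < Fintype.card {w : Fin d → Fin n // wordExponent w = e} := by
      rw [Nat.pos_iff_ne_zero]
      intro h0
      rw [h0, zero_mul] at h
      exact (Nat.factorial_ne_zero _) h.symm
    obtain ⟨w, hw⟩ := Fintype.card_pos_iff.1 hpos
    exact ⟨w, hw⟩
  choose W hW using hmon
  refine ⟨fun u => ∑ e ∈ P.support.attach, if u = W e.1 e.2 then P.coeff e.1 else 0, fun x => ?_⟩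
  simp only [Finset.sum_mul]
  rw [Finset.sum_comm, evalAt, MvPolynomial.eval_eq', ← Finset.sum_attach]
  refine Finset.sum_congr rfl fun e _ => ?_
  rw [Finset.sum_eq_single (W e.1 e.2) (fun u _ hu => by rw [if_neg hu, zero_mul]) (by simp),
    if_pos rfl, tensorPow_eq, hW e.1 e.2]

lemma IsState.isPseudoDistribution {l : ℕ} {c : USphere n →₀ ℝ}
    (hM : IsState (∑ y ∈ c.support, c y • tensorProj l (y : EuclideanSpace ℝ (Fin n)))) :
    IsPseudoDistribution l c := by
  refine ⟨?_, fun {d} P hP hd => ?_⟩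
  · rw [← hM.2, Matrix.trace_sum]
    refine Finset.sum_congr rfl fun y _ => ?_
    rw [Matrix.trace_smul, Matrix.trace]
    simp only [Matrix.diag_apply, tensorProj, Matrix.vecMulVec_apply, sum_tensorPow_mul_self,
      smul_eq_mul, mul_one]
  · have hfull : ∀ Q : MvPolynomial (Fin n) ℝ, Q.IsHomogeneous l →
        0 ≤ ∑ y ∈ c.support, c y * evalAt Q y ^ 2 := by
      intro Q hQ
      obtain ⟨z, hz⟩ := exists_word_coeff hQ
      have h := hM.1.dotProduct_mulVec_nonneg z
      simp only [star_trivial, Matrix.sum_mulVec, dotProduct_sum, Matrix.smul_mulVec,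
        dotProduct_smul, smul_eq_mul, tensorProj, Matrix.vecMulVec_mulVec] at h
      refine h.trans_eq (Finset.sum_congr rfl fun y _ => ?_)
      have h2 : evalAt Q y = z ⬝ᵥ tensorPow l (y : EuclideanSpace ℝ (Fin n)) := hz _
      rw [h2, dotProduct_comm (tensorPow l _) z]
      simp only [MulOpposite.smul_eq_mul_unop, MulOpposite.unop_op]
      ring
    -- multiply by `|y|^{2(l-d)} = 1` to reach the degree `2l`
    have hexp : ∀ y : USphere n, c y * evalAt P y ^ 2 = ∑ w : Fin (l - d) → Fin n,
        c y * evalAt (P * ∏ k, MvPolynomial.X (w k)) y ^ 2 := by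
      intro y
      rw [← Finset.mul_sum]
      congr 1
      have h1 : ∀ w : Fin (l - d) → Fin n, evalAt (P * ∏ k, MvPolynomial.X (w k)) y ^ 2 =
          evalAt P y ^ 2 * (tensorPow (l - d) (y : EuclideanSpace ℝ (Fin n)) w *
            tensorPow (l - d) y w) := fun w => by
        simp only [evalAt, map_mul, map_prod, MvPolynomial.eval_X, tensorPow]
        ring
      simp only [h1]
      rw [← Finset.mul_sum, sum_tensorPow_mul_self, mul_one]
    rw [Finset.sum_congr rfl fun y _ => hexp y, Finset.sum_comm]
    refine Finset.sum_nonneg fun w _ => hfull _ ?_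
    have h3 : (∏ k, MvPolynomial.X (R := ℝ) (w k)).IsHomogeneous (l - d) := by
      simpa using MvPolynomial.IsHomogeneous.prod Finset.univ
        (fun k => MvPolynomial.X (R := ℝ) (w k)) (fun _ => 1)
        fun k _ => MvPolynomial.isHomogeneous_X ℝ (w k)
    have := hP.mul h3
    rwa [Nat.add_sub_of_le hd] at this

lemma IsPseudoDistribution.X_pow_nonneg {l : ℕ} {c : USphere n →₀ ℝ}
    (hc : IsPseudoDistribution l c) {j : ℕ} (hj : j ≤ l) (x : USphere n) :
    0 ≤ ∑ y ∈ c.support, c y * (X ^ j : ℝ[X]).eval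
      (inner ℝ (x : EuclideanSpace ℝ (Fin n)) (y : EuclideanSpace ℝ (Fin n)) ^ 2) := by
  refine (hc.sq_nonneg (linPoly (x : EuclideanSpace ℝ (Fin n)) ^ j)
    ((isHomogeneous_linPoly _).pow j) (by omega)).trans_eq (Finset.sum_congr rfl fun y _ => ?_)
  have := evalAt_linPoly (x : EuclideanSpace ℝ (Fin n)) y
  simp only [evalAt] at this
  rw [evalAt, map_pow, this, eval_pow, eval_X]
  ring

lemma IsPseudoDistribution.gegenKernel_nonneg {l : ℕ} {c : USphere n →₀ ℝ}
    (hc : IsPseudoDistribution l c) (x : USphere n) :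
    0 ≤ ∑ y ∈ c.support, c y * (gegenKernel n l).eval
      (inner ℝ (x : EuclideanSpace ℝ (Fin n)) (y : EuclideanSpace ℝ (Fin n)) ^ 2) := by
  refine (hc.sq_nonneg (d := l) (∑ i ∈ Finset.range (l / 2 + 1), MvPolynomial.C (gegenCoeff n l i) *
    (linPoly (x : EuclideanSpace ℝ (Fin n)) ^ (l % 2 + 2 * i) * normSqPoly n ^ (l / 2 - i)))
    (MvPolynomial.IsHomogeneous.sum _ _ _ fun i hi => MvPolynomial.IsHomogeneous.C_mul ?_ _)
    le_rfl).trans_eq (Finset.sum_congr rfl fun y _ => ?_)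
  · have := ((isHomogeneous_linPoly (x : EuclideanSpace ℝ (Fin n))).pow (l % 2 + 2 * i)).mul
      ((isHomogeneous_normSqPoly (n := n)).pow (l / 2 - i))
    have hi' := Finset.mem_range.1 hi
    rwa [show 1 * (l % 2 + 2 * i) + 2 * (l / 2 - i) = l by omega] at this
  · have h1 := evalAt_linPoly (x : EuclideanSpace ℝ (Fin n)) y
    have h2 := evalAt_normSqPoly y
    simp only [evalAt] at h1 h2
    have h3 := congrArg (eval (inner ℝ (x : EuclideanSpace ℝ (Fin n))
      (y : EuclideanSpace ℝ (Fin n)))) (expand_gegenKernel n l)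
    rw [expand_eval, eval_pow, gegen_eq_sum] at h3
    rw [h3]
    simp only [evalAt, map_sum, map_mul, map_pow, h1, h2, one_pow, mul_one, MvPolynomial.eval_C,
      eval_finsetSum, eval_mul, eval_C, eval_pow, eval_X]

/-- If the kernel `∑ c_y h(⟨x, y⟩²)` is nonnegative in `x`, then its integral against `F` is at most
its mass times the maximum of `|F|`. -/
lemma abs_sum_zonalMean_mul_le [NeZero n] {c : USphere n →₀ ℝ}
    (hsum : ∑ y ∈ c.support, c y = 1) {h : ℝ[X]}
    (hh : ∀ x : USphere n, 0 ≤ ∑ y ∈ c.support, c y * h.eval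
      (inner ℝ (x : EuclideanSpace ℝ (Fin n)) (y : EuclideanSpace ℝ (Fin n)) ^ 2))
    {F : MvPolynomial (Fin n) ℝ} {a : ℕ} {p : USphere n → ℝ[X]} (hp : ∀ y, IsZonalPoly F y a (p y))
    {κ : ℝ} (hF : ∀ x : USphere n, |evalAt F x| ≤ κ) :
    |∑ y ∈ c.support, c y * zonalMean n (h * p y)| ≤ κ * zonalMean n h := by
  have hFc := continuous_evalAt F
  set H : USphere n → ℝ := fun x => ∑ y ∈ c.support, c y * h.eval
      (inner ℝ (x : EuclideanSpace ℝ (Fin n)) (y : EuclideanSpace ℝ (Fin n)) ^ 2) with hH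
  have hHc : Continuous H := by fun_prop
  have h1 : ∑ y ∈ c.support, c y * zonalMean n (h * p y) =
      ∫ x : USphere n, evalAt F x * H x ∂(sphereMeasure n) := by
    simp only [hH, Finset.mul_sum]
    rw [integral_finsetSum]
    swap
    · exact fun i _ => integrable_of_continuous (by fun_prop) _
    refine Finset.sum_congr rfl fun y _ => ?_
    rw [← (hp y).2.2 h, ← integral_const_mul]
    congr 1
    ext x
    ring
  have h2 : ∫ x : USphere n, H x ∂(sphereMeasure n) = zonalMean n h := by
    simp only [hH]
    rw [integral_finsetSum]
    swap
    · exact fun i _ => integrable_of_continuous (by fun_prop) _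
    simp only [integral_const_mul, integral_eval_inner_sq]
    rw [← Finset.sum_mul, hsum, one_mul]
  rw [h1, ← h2, ← integral_const_mul]
  refine abs_integral_le_integral_abs.trans (integral_mono
    (integrable_of_continuous (by fun_prop) _) (integrable_of_continuous (by fun_prop) _)
    fun x => ?_)
  simp only
  rw [abs_mul, abs_of_nonneg (hh x)]
  exact mul_le_mul_of_nonneg_right (hF x) (hh x)

end

/-! ### The approximating matrix -/

section

open Polynomial

variable {n : ℕ}

/-- The case `l = 0`; the value is one since the Gamma factors cancel against the areas `ω_n`,
`ω_{n-1}`. -/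
lemma normConst_zero (hn : 2 ≤ n) : normConst n 0 = 1 := by
  have h1 : ((n - 1 : ℕ) : ℝ) = (n : ℝ) - 1 := by
    rw [Nat.cast_sub (by omega)]; simp
  have hn' : (2 : ℝ) ≤ n := by exact_mod_cast hn
  have g1 : Real.Gamma (((n : ℝ) - 1) / 2) ≠ 0 := (Real.Gamma_pos_of_pos (by linarith)).ne'
  have g2 : Real.Gamma ((n : ℝ) / 2) ≠ 0 := (Real.Gamma_pos_of_pos (by linarith)).ne'
  have hp : Real.pi ^ ((n : ℝ) / 2) = Real.pi ^ (((n : ℝ) - 1) / 2) * Real.sqrt Real.pi := by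
    rw [Real.sqrt_eq_rpow, ← Real.rpow_add Real.pi_pos]
    congr 1
    ring
  have hp1 : Real.pi ^ (((n : ℝ) - 1) / 2) ≠ 0 := (Real.rpow_pos_of_pos Real.pi_pos _).ne'
  have hp2 : Real.sqrt Real.pi ≠ 0 := (Real.sqrt_pos.2 Real.pi_pos).ne'
  simp only [normConst, sphereArea, h1, hp, Nat.cast_zero, mul_zero, zero_add, pow_zero, one_mul,
    Real.Gamma_one, mul_one]
  field_simp

lemma normConst_succ (hn : 2 ≤ n) (l : ℕ) :
    (2 * (l : ℝ) + 1) * normConst n (l + 1) = (2 * (l : ℝ) + n) * normConst n l := by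
  have hn' : (2 : ℝ) ≤ n := by exact_mod_cast hn
  have hl : (0 : ℝ) ≤ l := l.cast_nonneg
  have e1 : Real.Gamma ((l : ℝ) + 1 + 1) = (l + 1) * Real.Gamma ((l : ℝ) + 1) :=
    Real.Gamma_add_one (by positivity)
  have e2 : Real.Gamma ((l : ℝ) + 1 + (n : ℝ) / 2) =
      (l + (n : ℝ) / 2) * Real.Gamma ((l : ℝ) + (n : ℝ) / 2) := by
    rw [← Real.Gamma_add_one (by positivity)]
    congr 1
    ring
  have e3 : Real.Gamma (2 * ((l : ℝ) + 1) + 1) =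
      (2 * l + 2) * ((2 * l + 1) * Real.Gamma (2 * (l : ℝ) + 1)) := by
    rw [← Real.Gamma_add_one (by positivity),
      show 2 * (l : ℝ) + 2 = 2 * l + 1 + 1 by ring, ← Real.Gamma_add_one (by positivity)]
    congr 1
    ring
  have g : Real.Gamma (2 * (l : ℝ) + 1) ≠ 0 := (Real.Gamma_pos_of_pos (by positivity)).ne'
  simp only [normConst, Nat.cast_add, Nat.cast_one, e1, e2, e3]
  rw [show 2 * (l + 1) = 2 * l + 2 by ring, pow_add]
  have h1 : (2 * (l : ℝ) + 1) ≠ 0 := by positivity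
  have h2 : (2 * (l : ℝ) + 2) ≠ 0 := by positivity
  field_simp

/-- The normalization constant is the inverse of the mean of `⟨x, y⟩^{2l}`: the recursions
in `l` of the two factors cancel. -/
lemma normConst_mul_zonalMean (hn : 2 ≤ n) (l : ℕ) : normConst n l * zonalMean n (X ^ l) = 1 := by
  have : NeZero n := ⟨by omega⟩
  induction l with
  | zero =>
    rw [normConst_zero hn, pow_zero, zonalMean_one, mul_one]
  | succ l ih =>
    have h1 := normConst_succ hn l
    have h2 := zonalMean_X_pow_succ (n := n) l
    have hn' : (2 : ℝ) ≤ n := by exact_mod_cast hn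
    have h3 : (2 * (l : ℝ) + 1) ≠ 0 := by positivity
    have h4 : (2 * (l : ℝ) + n) ≠ 0 := by positivity
    refine mul_left_cancel₀ h3 (mul_left_cancel₀ h4 ?_)
    linear_combination (2 * (l : ℝ) + n) * zonalMean n (X ^ (l + 1)) * h1 +
      (2 * (l : ℝ) + n) * normConst n l * h2 + (2 * (l : ℝ) + n) * (2 * l + 1) * ih

lemma normConst_pos (hn : 2 ≤ n) (l : ℕ) : 0 < normConst n l := by
  have : NeZero n := ⟨by omega⟩
  refine pos_of_mul_pos_left ?_ (zonalMean_X_pow_pos (n := n) l).le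
  rw [normConst_mul_zonalMean hn]
  exact one_pos

lemma continuous_tensorProj_apply {a : ℕ} (i j : Fin a → Fin n) :
    Continuous fun x : USphere n => tensorProj a (x : EuclideanSpace ℝ (Fin n)) i j := by
  simp only [tensorProj, Matrix.vecMulVec_apply, tensorPow]
  fun_prop

lemma continuous_qRep {l : ℕ} (M : TensorMatrix n l) :
    Continuous fun x : USphere n => qRep M (x : EuclideanSpace ℝ (Fin n)) := by
  simp only [qRep, dotProduct, Matrix.mulVec, tensorPow]
  fun_prop

lemma qRep_nonneg {l : ℕ} {M : TensorMatrix n l} (hM : M.PosSemidef)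
    (x : EuclideanSpace ℝ (Fin n)) : 0 ≤ qRep M x := by
  simpa [qRep] using hM.dotProduct_mulVec_nonneg (tensorPow l x)

/-- The density of `approxMatrix a M`, which is the same for all `a`. -/
noncomputable def approxDensity {l : ℕ} (M : TensorMatrix n l) (x : USphere n) : ℝ :=
  normConst n l * qRep M (x : EuclideanSpace ℝ (Fin n))

lemma continuous_approxDensity {l : ℕ} (M : TensorMatrix n l) : Continuous (approxDensity M) :=
  (continuous_qRep M).const_mul _

lemma approxDensity_nonneg (hn : 2 ≤ n) {l : ℕ} {M : TensorMatrix n l} (hM : M.PosSemidef)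
    (x : USphere n) : 0 ≤ approxDensity M x :=
  mul_nonneg (normConst_pos hn l).le (qRep_nonneg hM _)

lemma approxMatrix_apply {l : ℕ} (a : ℕ) (M : TensorMatrix n l) (i j : Fin a → Fin n) :
    approxMatrix a M i j = ∫ x : USphere n, approxDensity M x *
      tensorProj a (x : EuclideanSpace ℝ (Fin n)) i j ∂(sphereMeasure n) := by
  simp only [approxMatrix, Matrix.of_apply, approxDensity, mul_assoc, integral_const_mul]

lemma integral_approxDensity (hn : 2 ≤ n) {l : ℕ} {M : TensorMatrix n l} (hsym : IsMaxSym M)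
    (hM : IsState M) : ∫ x, approxDensity M x ∂(sphereMeasure n) = 1 := by
  have : NeZero n := ⟨by omega⟩
  obtain ⟨c, rfl⟩ := hsym.exists_signed_representation
  have hc := hM.isPseudoDistribution
  simp only [approxDensity, qRep_sum, integral_const_mul]
  rw [integral_finsetSum]
  swap
  · exact fun i _ => integrable_of_continuous (by fun_prop) _
  have h1 : ∀ y : USphere n, ∫ x : USphere n, c y * inner ℝ (x : EuclideanSpace ℝ (Fin n))
      (y : EuclideanSpace ℝ (Fin n)) ^ (2 * l) ∂(sphereMeasure n) =
      c y * zonalMean n (X ^ l) := fun y => by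
    rw [integral_const_mul, ← integral_eval_inner_sq y]
    simp only [eval_pow, eval_X, pow_mul]
  simp only [h1]
  rw [← Finset.sum_mul, hc.sum_eq_one, one_mul, normConst_mul_zonalMean hn]

lemma trace_mul_approxMatrix [NeZero n] {l a : ℕ} (M : TensorMatrix n l) (Z : TensorMatrix n a) :
    (Z * approxMatrix a M).trace = ∫ x : USphere n, approxDensity M x *
      (Z * tensorProj a (x : EuclideanSpace ℝ (Fin n))).trace ∂(sphereMeasure n) := by
  have hc := continuous_approxDensity M
  have hc2 := fun i j => continuous_tensorProj_apply (n := n) (a := a) i j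
  simp only [Matrix.trace, Matrix.diag_apply, Matrix.mul_apply, approxMatrix_apply, Finset.mul_sum]
  rw [integral_finsetSum]
  swap
  · exact fun i _ => integrable_of_continuous (by fun_prop) _
  refine Finset.sum_congr rfl fun i _ => ?_
  rw [integral_finsetSum]
  swap
  · exact fun i _ => integrable_of_continuous (by fun_prop) _
  refine Finset.sum_congr rfl fun j _ => ?_
  rw [← integral_const_mul]
  congr 1
  ext x
  ring

lemma isState_approxMatrix (hn : 2 ≤ n) {l : ℕ} (a : ℕ) {M : TensorMatrix n l} (hsym : IsMaxSym M)
    (hM : IsState M) : IsState (approxMatrix a M) := by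
  have : NeZero n := ⟨by omega⟩
  have hc := continuous_approxDensity M
  have hc2 := fun i j => continuous_tensorProj_apply (n := n) (a := a) i j
  refine ⟨Matrix.PosSemidef.of_dotProduct_mulVec_nonneg ?_ fun z => ?_, ?_⟩
  · ext i j
    simp only [Matrix.conjTranspose_apply, star_trivial, approxMatrix_apply, tensorProj,
      Matrix.vecMulVec_apply]
    simp only [mul_comm (tensorPow a _ j)]
  · have h : star z ⬝ᵥ (approxMatrix a M).mulVec z =
        (Matrix.vecMulVec z z * approxMatrix a M).trace := by
      simp only [star_trivial, dotProduct, Matrix.mulVec, Matrix.trace, Matrix.diag_apply,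
        Matrix.mul_apply, Matrix.vecMulVec_apply, Finset.mul_sum]
      rw [Finset.sum_comm]
      exact Finset.sum_congr rfl fun i _ => Finset.sum_congr rfl fun j _ => by ring
    rw [h, trace_mul_approxMatrix]
    refine integral_nonneg fun x => mul_nonneg (approxDensity_nonneg hn hM.1 x) ?_
    rw [tensorProj, Matrix.vecMulVec_mul_vecMulVec, Matrix.trace_vecMulVec, dotProduct_smul,
      smul_eq_mul]
    exact mul_self_nonneg _
  · rw [← one_mul (approxMatrix a M), trace_mul_approxMatrix]
    refine Eq.trans ?_ (integral_approxDensity hn hsym hM)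
    refine integral_congr_ae (Filter.Eventually.of_forall fun x => ?_)
    simp only [Matrix.trace, Matrix.diag_apply, tensorProj, one_mul, Matrix.vecMulVec_apply,
      sum_tensorPow_mul_self, mul_one]

lemma hasPositivePRep_approxMatrix (hn : 2 ≤ n) {l : ℕ} (a : ℕ) {M : TensorMatrix n l}
    (hM : IsState M) : HasPositivePRep (approxMatrix a M) := by
  have : NeZero n := ⟨by omega⟩
  exact ⟨approxDensity M, (continuous_approxDensity M).memLp_of_hasCompactSupport
    (HasCompactSupport.of_compactSpace _), approxDensity_nonneg hn hM.1, approxMatrix_apply a M⟩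

lemma isMaxSym_tensorProj (a : ℕ) (x : EuclideanSpace ℝ (Fin n)) : IsMaxSym (tensorProj a x) := by
  intro π w
  have h : ∀ v : Fin a ⊕ Fin a → Fin n, vectorize (tensorProj a x) v = ∏ k, x (v k) := fun v => by
    rw [Fintype.prod_sum_type]
    rfl
  rw [h, h]
  exact Equiv.prod_comp π fun k => x (w k)

lemma isMomentMatrix_approxMatrix (hn : 2 ≤ n) {l : ℕ} (a : ℕ) {M : TensorMatrix n l}
    (hsym : IsMaxSym M) (hM : IsState M) : IsMomentMatrix (approxMatrix a M) := by
  have : NeZero n := ⟨by omega⟩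
  have hc := continuous_approxDensity M
  refine ⟨fun π w => ?_, (sphereMeasure n).withDensity fun x => ENNReal.ofReal (approxDensity M x),
    ⟨?_⟩, fun i j => ?_⟩
  · simp only [vectorize, approxMatrix_apply]
    refine integral_congr_ae (Filter.Eventually.of_forall fun x => ?_)
    exact congrArg (approxDensity M x * ·) (isMaxSym_tensorProj a _ π w)
  · rw [withDensity_apply _ MeasurableSet.univ, Measure.restrict_univ,
      ← ofReal_integral_eq_lintegral_ofReal (integrable_of_continuous hc _)
        (Filter.Eventually.of_forall fun x => approxDensity_nonneg hn hM.1 x),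
      integral_approxDensity hn hsym hM, ENNReal.ofReal_one]
  · rw [approxMatrix_apply, integral_withDensity_eq_integral_toReal_smul
      (by fun_prop) (Filter.Eventually.of_forall fun x => ENNReal.ofReal_lt_top)]
    refine integral_congr_ae (Filter.Eventually.of_forall fun x => ?_)
    simp only [ENNReal.toReal_ofReal (approxDensity_nonneg hn hM.1 x), smul_eq_mul]

end

/-! ### Pseudo-means of forms and their comparison with weighted means -/

section

open Polynomial

variable {n : ℕ}

/-- The mean of `h(⟨x, y⟩²)` over the sphere, with the density proportional to `w(⟨x, y⟩²)`. It is
meaningful if `zonalMean n w` is positive. -/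
noncomputable def weightedMean (n : ℕ) (w : ℝ[X]) : ℝ[X] →ₗ[ℝ] ℝ :=
  (zonalMean n w)⁻¹ • (zonalMean n).comp (LinearMap.mulLeft ℝ w)

lemma weightedMean_apply (w h : ℝ[X]) :
    weightedMean n w h = (zonalMean n w)⁻¹ * zonalMean n (w * h) := by
  simp [weightedMean]

lemma weightedMean_one {w : ℝ[X]} (hw : 0 < zonalMean n w) : weightedMean n w 1 = 1 := by
  rw [weightedMean_apply, mul_one, inv_mul_cancel₀ hw.ne']

lemma weightedMean_mono [NeZero n] {w : ℝ[X]} (hw : 0 < zonalMean n w)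
    (hw' : ∀ s ∈ Set.Icc (0 : ℝ) 1, 0 ≤ w.eval s) {f g : ℝ[X]}
    (h : ∀ s ∈ Set.Icc (0 : ℝ) 1, f.eval s ≤ g.eval s) :
    weightedMean n w f ≤ weightedMean n w g := by
  rw [weightedMean_apply, weightedMean_apply]
  refine mul_le_mul_of_nonneg_left (zonalMean_mono fun s hs => ?_) (inv_pos.2 hw).le
  rw [eval_mul, eval_mul]
  exact mul_le_mul_of_nonneg_left (h s hs) (hw' s hs)

/-- The value `p(1)` minus the mean of `p` with weight `w`. For a zonal polynomial `p` of `F`, this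
is the change of `F` under averaging against the kernel `w`. -/
noncomputable def deviation (n : ℕ) (w : ℝ[X]) : ℝ[X] →ₗ[ℝ] ℝ :=
  leval 1 - weightedMean n w

lemma deviation_apply (w p : ℝ[X]) :
    deviation n w p = p.eval 1 - weightedMean n w p := rfl

lemma weightedMean_C {w : ℝ[X]} (hw : 0 < zonalMean n w) (r : ℝ) :
    weightedMean n w (C r) = r := by
  rw [← mul_one (C r), C_mul', map_smul, weightedMean_one hw, smul_eq_mul, mul_one]

lemma abs_deviation_le [NeZero n] {w : ℝ[X]} (hw : 0 < zonalMean n w)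
    (hw' : ∀ s ∈ Set.Icc (0 : ℝ) 1, 0 ≤ w.eval s) {p : ℝ[X]} {α β : ℝ}
    (h : ∀ s ∈ Set.Icc (0 : ℝ) 1, |p.eval 1 - p.eval s| ≤ α + β * (1 - s)) :
    |deviation n w p| ≤ α + β * weightedMean n w (1 - X) := by
  have e : α + β * weightedMean n w (1 - X) = weightedMean n w (C α + C β * (1 - X)) := by
    rw [map_add, weightedMean_C hw, C_mul', map_smul, smul_eq_mul]
  have e2 : deviation n w p = weightedMean n w (C (p.eval 1) - p) := by
    rw [deviation_apply, map_sub, weightedMean_C hw]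
  rw [e, e2, abs_le, ← map_neg]
  constructor <;> refine weightedMean_mono hw hw' fun s hs => ?_ <;>
  · have := abs_le.1 (h s hs)
    simp only [eval_add, eval_mul, eval_C, eval_sub, eval_one, eval_X, eval_neg]
    linarith

lemma X_pow_eval_nonneg (k : ℕ) : ∀ s ∈ Set.Icc (0 : ℝ) 1, 0 ≤ (X ^ k : ℝ[X]).eval s :=
  fun s hs => by
    rw [eval_pow, eval_X]
    exact pow_nonneg hs.1 k

lemma weightedMean_X_pow_one_sub [NeZero n] (k : ℕ) :
    weightedMean n (X ^ k) (1 - X) = ((n : ℝ) - 1) / (2 * k + n) := by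
  have h1 := zonalMean_X_pow_succ (n := n) k
  have h0 := zonalMean_X_pow_pos (n := n) k
  have hn : 0 < (n : ℝ) := Nat.cast_pos.2 (NeZero.pos n)
  have h2 : (2 * (k : ℝ) + n) ≠ 0 := by positivity
  rw [weightedMean_apply, mul_sub, mul_one, ← pow_succ, map_sub]
  field_simp
  linear_combination -h1

lemma weightedMean_X_pow_one_sub_sq [NeZero n] (k : ℕ) :
    weightedMean n (X ^ k) ((1 - X) ^ 2) =
      ((n : ℝ) ^ 2 - 1) / ((2 * k + n) * (2 * k + n + 2)) := by
  have h1 := zonalMean_X_pow_succ (n := n) k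
  have h3 := zonalMean_X_pow_succ (n := n) (k + 1)
  have h0 := zonalMean_X_pow_pos (n := n) k
  have hn : 0 < (n : ℝ) := Nat.cast_pos.2 (NeZero.pos n)
  have h2 : (2 * (k : ℝ) + n) ≠ 0 := by positivity
  have h2 : (2 * (k : ℝ) + n + 2) ≠ 0 := by positivity
  have e : (X ^ k * (1 - X) ^ 2 : ℝ[X]) = X ^ k - (2 : ℝ) • X ^ (k + 1) + X ^ (k + 1 + 1) := by
    rw [smul_eq_C_mul]
    simp only [map_ofNat]
    ring
  rw [weightedMean_apply, e, map_add, map_sub, map_smul, smul_eq_mul]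
  push_cast at h3
  field_simp
  linear_combination (-2 * (2 * (k : ℝ) + n + 2) + (2 * k + 3)) * h1 + (2 * (k : ℝ) + n) * h3

/-- The form `F` is bounded by one on the sphere. -/
def UnitBounded (F : MvPolynomial (Fin n) ℝ) : Prop := ∀ x : USphere n, |evalAt F x| ≤ 1

lemma unitBounded_of_sphereSupNorm_le {F : MvPolynomial (Fin n) ℝ} (h : sphereSupNorm F ≤ 1) :
    UnitBounded F := by
  intro x
  refine le_trans ?_ h
  have hc : Continuous fun x : USphere n => |evalAt F x| := by
    have := continuous_evalAt F
    fun_prop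
  exact le_ciSup (isCompact_range hc).bddAbove x

/-- The linear functional on forms given by the weights `c`. -/
noncomputable def pseudoMean (c : USphere n →₀ ℝ) (F : MvPolynomial (Fin n) ℝ) : ℝ :=
  ∑ y ∈ c.support, c y * evalAt F y

lemma reducedMatrix_sum {a l : ℕ} (h : a ≤ l) (s : Finset (USphere n)) (c : USphere n → ℝ)
    (T : USphere n → TensorMatrix n l) :
    reducedMatrix a h (∑ y ∈ s, c y • T y) = ∑ y ∈ s, c y • reducedMatrix a h (T y) := by
  ext i j
  simp only [reducedMatrix, Matrix.of_apply, Matrix.sum_apply, Matrix.smul_apply, smul_eq_mul,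
    Finset.mul_sum]
  exact Finset.sum_comm

/-- The pairing of `Z_F` with the difference of the two matrices, in terms of zonal polynomials. -/
lemma trace_polyMatrix_mul_sub (hn : 2 ≤ n) {a l : ℕ} (h : a ≤ l) (c : USphere n →₀ ℝ)
    {F : MvPolynomial (Fin n) ℝ} (hF : F.IsHomogeneous (2 * a)) {p : USphere n → ℝ[X]}
    (hp : ∀ y, IsZonalPoly F y a (p y)) :
    (polyMatrix a F * (reducedMatrix a h
        (∑ y ∈ c.support, c y • tensorProj l (y : EuclideanSpace ℝ (Fin n))) -
      approxMatrix a (∑ y ∈ c.support, c y • tensorProj l (y : EuclideanSpace ℝ (Fin n))))).trace =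
      ∑ y ∈ c.support, c y * deviation n (X ^ l) (p y) := by
  have : NeZero n := ⟨by omega⟩
  have hFc := continuous_evalAt F
  have hN : normConst n l = (zonalMean n (X ^ l))⁻¹ :=
    eq_inv_of_mul_eq_one_left (normConst_mul_zonalMean hn l)
  rw [Matrix.mul_sub, Matrix.trace_sub, trace_mul_approxMatrix, reducedMatrix_sum, Matrix.mul_sum,
    Matrix.trace_sum]
  simp only [trace_polyMatrix_mul_tensorProj hF, reducedMatrix_tensorProj, Matrix.mul_smul,
    Matrix.trace_smul, smul_eq_mul, approxDensity, qRep_sum, Finset.mul_sum, Finset.sum_mul]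
  rw [integral_finsetSum, ← Finset.sum_sub_distrib]
  swap
  · exact fun i _ => integrable_of_continuous (by fun_prop) _
  refine Finset.sum_congr rfl fun y _ => ?_
  rw [deviation_apply, weightedMean_apply, mul_sub, ← (hp y).2.2, (hp y).2.1, ← hN,
    ← mul_assoc, mul_comm (c y) (normConst n l), mul_assoc (normConst n l), ← integral_const_mul,
    ← integral_const_mul]
  congr 2
  ext x
  rw [eval_pow, eval_X, ← pow_mul]
  ring

lemma pseudoMean_eq {c : USphere n →₀ ℝ} {F : MvPolynomial (Fin n) ℝ} {a : ℕ} {p : USphere n → ℝ[X]}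
    (hp : ∀ y, IsZonalPoly F y a (p y)) (w : ℝ[X]) :
    pseudoMean c F = ∑ y ∈ c.support, c y * weightedMean n w (p y) +
      ∑ y ∈ c.support, c y * deviation n w (p y) := by
  rw [pseudoMean, ← Finset.sum_add_distrib]
  refine Finset.sum_congr rfl fun y _ => ?_
  rw [deviation_apply, (hp y).2.1]
  ring

/-- Averaging a form against a positive kernel keeps its pseudo-mean below the supremum norm. -/
lemma abs_sum_weightedMean_le [NeZero n] {c : USphere n →₀ ℝ}
    (hsum : ∑ y ∈ c.support, c y = 1) {h : ℝ[X]} (hpos : 0 < zonalMean n h)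
    (hh : ∀ x : USphere n, 0 ≤ ∑ y ∈ c.support, c y * h.eval
      (inner ℝ (x : EuclideanSpace ℝ (Fin n)) (y : EuclideanSpace ℝ (Fin n)) ^ 2))
    {F : MvPolynomial (Fin n) ℝ} {a : ℕ} {p : USphere n → ℝ[X]} (hp : ∀ y, IsZonalPoly F y a (p y))
    (hF : UnitBounded F) :
    |∑ y ∈ c.support, c y * weightedMean n h (p y)| ≤ 1 := by
  have h1 : ∑ y ∈ c.support, c y * weightedMean n h (p y) =
      (zonalMean n h)⁻¹ * ∑ y ∈ c.support, c y * zonalMean n (h * p y) := by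
    rw [Finset.mul_sum]
    exact Finset.sum_congr rfl fun y _ => by rw [weightedMean_apply]; ring
  rw [h1, abs_mul, abs_of_pos (inv_pos.2 hpos), inv_mul_le_iff₀ hpos, mul_one]
  exact (abs_sum_zonalMean_mul_le hsum hh hp hF).trans_eq (one_mul _)

/-- The number `N` bounds the pseudo-mean on the unit ball of the forms of degree `2a`. -/
def PseudoMeanBound (c : USphere n →₀ ℝ) (a : ℕ) (N : ℝ) : Prop :=
  ∀ F : MvPolynomial (Fin n) ℝ, F.IsHomogeneous (2 * a) → UnitBounded F → |pseudoMean c F| ≤ N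

/-- If `Λ` is bounded by `κ` on the unit ball of the polynomials of degree at most `a`, then the
pseudo-mean of the form that realizes `Λ` is at most `κ N`. -/
lemma PseudoMeanBound.abs_sum_le (hn : 2 ≤ n) {c : USphere n →₀ ℝ} {a : ℕ} {N : ℝ}
    (hN : PseudoMeanBound c a N) {κ : ℝ} (Λ : ℝ[X] →ₗ[ℝ] ℝ)
    (hΛ : ∀ p : ℝ[X], p.natDegree ≤ a → (∀ s ∈ Set.Icc (0 : ℝ) 1, |p.eval s| ≤ 1) → |Λ p| ≤ κ)
    {F : MvPolynomial (Fin n) ℝ} {p : USphere n → ℝ[X]} (hp : ∀ y, IsZonalPoly F y a (p y))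
    (hF : UnitBounded F) : |∑ y ∈ c.support, c y * Λ (p y)| ≤ κ * N := by
  obtain ⟨G, hG, hGΛ⟩ := exists_form_of_functional hn (F := F) a Λ
  have hb : ∀ y : USphere n, |evalAt G y| ≤ κ := fun y => by
    rw [hGΛ y _ (hp y)]
    exact hΛ _ (hp y).1 fun s hs => (hp y).abs_le hn hF hs
  have e : ∑ y ∈ c.support, c y * Λ (p y) = pseudoMean c G :=
    (Finset.sum_congr rfl fun y _ => by rw [hGΛ y _ (hp y)])
  rw [e]
  have : NeZero n := ⟨by omega⟩
  have hκ0 : 0 ≤ κ := (abs_nonneg _).trans (hb (Classical.arbitrary _))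
  rcases hκ0.eq_or_lt with rfl | hκ
  · have : ∀ y : USphere n, evalAt G y = 0 := fun y => abs_nonpos_iff.1 (hb y)
    simp [pseudoMean, this]
  · have hs : ∀ y : EuclideanSpace ℝ (Fin n),
        evalAt (MvPolynomial.C κ⁻¹ * G) y = κ⁻¹ * evalAt G y := fun y => by simp [evalAt]
    have h1 := hN (MvPolynomial.C κ⁻¹ * G) (MvPolynomial.IsHomogeneous.C_mul hG _) fun y => by
      rw [hs, abs_mul, abs_of_pos (inv_pos.2 hκ), inv_mul_le_iff₀ hκ, mul_one]
      exact hb y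
    have h2 : pseudoMean c (MvPolynomial.C κ⁻¹ * G) = κ⁻¹ * pseudoMean c G := by
      simp only [pseudoMean, hs, Finset.mul_sum]
      exact Finset.sum_congr rfl fun y _ => by ring
    rwa [h2, abs_mul, abs_of_pos (inv_pos.2 hκ), inv_mul_le_iff₀ hκ] at h1

/-- The pseudo-mean is bounded as soon as a positive kernel reproduces forms up to `κ < 1`:
splitting `F` into its average and the deviation shows that the optimal bound `N` satisfies
`N ≤ 1 + κ N`. -/
lemma pseudoMeanBound_of_kernel (hn : 2 ≤ n) {c : USphere n →₀ ℝ} {a : ℕ} {κ : ℝ} (hκ : κ < 1)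
    (hsum : ∑ y ∈ c.support, c y = 1) {h : ℝ[X]} (hpos : 0 < zonalMean n h)
    (hh : ∀ x : USphere n, 0 ≤ ∑ y ∈ c.support, c y * h.eval
      (inner ℝ (x : EuclideanSpace ℝ (Fin n)) (y : EuclideanSpace ℝ (Fin n)) ^ 2))
    (hΛ : ∀ p : ℝ[X], p.natDegree ≤ a → (∀ s ∈ Set.Icc (0 : ℝ) 1, |p.eval s| ≤ 1) →
      |deviation n h p| ≤ κ) : PseudoMeanBound c a (1 - κ)⁻¹ := by
  have : NeZero n := ⟨by omega⟩
  set S : Set ℝ := {r | ∃ F : MvPolynomial (Fin n) ℝ, F.IsHomogeneous (2 * a) ∧ UnitBounded F ∧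
    r = |pseudoMean c F|}
  have hbdd : BddAbove S := by
    refine ⟨∑ y ∈ c.support, |c y|, ?_⟩
    rintro _ ⟨F, -, hF, rfl⟩
    refine (Finset.abs_sum_le_sum_abs _ _).trans (Finset.sum_le_sum fun y _ => ?_)
    rw [abs_mul]
    exact mul_le_of_le_one_right (abs_nonneg _) (hF y)
  have hS : PseudoMeanBound c a (sSup S) := fun F hF hF1 => le_csSup hbdd ⟨F, hF, hF1, rfl⟩
  have hne : S.Nonempty := ⟨_, 0, MvPolynomial.isHomogeneous_zero _ _ _, fun x => by
    simp [evalAt], rfl⟩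
  have hle : sSup S ≤ 1 + κ * sSup S := by
    refine csSup_le hne ?_
    rintro _ ⟨F, hF, hF1, rfl⟩
    choose p hp using fun y => exists_isZonalPoly hn hF y
    rw [pseudoMean_eq hp h]
    exact (abs_add_le _ _).trans (add_le_add (abs_sum_weightedMean_le hsum hpos hh hp hF1)
      (hS.abs_sum_le hn _ hΛ hp hF1))
  have hle' : sSup S ≤ (1 - κ)⁻¹ := by
    rw [← one_div, le_div_iff₀ (by linarith)]
    linarith
  exact fun F hF hF1 => (hS F hF hF1).trans hle'

open scoped Matrix MatrixOrder Matrix.Norms.L2Operator in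
/-- A quadratic form that is nonnegative on the sphere has a nonnegative pseudo-mean, since it is a
sum of squares of linear forms. -/
lemma IsPseudoDistribution.pseudoMean_nonneg {l : ℕ} (hl : 1 ≤ l) {c : USphere n →₀ ℝ}
    (hc : IsPseudoDistribution l c) {G : MvPolynomial (Fin n) ℝ} (hG : G.IsHomogeneous (2 * 1))
    (h0 : ∀ y : USphere n, 0 ≤ evalAt G y) : 0 ≤ pseudoMean c G := by
  have hall : ∀ x : EuclideanSpace ℝ (Fin n), 0 ≤ evalAt G x := by
    intro x
    have hscale : ∀ (r : ℝ) (x : EuclideanSpace ℝ (Fin n)),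
        evalAt G (r • x) = r ^ 2 * evalAt G x := by
      intro r x
      rw [← trace_polyMatrix_mul_tensorProj hG, ← trace_polyMatrix_mul_tensorProj hG]
      have h : tensorProj 1 (r • x) = r ^ 2 • tensorProj 1 x := by
        ext i j
        simp only [tensorProj, Matrix.vecMulVec_apply, Matrix.smul_apply, tensorPow,
          Finset.univ_unique, Finset.prod_singleton, PiLp.smul_apply, smul_eq_mul]
        ring
      rw [h, Matrix.mul_smul, Matrix.trace_smul, smul_eq_mul]
    rcases eq_or_ne x 0 with rfl | hx
    · have := hscale 0 0
      simp at this
      rw [this]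
    · have hx' : ‖x‖ ≠ 0 := norm_ne_zero_iff.2 hx
      have h1 : x = ‖x‖ • (‖x‖⁻¹ • x) := by rw [smul_smul, mul_inv_cancel₀ hx', one_smul]
      rw [h1, hscale]
      refine mul_nonneg (pow_nonneg (norm_nonneg _) 2) (h0 ⟨‖x‖⁻¹ • x, ?_⟩)
      simp [norm_smul, hx']
  have hpsd : (polyMatrix 1 G).PosSemidef := by
    refine Matrix.PosSemidef.of_dotProduct_mulVec_nonneg ?_ fun z => ?_
    · ext i j
      simp [polyMatrix, add_comm]
    · set x : EuclideanSpace ℝ (Fin n) := WithLp.toLp 2 fun j => z fun _ => j with hx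
      have hz : z = tensorPow 1 x := by
        ext i
        simp only [tensorPow, hx, Finset.univ_unique, Finset.prod_singleton]
        congr 1
        ext k
        rw [Subsingleton.elim k]
      refine (hall x).trans_eq ?_
      rw [← trace_polyMatrix_mul_tensorProj hG x, tensorProj, ← hz, Matrix.mul_vecMulVec,
        Matrix.trace_vecMulVec, star_trivial, dotProduct_comm]
  obtain ⟨B, hB⟩ := CStarAlgebra.nonneg_iff_eq_star_mul_self.1 hpsd.nonneg
  have hsq : ∀ y : EuclideanSpace ℝ (Fin n), evalAt G y = ∑ i, evalAt
      (∑ u : Fin 1 → Fin n, MvPolynomial.C (B i u) * MvPolynomial.X (u 0)) y ^ 2 := by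
    intro y
    have h1 : ∀ i, evalAt (∑ u : Fin 1 → Fin n, MvPolynomial.C (B i u) * MvPolynomial.X (u 0)) y =
        (B *ᵥ tensorPow 1 y) i := fun i => by
      simp [evalAt, Matrix.mulVec, dotProduct, tensorPow]
    simp only [h1]
    rw [← trace_polyMatrix_mul_tensorProj hG, hB, tensorProj, Matrix.mul_vecMulVec,
      Matrix.trace_vecMulVec, ← Matrix.mulVec_mulVec, dotProduct_comm, Matrix.star_eq_conjTranspose,
      Matrix.conjTranspose_eq_transpose_of_trivial, Matrix.dotProduct_mulVec,
      Matrix.vecMul_transpose, dotProduct]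
    exact Finset.sum_congr rfl fun i _ => (sq _).symm
  rw [pseudoMean]
  simp only [hsq, Finset.mul_sum]
  rw [Finset.sum_comm]
  refine Finset.sum_nonneg fun i _ => hc.sq_nonneg (d := 1) _ ?_ hl
  exact MvPolynomial.IsHomogeneous.sum _ _ _ fun u _ => MvPolynomial.isHomogeneous_C_mul_X _ _

lemma IsPseudoDistribution.pseudoMeanBound_one {l : ℕ} (hl : 1 ≤ l) {c : USphere n →₀ ℝ}
    (hc : IsPseudoDistribution l c) : PseudoMeanBound c 1 1 := by
  intro F hF hF1
  have key : ∀ r : ℝ, (r = 1 ∨ r = -1) → r * pseudoMean c F ≤ 1 := by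
    intro r hr
    have he : ∀ y : USphere n, evalAt (normSqPoly n - MvPolynomial.C r * F) y =
        1 - r * evalAt F y := fun y => by
      have h := evalAt_normSqPoly y
      simp only [evalAt] at h ⊢
      rw [map_sub, map_mul, h, MvPolynomial.eval_C]
    have h := hc.pseudoMean_nonneg hl (G := normSqPoly n - MvPolynomial.C r * F)
      (isHomogeneous_normSqPoly.sub (MvPolynomial.IsHomogeneous.C_mul hF r)) fun y => by
        rw [he]
        have := abs_le.1 (hF1 y)
        rcases hr with rfl | rfl <;> linarith
    simp only [pseudoMean, he] at h ⊢
    have h2 : ∑ y ∈ c.support, c y * (1 - r * evalAt F y) =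
        ∑ y ∈ c.support, c y - r * ∑ y ∈ c.support, c y * evalAt F y := by
      rw [Finset.mul_sum, ← Finset.sum_sub_distrib]
      exact Finset.sum_congr rfl fun y _ => by ring
    rw [h2, hc.sum_eq_one] at h
    linarith
  exact abs_le.2 ⟨by linarith [key (-1) (Or.inr rfl)], by linarith [key 1 (Or.inl rfl)]⟩

end

/-! ### Numerical inequalities -/

section

open Polynomial

/-- The inequality behind the case `a ≥ 3`, with `D` for `2l + n` and `U` for the mean of `1 - s`
under the Gegenbauer kernel. -/
lemma large_degree_bound {a n D U : ℝ} (ha : 3 ≤ a) (hn : 3 ≤ n)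
    (hD : 2 * a ^ 2 * (2 * a + n - 2) ≤ D) (hU0 : 0 ≤ U) (hU : U * D ^ 2 ≤ 2 * (n - 1) * (n + 3)) :
    2 * a ^ 2 * U < 1 ∧
    (2 * (a ^ 2 * ((n - 1) / D)) - (a ^ 2 * ((n - 1) / D)) ^ 2 / 2) * (1 - 2 * a ^ 2 * U)⁻¹ ≤
      2 * a ^ 2 * (2 * a + n - 2) / D := by
  have ha2 : 9 ≤ a ^ 2 := by nlinarith
  have hD0 : 0 < D := by nlinarith
  obtain ⟨η, hη⟩ : ∃ η, η = (n - 1) / D := ⟨_, rfl⟩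
  have hηD : η * D = n - 1 := by rw [hη]; field_simp
  have hη0 : 0 < η := by rw [hη]; exact div_pos (by linarith) hD0
  have hUη : U * D ≤ 2 * η * (n + 3) := by
    refine le_of_mul_le_mul_right ?_ hD0
    calc U * D * D = U * D ^ 2 := by ring
      _ ≤ 2 * (η * D) * (n + 3) := by rw [hηD]; exact hU
      _ = _ := by ring
  have hT : (2 * a + n - 2) * (2 * a ^ 2 * U) ≤ 2 * η * (n + 3) := by
    refine le_trans ?_ hUη
    calc (2 * a + n - 2) * (2 * a ^ 2 * U) = (2 * a ^ 2 * (2 * a + n - 2)) * U := by ring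
      _ ≤ D * U := mul_le_mul_of_nonneg_right hD hU0
      _ = _ := by ring
  rw [← hη]
  obtain ⟨Y, hY⟩ : ∃ Y, Y = a ^ 2 * η := ⟨_, rfl⟩
  have hY0 : 0 < Y := by rw [hY]; positivity
  -- `Y ≤ 1/2`, from the lower bound on `D`
  have hY2 : Y ≤ 1 / 2 := by
    have h1 : 2 * (2 * a + n - 2) * Y ≤ n - 1 := by
      rw [← hηD, hY]
      calc 2 * (2 * a + n - 2) * (a ^ 2 * η) = η * (2 * a ^ 2 * (2 * a + n - 2)) := by ring
        _ ≤ η * D := mul_le_mul_of_nonneg_left hD hη0.le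
    nlinarith
  have hηY : 9 * η ≤ Y := by rw [hY]; nlinarith
  have hT2 : (2 * a + n - 2) * (2 * a ^ 2 * U) ≤ 2 * (Y / 9) * (n + 3) := by
    refine hT.trans ?_
    have : η ≤ Y / 9 := by linarith
    nlinarith
  obtain ⟨κ, hκ⟩ : ∃ κ, κ = 2 * a ^ 2 * U := ⟨_, rfl⟩
  rw [← hκ] at hT2 ⊢
  have hκ1 : κ < 1 := by
    have h1 : 2 * (Y / 9) * (n + 3) ≤ (n + 3) / 9 := by nlinarith
    by_contra hge
    have : (2 * a + n - 2) * 1 ≤ (2 * a + n - 2) * κ :=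
      mul_le_mul_of_nonneg_left (by linarith) (by linarith)
    linarith
  refine ⟨hκ1, ?_⟩
  rw [← hY, ← div_eq_mul_inv, div_le_div_iff₀ (by linarith) hD0]
  -- after division by `2a²`
  have key : (n - 1) * (1 - Y / 4) ≤ (2 * a + n - 2) * (1 - κ) := by nlinarith
  calc (2 * Y - Y ^ 2 / 2) * D = 2 * a ^ 2 * ((η * D) * (1 - Y / 4)) := by rw [hY]; ring
    _ ≤ 2 * a ^ 2 * ((2 * a + n - 2) * (1 - κ)) := by
      rw [hηD]
      exact mul_le_mul_of_nonneg_left key (by positivity)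
    _ = _ := by ring

/-- Interpolation between three averages of a quadratic polynomial `A + B v + C v²`. The averages
have first moments `U`, `vj`, `v0` and second moments `U2`, `vj rj`, `v0 r0`, and `B η + C η r` is
the combination of them with coefficients of sum zero that Cramer's rule gives. Only one of the
three coefficients is positive, so their absolute values sum to twice that one. In `hmain` the
unknown `U2` is replaced by its worst value, zero. -/
lemma three_kernel_bound {A B C v0 vj η U U2 r0 rj r b : ℝ} (hη : 0 < η) (hvj : 0 < vj)
    (hvj0 : vj ≤ v0) (hr : r ≤ rj) (hrj : rj < r0) (hU2 : 0 ≤ U2) (hUU : U2 ≤ U) (hb : 0 ≤ b)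
    (h3 : U * (1 - r) ≤ vj * (rj - r))
    (hmain : 2 * η * (v0 * r0 - r * (v0 - U)) ≤ b * ((vj - U) * (v0 * r0) - vj * rj * (v0 - U)))
    (a1 : |A + B * U + C * U2| ≤ 1) (a2 : |A + B * vj + C * (vj * rj)| ≤ 1)
    (a3 : |A + B * v0 + C * (v0 * r0)| ≤ 1) : |B * η + C * (η * r)| ≤ b := by
  set Δ := (vj - U) * (v0 * r0 - U2) - (vj * rj - U2) * (v0 - U) with hΔ
  set W2 := η * (v0 * r0 - U2) - η * r * (v0 - U) with hW2
  set W3 := (vj - U) * (η * r) - (vj * rj - U2) * η with hW3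
  have hW30 : W3 ≤ 0 := by
    have : W3 = -(η * (vj * (rj - r) - U2 + r * U)) := by rw [hW3]; ring
    rw [this]
    have : 0 ≤ vj * (rj - r) - U2 + r * U := by nlinarith
    have := mul_nonneg hη.le this
    linarith
  have hW10 : 0 < W2 + W3 := by
    have : W2 + W3 = η * (v0 * (r0 - r) - vj * (rj - r)) := by rw [hW2, hW3]; ring
    rw [this]
    refine mul_pos hη ?_
    nlinarith
  have hW2Δ : 2 * W2 ≤ b * Δ := by
    have e1 : 2 * W2 = 2 * η * (v0 * r0 - r * (v0 - U)) - 2 * η * U2 := by rw [hW2]; ring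
    have e2 : b * Δ = b * ((vj - U) * (v0 * r0) - vj * rj * (v0 - U)) + b * ((v0 - vj) * U2) := by
      rw [hΔ]; ring
    rw [e1, e2]
    have : 0 ≤ b * ((v0 - vj) * U2) := mul_nonneg hb (mul_nonneg (by linarith) hU2)
    have : 0 ≤ η * U2 := by positivity
    linarith
  have hΔ0 : 0 < Δ := by
    by_contra h
    have : b * Δ ≤ 0 := mul_nonpos_of_nonneg_of_nonpos hb (not_lt.1 h)
    linarith
  have hid : Δ * (B * η + C * (η * r)) = -(W2 + W3) * (A + B * U + C * U2) +
      W2 * (A + B * vj + C * (vj * rj)) + W3 * (A + B * v0 + C * (v0 * r0)) := by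
    rw [hΔ, hW2, hW3]; ring
  have hfin : |Δ * (B * η + C * (η * r))| ≤ Δ * b := by
    rw [hid]
    have t1 := mul_le_mul_of_nonneg_left a1 hW10.le
    have t2 := mul_le_mul_of_nonneg_left a2 (show 0 ≤ W2 by linarith)
    have t3 := mul_le_mul_of_nonneg_left a3 (show 0 ≤ -W3 by linarith)
    refine (abs_add_le _ _).trans ((add_le_add_left (abs_add_le _ _) _).trans ?_)
    rw [abs_mul, abs_mul, abs_mul, abs_neg, abs_of_pos hW10,
      abs_of_nonneg (show 0 ≤ W2 by linarith), abs_of_nonpos hW30]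
    linarith
  rw [abs_mul, abs_of_pos hΔ0] at hfin
  exact le_of_mul_le_mul_left hfin hΔ0

lemma quadratic_le_add_inv {n x : ℝ} (hn : 3 ≤ n) (hx0 : 0 < x) (ht : (4 * n + 9) * x ≤ 1) :
    2 * (n + 2) * (n + 3) * x ^ 2 ≤ 1 / (3 * n) + (n + 2) * x / 2 := by
  obtain ⟨t, htx⟩ : ∃ t, t = (4 * n + 9) * x := ⟨_, rfl⟩
  have hxt : x = t / (4 * n + 9) := by rw [htx]; field_simp
  rw [← htx] at ht
  have ht0 : 0 < t := by rw [htx]; positivity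
  have htt : t ^ 2 ≤ t := by nlinarith
  have h6 : 3 * (n + 2) / (2 * (4 * n + 9) ^ 2) ≤ 1 / (3 * n) := by
    rw [div_le_div_iff₀ (by positivity) (by positivity)]
    nlinarith
  refine le_trans ?_ (add_le_add_left h6 _)
  rw [hxt, div_pow, ← sub_nonneg]
  have : 3 * (n + 2) / (2 * (4 * n + 9) ^ 2) + (n + 2) * (t / (4 * n + 9)) / 2 -
      2 * (n + 2) * (n + 3) * (t ^ 2 / (4 * n + 9) ^ 2) =
      (n + 2) / (2 * (4 * n + 9) ^ 2) *
        (3 * (1 - t ^ 2) + (4 * n + 9) * (t - t ^ 2)) := by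
    field_simp
    ring
  rw [this]
  have := mul_nonneg (show 0 ≤ 4 * n + 9 by linarith) (sub_nonneg.2 htt)
  have : 0 ≤ 3 * (1 - t ^ 2) + (4 * n + 9) * (t - t ^ 2) := by linarith
  positivity

/-- The hypotheses `h3` and `hmain` of `three_kernel_bound` for the moments of the weights `s^l`, of
the Gegenbauer kernel, of `s^{⌊n/2⌋}` and of the constant weight. Here `D = l + n/2` and
`d = ⌊n/2⌋ + n/2`. -/
lemma quartic_moment_inequalities {n D d E : ℝ} (hn : 3 ≤ n) (hD : 4 * (n + 2) ≤ D)
    (hd : d = n ∨ d = n - 1 / 2) (hE : E = D ^ 2 + 2 * D + n ^ 2 / 4 + n / 2) :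
    (n - 1) * (n + 3) / (2 * E) * (1 - (n + 1) / (2 * (D + 1))) ≤
      (n - 1) / (2 * d) * ((n + 1) / (2 * (d + 1)) - (n + 1) / (2 * (D + 1))) ∧
    2 * ((n - 1) / (2 * D)) * ((n - 1) / n * ((n + 1) / (n + 2)) -
        (n + 1) / (2 * (D + 1)) * ((n - 1) / n - (n - 1) * (n + 3) / (2 * E))) ≤
      4 * (n + 2) / D * (((n - 1) / (2 * d) - (n - 1) * (n + 3) / (2 * E)) *
        ((n - 1) / n * ((n + 1) / (n + 2))) - (n - 1) / (2 * d) * ((n + 1) / (2 * (d + 1))) *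
          ((n - 1) / n - (n - 1) * (n + 3) / (2 * E))) := by
  have hd1 : n - 1 / 2 ≤ d := by rcases hd with rfl | rfl <;> linarith
  have hd2 : d ≤ n := by rcases hd with rfl | rfl <;> linarith
  have hd0 : 0 < d := by linarith
  have hD0 : 0 < D := by linarith
  have hE0 : (D + 1) ^ 2 ≤ E := by rw [hE]; nlinarith
  have hEpos : 0 < E := lt_of_lt_of_le (by positivity) hE0
  clear hE
  obtain ⟨x, hx⟩ : ∃ x, x = 1 / (D + 1) := ⟨_, rfl⟩
  obtain ⟨e, he⟩ : ∃ e, e = 1 / E := ⟨_, rfl⟩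
  have hx0 : 0 < x := by rw [hx]; positivity
  have he0 : 0 < e := by rw [he]; positivity
  have hex : e ≤ x ^ 2 := by
    rw [he, hx, div_pow, one_pow]
    exact one_div_le_one_div_of_le (by positivity) hE0
  have hxD : x * (D + 1) = 1 := by rw [hx]; field_simp
  obtain ⟨q, hq⟩ : ∃ q, q = 1 / (d * (d + 1)) := ⟨_, rfl⟩
  have hq0 : 0 < q := by rw [hq]; positivity
  have hqd : q * (d * (d + 1)) = 1 := by rw [hq]; field_simp
  constructor
  · have hU : (n - 1) * (n + 3) / (2 * E) * (1 - (n + 1) / (2 * (D + 1))) ≤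
        (n - 1) * (n + 3) * x ^ 2 / 2 := by
      have h1 : 0 ≤ (n + 1) / (2 * (D + 1)) := by positivity
      have h2 : (n - 1) * (n + 3) / (2 * E) = (n - 1) * (n + 3) * e / 2 := by rw [he]; field_simp
      have h4 : 0 ≤ (n - 1) * (n + 3) := mul_nonneg (by linarith) (by linarith)
      rw [h2]
      refine (mul_le_of_le_one_right (by positivity) (by linarith)).trans ?_
      have := mul_le_mul_of_nonneg_left hex h4
      linarith
    have hV : (n - 1) / (2 * d) * ((n + 1) / (2 * (d + 1)) - (n + 1) / (2 * (D + 1))) =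
        (n - 1) * x / 4 * (q * ((n + 1) * (D - d))) := by
      rw [hq, hx]
      field_simp
      ring
    rw [hV]
    refine hU.trans ?_
    have h1 : (D - d) / n ≤ q * ((n + 1) * (D - d)) := by
      have : 1 / n ≤ q * (n + 1) := by
        rw [hq, div_mul_eq_mul_div, one_mul, div_le_div_iff₀ (by linarith) (by positivity)]
        nlinarith
      calc (D - d) / n = 1 / n * (D - d) := by ring
        _ ≤ q * (n + 1) * (D - d) := mul_le_mul_of_nonneg_right this (by linarith)
        _ = _ := by ring
    have h2 : 2 * (n + 3) * x ≤ (D - d) / n := by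
      rw [le_div_iff₀ (by linarith), hx, mul_one_div, div_mul_eq_mul_div, div_le_iff₀ (by linarith)]
      nlinarith
    have h3 := mul_le_mul_of_nonneg_left (h2.trans h1)
      (mul_nonneg (show 0 ≤ n - 1 by linarith) hx0.le)
    linarith
  · obtain ⟨ε, hε⟩ : ∃ ε, ε = n * (n + 3) * e / 2 := ⟨_, rfl⟩
    have hε0 : 0 < ε := by rw [hε]; positivity
    -- the claim after division by the common factor `hpre` below
    have key : 1 - (n + 2) * x / 2 * (1 - ε) ≤
        (n + 2) * (2 * d - n) * q + (n + 2) ^ 2 * q * ε - 2 * (n + 2) * (n + 3) * e := by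
      have h1 : 1 + 1 / (3 * n) ≤ (n + 2) * (2 * d - n) * q := by
        rw [hq, mul_one_div, le_div_iff₀ (by positivity),
          show 1 + 1 / (3 * n) = (3 * n + 1) / (3 * n) by field_simp, div_mul_eq_mul_div,
          div_le_iff₀ (by linarith)]
        rcases hd with rfl | rfl <;> nlinarith [mul_pos hd0 hd0]
      have h2 : 1 ≤ (n + 2) ^ 2 * q := by
        rw [hq, mul_one_div, le_div_iff₀ (by positivity)]
        nlinarith
      have h2' := mul_le_mul_of_nonneg_right h2 hε0.le
      have ht : (4 * n + 9) * x ≤ 1 := by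
        rw [← hxD]
        nlinarith
      have h3 : (n + 2) * x ≤ 1 := by nlinarith
      have h3' := mul_le_mul_of_nonneg_right h3 hε0.le
      have h4 : 2 * (n + 2) * (n + 3) * e ≤ 2 * (n + 2) * (n + 3) * x ^ 2 :=
        mul_le_mul_of_nonneg_left hex (by positivity)
      have h5 := quadratic_le_add_inv hn hx0 ht
      linarith
    have hpre : 0 ≤ (n - 1) / n * ((n - 1) * (n + 1) / ((n + 2) * D)) := by
      have : 0 ≤ n - 1 := by linarith
      positivity
    refine le_trans (le_of_eq ?_) ((mul_le_mul_of_nonneg_left key hpre).trans (le_of_eq ?_))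
    · rw [hε, he, hx]
      field_simp
    · rw [hε, he, hq]
      field_simp
      ring

end

/-! ### The bound on the pseudo-mean of the deviation -/

section

open Polynomial

variable {n : ℕ}

lemma zonalMean_gegenKernel_pos (hn : 2 ≤ n) (l : ℕ) : 0 < zonalMean n (gegenKernel n l) :=
  zonalMean_pos hn (fun _ hs => gegenKernel_nonneg n l hs.1) (gegenKernel_ne_zero n l)

lemma weightedMean_gegenKernel (hn : 2 ≤ n) (l : ℕ) :
    weightedMean n (gegenKernel n l) (1 - X) =
      ((n : ℝ) - 1) * (n + 3) / (2 * ((l : ℝ) * (l + n + 2)) + n * (n + 3)) := by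
  have : NeZero n := ⟨by omega⟩
  have h := gegenKernel_virial (n := n) l
  have h0 := zonalMean_gegenKernel_pos hn l
  have hn0 : 0 < (n : ℝ) := Nat.cast_pos.2 (NeZero.pos n)
  have h1 : 2 * ((l : ℝ) * (l + n + 2)) + n * (n + 3) ≠ 0 := by positivity
  rw [weightedMean_apply, mul_comm (gegenKernel n l)]
  field_simp
  linear_combination h

/-- The case of quadratic forms. -/
lemma IsPseudoDistribution.abs_sum_deviation_le_linear (hn : 3 ≤ n) {l : ℕ} (hl : 1 ≤ l)
    {c : USphere n →₀ ℝ} (hc : IsPseudoDistribution l c) {F : MvPolynomial (Fin n) ℝ}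
    {p : USphere n → ℝ[X]} (hp : ∀ y, IsZonalPoly F y 1 (p y)) (hF : UnitBounded F) :
    |∑ y ∈ c.support, c y * deviation n (X ^ l) (p y)| ≤ 2 * (n : ℝ) / (2 * l + n) := by
  have : NeZero n := ⟨by omega⟩
  have h := (hc.pseudoMeanBound_one hl).abs_sum_le (by omega) (deviation n (X ^ l))
    (κ := 0 + 2 * weightedMean n (X ^ l) (1 - X)) (fun q hd hq =>
      abs_deviation_le (zonalMean_X_pow_pos l) (X_pow_eval_nonneg l) fun s hs => by
        rw [zero_add]
        exact abs_eval_one_sub_le_of_natDegree_le_one hd hq hs.2) hp hF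
  refine h.trans ?_
  rw [mul_one, zero_add, weightedMean_X_pow_one_sub, ← mul_div_assoc]
  gcongr
  linarith

lemma IsPseudoDistribution.abs_sum_deviation_le_of_three_le (hn : 3 ≤ n) {a l : ℕ} (ha : 3 ≤ a)
    (hl : 2 * (a : ℝ) ^ 2 * (2 * a + n - 2) ≤ 2 * l + n)
    {c : USphere n →₀ ℝ} (hc : IsPseudoDistribution l c) {F : MvPolynomial (Fin n) ℝ}
    {p : USphere n → ℝ[X]} (hp : ∀ y, IsZonalPoly F y a (p y)) (hF : UnitBounded F) :
    |∑ y ∈ c.support, c y * deviation n (X ^ l) (p y)| ≤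
      2 * (a : ℝ) ^ 2 * (2 * a + n - 2) / (2 * l + n) := by
  have : NeZero n := ⟨by omega⟩
  have hn' : (3 : ℝ) ≤ n := by exact_mod_cast hn
  have hl0 : (0 : ℝ) ≤ l := l.cast_nonneg
  set U := weightedMean n (gegenKernel n l) (1 - X) with hU
  have hUe := weightedMean_gegenKernel (n := n) (by omega) l
  rw [← hU] at hUe
  have hU0 : 0 ≤ U := by
    rw [hUe]
    have : (0 : ℝ) ≤ n - 1 := by linarith
    positivity
  have hUD : U * (2 * (l : ℝ) + n) ^ 2 ≤ 2 * ((n : ℝ) - 1) * (n + 3) := by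
    rw [hUe, div_mul_eq_mul_div, div_le_iff₀ (by positivity)]
    have h1 : (2 * (l : ℝ) + n) ^ 2 ≤ 2 * (2 * ((l : ℝ) * (l + n + 2)) + n * (n + 3)) := by
      nlinarith
    have h2 : 0 ≤ ((n : ℝ) - 1) * (n + 3) := mul_nonneg (by linarith) (by linarith)
    calc ((n : ℝ) - 1) * (n + 3) * (2 * (l : ℝ) + n) ^ 2 ≤
        ((n : ℝ) - 1) * (n + 3) * (2 * (2 * ((l : ℝ) * (l + n + 2)) + n * (n + 3))) :=
          mul_le_mul_of_nonneg_left h1 h2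
      _ = _ := by ring
  obtain ⟨hκ, hfin⟩ := large_degree_bound (a := a) (by exact_mod_cast ha) hn' hl hU0 hUD
  have hN : PseudoMeanBound c a (1 - 2 * (a : ℝ) ^ 2 * U)⁻¹ := by
    refine pseudoMeanBound_of_kernel (by omega) hκ hc.sum_eq_one
      (zonalMean_gegenKernel_pos (by omega) l) hc.gegenKernel_nonneg fun q hd hq => ?_
    have := abs_deviation_le (zonalMean_gegenKernel_pos (n := n) (by omega) l)
      (fun s hs => RealDeFinetti.gegenKernel_nonneg n l hs.1) (p := q) (α := 0)
      (β := 2 * (a : ℝ) ^ 2) fun s hs =>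
        (abs_eval_one_sub_le (by omega) hd hq hs (y := 0) (by norm_num)).trans_eq (by ring)
    rwa [zero_add] at this
  -- the mean of `a² (1 - s)` under the weight `s^l`, where the tangent line is taken
  set Y := (a : ℝ) ^ 2 * (((n : ℝ) - 1) / (2 * l + n)) with hY
  have hY2 : Y ≤ 2 := by
    have ha2 : (0 : ℝ) ≤ (a : ℝ) ^ 2 := by positivity
    have ha3 : (3 : ℝ) ≤ a := by exact_mod_cast ha
    rw [hY, mul_div_assoc', div_le_iff₀ (by positivity)]
    nlinarith
  refine (hN.abs_sum_le (by omega) (deviation n (X ^ l)) (κ := 2 * Y - Y ^ 2 / 2)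
    (fun q hd hq => ?_) hp hF).trans hfin
  refine (abs_deviation_le (zonalMean_X_pow_pos l) (X_pow_eval_nonneg l)
    (α := Y ^ 2 / 2) (β := (2 - Y) * (a : ℝ) ^ 2)
    fun s hs => (abs_eval_one_sub_le (by omega) hd hq hs hY2).trans_eq (by ring)).trans_eq ?_
  rw [weightedMean_X_pow_one_sub, mul_assoc, ← hY]
  ring

lemma exists_quadratic_in_one_sub {p : ℝ[X]} (hp : p.natDegree ≤ 2) :
    ∃ A B D : ℝ, p = C A + C B * (1 - X) + C D * (1 - X) ^ 2 := by
  refine ⟨p.coeff 0 + p.coeff 1 + p.coeff 2, -(p.coeff 1 + 2 * p.coeff 2), p.coeff 2, ?_⟩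
  conv_lhs => rw [p.as_sum_range_C_mul_X_pow' (n := 3) (by omega)]
  simp only [Finset.sum_range_succ, Finset.sum_range_zero, zero_add, pow_zero, mul_one, pow_one,
    C_add, C_neg, C_mul]
  rw [show (C (2 : ℝ) : ℝ[X]) = 2 from rfl]
  ring

/-- The case of quartic forms. -/
lemma IsPseudoDistribution.abs_sum_deviation_le_quadratic (hn : 3 ≤ n) {l : ℕ}
    (hl : 8 * ((n : ℝ) + 2) ≤ 2 * l + n)
    {c : USphere n →₀ ℝ} (hc : IsPseudoDistribution l c) {F : MvPolynomial (Fin n) ℝ}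
    {p : USphere n → ℝ[X]} (hp : ∀ y, IsZonalPoly F y 2 (p y)) (hF : UnitBounded F) :
    |∑ y ∈ c.support, c y * deviation n (X ^ l) (p y)| ≤ 8 * ((n : ℝ) + 2) / (2 * l + n) := by
  have : NeZero n := ⟨by omega⟩
  have hn' : (3 : ℝ) ≤ n := by exact_mod_cast hn
  have hl0 : (0 : ℝ) ≤ l := l.cast_nonneg
  choose A B D hABD using fun y => exists_quadratic_in_one_sub (hp y).1
  -- the weighted means depend on the zonal polynomials only through the sums of their coefficients
  have hmean : ∀ w : ℝ[X], 0 < zonalMean n w → ∑ y ∈ c.support, c y * weightedMean n w (p y) =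
      ∑ y ∈ c.support, c y * A y + (∑ y ∈ c.support, c y * B y) * weightedMean n w (1 - X) +
        (∑ y ∈ c.support, c y * D y) * weightedMean n w ((1 - X) ^ 2) := by
    intro w hw
    simp only [Finset.sum_mul, ← Finset.sum_add_distrib]
    refine Finset.sum_congr rfl fun y _ => ?_
    rw [hABD y, map_add, map_add, weightedMean_C hw, C_mul', C_mul', map_smul, map_smul,
      smul_eq_mul, smul_eq_mul]
    ring
  have hdev : ∑ y ∈ c.support, c y * deviation n (X ^ l) (p y) =
      -((∑ y ∈ c.support, c y * B y) * weightedMean n (X ^ l) (1 - X) +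
        (∑ y ∈ c.support, c y * D y) * weightedMean n (X ^ l) ((1 - X) ^ 2)) := by
    have h1 : ∑ y ∈ c.support, c y * deviation n (X ^ l) (p y) = ∑ y ∈ c.support, c y * A y -
        ∑ y ∈ c.support, c y * weightedMean n (X ^ l) (p y) := by
      rw [← Finset.sum_sub_distrib]
      refine Finset.sum_congr rfl fun y _ => ?_
      have : (p y).eval 1 = A y := by
        rw [hABD y]
        simp
      rw [deviation_apply, this]
      ring
    rw [h1, hmean _ (zonalMean_X_pow_pos l)]
    ring
  have hbd : ∀ w : ℝ[X], 0 < zonalMean n w → (∀ x : USphere n, 0 ≤ ∑ y ∈ c.support, c y * w.eval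
      (inner ℝ (x : EuclideanSpace ℝ (Fin n)) (y : EuclideanSpace ℝ (Fin n)) ^ 2)) →
      |∑ y ∈ c.support, c y * A y + (∑ y ∈ c.support, c y * B y) * weightedMean n w (1 - X) +
        (∑ y ∈ c.support, c y * D y) * weightedMean n w ((1 - X) ^ 2)| ≤ 1 := fun w hw hpos => by
    rw [← hmean w hw]
    exact abs_sum_weightedMean_le hc.sum_eq_one hw hpos hp hF
  rw [hdev, abs_neg]
  -- the weight `s^{⌊n/2⌋}`, whose moments are expressed by `d`
  set d : ℝ := ((n / 2 : ℕ) : ℝ) + n / 2 with hd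
  have hdn : d = n ∨ d = n - 1 / 2 := by
    rcases Nat.even_or_odd' n with ⟨k, rfl | rfl⟩
    · left
      rw [hd, Nat.mul_div_cancel_left k two_pos]
      push_cast
      ring
    · right
      rw [hd, show (2 * k + 1) / 2 = k by omega]
      push_cast
      ring
  have hjl : n / 2 ≤ l := by
    have h2 : (n : ℝ) ≤ l := by linarith
    have : n ≤ l := by exact_mod_cast h2
    omega
  set δ : ℝ := l + n / 2 with hδ
  set E : ℝ := δ ^ 2 + 2 * δ + (n : ℝ) ^ 2 / 4 + n / 2 with hE
  have hδ4 : 4 * ((n : ℝ) + 2) ≤ δ := by rw [hδ]; linarith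
  obtain ⟨h3, hmain⟩ := quartic_moment_inequalities hn' hδ4 hdn hE
  have hd0 : 0 < d := by rcases hdn with h | h <;> linarith
  have hdn' : d ≤ n := by rcases hdn with h | h <;> linarith
  have hd2 : (n : ℝ) / 2 < d := by rcases hdn with h | h <;> linarith
  have hδ0 : 0 < δ := by linarith
  have hE0 : 0 < E := by positivity
  have hn1 : 0 < (n : ℝ) - 1 := by linarith
  -- the first and second moment of `1 - s` under the weight `s^k`, in terms of `r = k + n/2`
  have hXpow : ∀ k : ℕ, ∀ r : ℝ, r = k + (n : ℝ) / 2 →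
      weightedMean n (X ^ k) (1 - X) = ((n : ℝ) - 1) / (2 * r) ∧
      weightedMean n (X ^ k) ((1 - X) ^ 2) =
        ((n : ℝ) - 1) / (2 * r) * (((n : ℝ) + 1) / (2 * (r + 1))) := by
    rintro k r rfl
    rw [weightedMean_X_pow_one_sub, weightedMean_X_pow_one_sub_sq]
    constructor
    · congr 1
      ring
    · rw [div_mul_div_comm]
      congr 1 <;> ring
  have hUe : weightedMean n (gegenKernel n l) (1 - X) = ((n : ℝ) - 1) * (n + 3) / (2 * E) := by
    rw [weightedMean_gegenKernel (by omega), hE, hδ]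
    congr 1
    ring
  have hgp := zonalMean_gegenKernel_pos (n := n) (by omega) l
  have hg0 : ∀ s ∈ Set.Icc (0 : ℝ) 1, 0 ≤ (gegenKernel n l).eval s :=
    fun s hs => RealDeFinetti.gegenKernel_nonneg n l hs.1
  have hU2 : 0 ≤ weightedMean n (gegenKernel n l) ((1 - X) ^ 2) := by
    rw [← map_zero (weightedMean n (gegenKernel n l))]
    refine weightedMean_mono hgp hg0 fun s _ => ?_
    simp only [eval_zero, eval_pow]
    positivity
  have hUU : weightedMean n (gegenKernel n l) ((1 - X) ^ 2) ≤
      weightedMean n (gegenKernel n l) (1 - X) := by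
    refine weightedMean_mono hgp hg0 fun s hs => ?_
    simp only [eval_pow, eval_sub, eval_one, eval_X]
    nlinarith [hs.1, hs.2]
  have ha1 := hbd _ hgp hc.gegenKernel_nonneg
  have ha2 := hbd _ (zonalMean_X_pow_pos (n / 2)) (hc.X_pow_nonneg hjl)
  have ha3 := hbd _ (zonalMean_X_pow_pos 0) (hc.X_pow_nonneg (Nat.zero_le l))
  rw [(hXpow l δ hδ).1, (hXpow l δ hδ).2]
  rw [(hXpow _ d hd).1, (hXpow _ d hd).2] at ha2
  have e0 : ((n : ℝ) - 1) / (2 * (n / 2)) = (n - 1) / n := by congr 1; ring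
  have e1 : ((n : ℝ) + 1) / (2 * ((n : ℝ) / 2 + 1)) = (n + 1) / (n + 2) := by congr 1; ring
  rw [(hXpow 0 ((n : ℝ) / 2) (by simp)).1, (hXpow 0 ((n : ℝ) / 2) (by simp)).2, e0, e1] at ha3
  rw [hUe] at ha1 hUU
  have hb : 8 * ((n : ℝ) + 2) / (2 * l + n) = 4 * (n + 2) / δ := by
    rw [hδ, div_eq_div_iff (by positivity) (by positivity)]
    ring
  rw [hb]
  refine three_kernel_bound (by positivity) (by positivity) ?_ ?_ ?_ hU2 hUU (by positivity)
    h3 hmain ha1 ha2 ha3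
  · exact div_le_div_of_nonneg_left hn1.le (by linarith) (by linarith)
  · exact div_le_div_of_nonneg_left (by positivity) (by linarith) (by linarith)
  · exact div_lt_div_of_pos_left (by positivity) (by linarith) (by linarith)

lemma IsPseudoDistribution.abs_sum_deviation_le (hn : 3 ≤ n) {a l : ℕ} (hal : a < l)
    (hl : 2 * (a : ℝ) ^ 2 * (2 * a + n - 2) ≤ 2 * l + n)
    {c : USphere n →₀ ℝ} (hc : IsPseudoDistribution l c) {F : MvPolynomial (Fin n) ℝ}
    {p : USphere n → ℝ[X]} (hp : ∀ y, IsZonalPoly F y a (p y)) (hF : UnitBounded F) :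
    |∑ y ∈ c.support, c y * deviation n (X ^ l) (p y)| ≤
      2 * (a : ℝ) ^ 2 * (2 * a + n - 2) / (2 * l + n) := by
  have : NeZero n := ⟨by omega⟩
  rcases (show a = 0 ∨ a = 1 ∨ a = 2 ∨ 3 ≤ a by omega) with rfl | rfl | rfl | ha
  · have h0 : ∀ y, deviation n (X ^ l) (p y) = 0 := fun y => by
      rw [eq_C_of_natDegree_le_zero (hp y).1, deviation_apply,
        weightedMean_C (zonalMean_X_pow_pos l), eval_C, sub_self]
    simp [h0]
  · refine (hc.abs_sum_deviation_le_linear hn (by omega) hp hF).trans_eq ?_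
    congr 1
    push_cast
    ring
  · push_cast at hl ⊢
    refine (hc.abs_sum_deviation_le_quadratic hn (by linarith) hp hF).trans_eq ?_
    congr 1
    ring
  · exact hc.abs_sum_deviation_le_of_three_le hn ha hl hp hF

lemma trace_le_of_mem_f1Values (hn : 3 ≤ n) {a l : ℕ} (hal : a < l)
    (hl : 2 * (a : ℝ) ^ 2 * (2 * a + n - 2) ≤ 2 * l + n) {M : TensorMatrix n l}
    (hsym : IsMaxSym M) (hM : IsState M) {r : ℝ}
    (hr : r ∈ f1Values (reducedMatrix a hal.le M - approxMatrix a M)) :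
    r ≤ 2 * (a : ℝ) ^ 2 * (2 * a + n - 2) / (2 * l + n) := by
  have : NeZero n := ⟨by omega⟩
  obtain ⟨F, hF, hF1, rfl⟩ := hr
  obtain ⟨c, rfl⟩ := hsym.exists_signed_representation
  choose p hp using fun y => exists_isZonalPoly (n := n) (by omega) hF y
  rw [trace_polyMatrix_mul_sub (by omega) hal.le c hF hp]
  exact (le_abs_self _).trans (hM.isPseudoDistribution.abs_sum_deviation_le hn hal hl hp
    (unitBounded_of_sphereSupNorm_le hF1))

end

end RealDeFinetti

theorem theorem5p2 (n a l : ℕ) (hn : 3 ≤ n) (hal : a < l)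
    (hl : 2 * (a : ℝ) ^ 2 * ((a : ℝ) + (n : ℝ) / 2 - 1) - (n : ℝ) / 2 ≤ (l : ℝ))
    (M : TensorMatrix n l) (hMsym : IsMaxSym M) (hMstate : IsState M) :
    (BddAbove (f1Values (reducedMatrix a hal.le M - approxMatrix a M)) ∧
      f1Norm (reducedMatrix a hal.le M - approxMatrix a M) ≤
        4 * (a : ℝ) ^ 2 * ((a : ℝ) + (n : ℝ) / 2 - 1) / (2 * (l : ℝ) + (n : ℝ))) ∧
    IsState (approxMatrix a M) ∧
    HasPositivePRep (approxMatrix a M) ∧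
    IsMomentMatrix (approxMatrix a M) := by
  have hb : ∀ r ∈ f1Values (reducedMatrix a hal.le M - approxMatrix a M),
      r ≤ 4 * (a : ℝ) ^ 2 * ((a : ℝ) + (n : ℝ) / 2 - 1) / (2 * (l : ℝ) + (n : ℝ)) := fun r hr => by
    refine (trace_le_of_mem_f1Values hn hal (by linarith) hMsym hMstate hr).trans_eq ?_
    congr 1
    ring
  have hne : (f1Values (reducedMatrix a hal.le M - approxMatrix a M)).Nonempty :=
    ⟨_, 0, MvPolynomial.isHomogeneous_zero _ _ _, by simp [sphereSupNorm], rfl⟩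
  exact ⟨⟨⟨_, hb⟩, csSup_le hne hb⟩, isState_approxMatrix (by omega) a hMsym hMstate,
    hasPositivePRep_approxMatrix (by omega) a hMstate,
    isMomentMatrix_approxMatrix (by omega) a hMsym hMstate⟩
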